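/- Let $\kappa_0>0$, $\kappa<0$, $b>0$ and $\gamma_0,\gamma_1,Q_e,Q_m,\Phi_1\in\mathbb R$; put $Q^2=Q_e^2+Q_m^2$, $\epsilon^2=\kappa_0Q^2/(2b^2)$ and assume the subcritical case $\gamma_1^2-e^{2\gamma_0}\epsilon^2=:\Lambda^2>0$, $\Lambda>0$, together with $\frac{\tanh(\Lambda\pi/2)}{\Lambda}|\gamma_1|<1$ and $-\kappa\Phi_1^2=2(1+\Lambda^2)$. Let $y=\arctan(x/b)$ and $$d=\gamma_0-\log\Big[\cosh(\Lambda y)-\gamma_1\tfrac{\sinh(\Lambda y)}{\Lambda}\Big],\quad a=-d,\quad c=\log\sqrt{x^2+b^2}-d,\quad \Phi=\Phi_1y ,$$ the static charged ghost-scalar wormhole with metric $-e^{2d}dt^2+e^{2a}dx^2+e^{2c}d\Omega^2$. Write $f_y=\frac{x^2+b^2}{b}f_x$, $\partial=e^{d-a}\partial_x=e^{2d}\partial_x$, and $$F=1+\tfrac xb y-\frac{y\,c_y}{1+\Lambda^2},\quad G=e^{-c}\frac{\Lambda^2}{1+\Lambda^2}\Big(1+\tfrac xb y\Big),\quad H=e^{-c}F,$$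 $$W=b^2e^{-4c}\Big\{-3(1+\Lambda^2)+2d_y(d_y-c_y)-4\tfrac GH\,[c_yd_y+1+\Lambda^2]+2c_y^2\big(\tfrac GH\big)^2\Big\},\qquad \chi_0=\frac{c_y}{e^cF}.$$ Consider $-\partial^2+W$ on $X=L^2(\mathbb R,e^{-2d}dx)$ (complex valued, derivatives in the distributional sense, domain all $f\in X$ with $-\partial^2f+Wf\in X$) and master equation II, $(\partial_t^2-\partial^2+W)\chi=0$. Then: 1. $F>0$ everywhere and $W$ is smooth. 2. $\chi_0$ is smooth, $-\partial^2\chi_0+W\chi_0=0$, $\chi_0\in X\setminus\{0\}$ is an eigenfunction with eigenvalue $0$, and $\chi_0$ has exactly one zero. 3. There are $\beta>0$ and a smooth real function $\chi_\beta\in X\setminus\{0\}$ such that $-\beta^2$ is the only negative eigenvalue of $-\partial^2+W$ and $-\partial^2\chi_\beta+W\chi_\beta=-\beta^2\chi_\beta$. The function $e^{\beta t}\chi_\beta(x)$ solves master equation II, and it is the unique growing mode: if $s\in\mathbb C$, $\operatorname{Re}s>0$, and $f\in X\setminus\{0\}$ satisfies $-\partial^2f+Wf=-s^2f$, then $s=\beta$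 and $f$ is a complex multiple of $\chi_\beta$. 4. The wormhole is linearly unstable under spherically symmetric perturbations, with a unique unstable mode. Consider the equations for $(d,a,c,\Phi)(t,x)$ $$\partial_t(e^{a-d}a_t)-\partial_x(e^{d-a}d_x)-e^{a-d}c_t^2+e^{d-a}c_x^2-e^{a+d-2c}=-\kappa_0Q^2e^{a+d-4c}-\tfrac\kappa2\big[e^{a-d}\Phi_t^2-e^{d-a}\Phi_x^2\big],$$ $$\partial_t(e^{a-d+2c}c_t)-\partial_x(e^{d-a+2c}c_x)=-e^{a+d}+\tfrac{\kappa_0}2Q^2e^{a+d-2c},\qquad \partial_t(e^{a-d+2c}\Phi_t)-\partial_x(e^{d-a+2c}\Phi_x)=0,$$ $$e^{d-a}[2c_{xx}+(3c_x-2a_x)c_x]-e^{a-d}c_t(2a_t+c_t)-e^{a+d-2c}+\tfrac{\kappa_0}2Q^2e^{a+d-4c}+\tfrac\kappa2\big[e^{a-d}\Phi_t^2+e^{d-a}\Phi_x^2\big]=0,$$ $$2c_{tx}+2c_tc_x-2d_xc_t-2a_tc_x+\kappa\Phi_t\Phi_x=0,$$ i.e. the spherically symmetric Einstein–Maxwell–ghost-scalar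 evolution equations and constraints, linearized at the wormhole with the charges fixed. For a smooth perturbation let $A=\delta a-e^{-a}(e^a\delta\Phi/\Phi_x)_x$ and $C=\delta c-c_x\delta\Phi/\Phi_x$ be its gauge-invariant amplitudes, $u_1=e^{-c}(A-C)$, $u_2=e^{-c}C$. (a) There are real functions $A_\beta,C_\beta,w_\beta$ of $x$, with $A_\beta,C_\beta$ not both identically zero, such that $\delta\Phi=0$, $\delta a=e^{\beta t}A_\beta$, $\delta c=e^{\beta t}C_\beta$, $\delta d=e^{\beta t}(A_\beta-2C_\beta)$ is a smooth solution of the linearized equations. It is generated by $\chi=e^{\beta t}\chi_\beta$: with $w=e^{\beta t}w_\beta$, $$\partial_tu_1=\partial_t\chi+be^{-2c}\tfrac GHw,\quad \partial_tu_2=be^{-2c}w,\quad \partial_tw=c_y\partial\chi+be^{-2c}\Big(\tfrac GHc_y^2-c_yd_y-1-\Lambda^2\Big)\chi ,$$ and $\chi=u_1-\frac GHu_2$. (b) Conversely, let $s\in\mathbb C$ with $\operatorname{Re}s>0$, and let $e^{st}(D,\mathcal A,\mathcal C,\varphi)(x)$ be a complex perturbation $(\delta d,\delta a,\delta c,\delta\Phi)$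 whose real and imaginary parts are smooth solutions of the linearized equations. Let $e^{st}A(x)$ and $e^{st}C(x)$ be its gauge-invariant amplitudes. If $A,C$ are not both identically zero and $e^{-c}(A-C)-\frac GHe^{-c}C\in X$, then $s=\beta$ and $(A,C)=k\,(A_\beta,C_\beta)$ for some $k\in\mathbb C$. -/

import Mathlib

open MeasureTheory Set
open scoped ContDiff

noncomputable section

namespace GhostWormhole

/-- Parameters of the static, spherically symmetric, charged ghost-scalar wormholes: the coupling
constants `κ₀` (electromagnetic) and `κ` (scalar), the scale `b`, the initial values
`γ₀ = d(0)`, `γ₁ = d_y(0)`, the electric and magnetic charges, and the scalar amplitude. -/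
structure Params where
  κ₀ : ℝ
  κ : ℝ
  b : ℝ
  γ₀ : ℝ
  γ₁ : ℝ
  Qe : ℝ
  Qm : ℝ
  Φ₁ : ℝ

namespace Params

variable (p : Params)

/-- The square of the total charge, `Q² = Qe² + Qm²`. -/
def Qsq : ℝ := p.Qe ^ 2 + p.Qm ^ 2

/-- `ε² = κ₀ Q² / (2 b²)`. -/
def εsq : ℝ := p.κ₀ * p.Qsq / (2 * p.b ^ 2)

/-- `Λ = √(γ₁² - e^{2γ₀} ε²)`. It is positive exactly when the radicand is. -/
def Λ : ℝ := Real.sqrt (p.γ₁ ^ 2 - Real.exp (2 * p.γ₀) * p.εsq)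

/-- The parameters describe a globally regular wormhole solution in the subcritical case. -/
structure IsSubcriticalWormhole : Prop where
  κ₀_pos : 0 < p.κ₀
  κ_neg : p.κ < 0
  b_pos : 0 < p.b
  subcritical : 0 < p.Λ
  regular : Real.tanh (p.Λ * (Real.pi / 2)) / p.Λ * |p.γ₁| < 1
  scalar : -p.κ * p.Φ₁ ^ 2 = 2 * (1 + p.Λ ^ 2)

/-! ### The static background
The metric is `-e^{2d} dt² + e^{2a} dx² + e^{2c} dΩ²` with `a = -d`, `e^{2c} = (x² + b²) e^{-2d}`. -/

/-- `y = arctan (x / b)`. -/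
def y (x : ℝ) : ℝ := Real.arctan (x / p.b)

def d (x : ℝ) : ℝ :=
  p.γ₀ - Real.log (Real.cosh (p.Λ * p.y x) - p.γ₁ * (Real.sinh (p.Λ * p.y x) / p.Λ))

def a (x : ℝ) : ℝ := -p.d x

def c (x : ℝ) : ℝ := Real.log (Real.sqrt (x ^ 2 + p.b ^ 2)) - p.d x

/-- The background scalar field. -/
def Φ (x : ℝ) : ℝ := p.Φ₁ * p.y x

/-- `∂_y = ((x² + b²) / b) ∂_x`. -/
def derivY (f : ℝ → ℝ) (x : ℝ) : ℝ := (x ^ 2 + p.b ^ 2) / p.b * deriv f x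

def cy : ℝ → ℝ := p.derivY p.c

def dy : ℝ → ℝ := p.derivY p.d

/-- `∂ = e^{d-a} ∂_x = e^{2d} ∂_x`. -/
def del (f : ℝ → ℝ) (x : ℝ) : ℝ := Real.exp (p.d x - p.a x) * deriv f x

/-- `F = 1 + (x/b) y - y c_y / (1 + Λ²)`. -/
def F (x : ℝ) : ℝ := 1 + x / p.b * p.y x - p.y x * p.cy x / (1 + p.Λ ^ 2)

def G (x : ℝ) : ℝ := Real.exp (-p.c x) * (p.Λ ^ 2 / (1 + p.Λ ^ 2) * (1 + x / p.b * p.y x))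

def H (x : ℝ) : ℝ := Real.exp (-p.c x) * p.F x

/-- The potential of master equation II. The scale `b` is kept general here: replacing
`(t, x, γ₀)` by `(b t, x / b, γ₀ - log b)` reduces everything to `b = 1`, where
`∂ = e^{-2c} ∂_y`; since here `∂ = b e^{-2c} ∂_y`, the potential carries the factor `b²`. -/
def W (x : ℝ) : ℝ :=
  p.b ^ 2 * Real.exp (-4 * p.c x) *
    (-3 * (1 + p.Λ ^ 2) + 2 * p.dy x * (p.dy x - p.cy x)
      - 4 * (p.G x / p.H x) * (p.cy x * p.dy x + 1 + p.Λ ^ 2)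
      + 2 * p.cy x ^ 2 * (p.G x / p.H x) ^ 2)

/-- The zero mode `χ₀ = c_y / (e^c F)`. -/
def χ₀ (x : ℝ) : ℝ := p.cy x / (Real.exp (p.c x) * p.F x)

/-! ### The Schrödinger operator `-∂² + W` on `X = L²(ℝ, e^{-2d} dx)` -/

/-- The measure `e^{-2d} dx`. -/
def μ : Measure ℝ := volume.withDensity fun x => ENNReal.ofReal (Real.exp (-2 * p.d x))

/-- `-∂²f + W f` for classically differentiable `f`. -/
def schrodinger (f : ℝ → ℝ) (x : ℝ) : ℝ := -p.del (p.del f) x + p.W x * f x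

/-- `f ∈ X` is in the domain of the operator `-∂² + W` on `X` (all derivatives being taken in the
distributional sense), and `g ∈ X` is its image. The operator is formally self-adjoint
with respect to `e^{-2d} dx`, and test functions are smooth with compact support. -/
def SchrodingerGraph (f g : ℝ → ℂ) : Prop :=
  MemLp f 2 p.μ ∧ MemLp g 2 p.μ ∧
    ∀ φ : ℝ → ℝ, ContDiff ℝ ∞ φ → HasCompactSupport φ →
      ∫ x, f x * (p.schrodinger φ x : ℂ) ∂p.μ = ∫ x, g x * (φ x : ℂ) ∂p.μ

/-- `f` is an eigenfunction of `-∂² + W` on `X` with eigenvalue `E`. -/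
def IsEigenfunction (E : ℂ) (f : ℝ → ℂ) : Prop :=
  ¬ (f =ᵐ[p.μ] 0) ∧ p.SchrodingerGraph f (fun x => E * f x)

def IsEigenvalue (E : ℂ) : Prop := ∃ f, p.IsEigenfunction E f

/-- Master equation II, `(∂_t² - ∂² + W) χ = 0`, for `χ = χ(t, x)`. -/
def MasterEquationII (χ : ℝ → ℝ → ℝ) : Prop :=
  ∀ t x, deriv (deriv fun s => χ s x) t - p.del (p.del (χ t)) x + p.W x * χ t x = 0

/-- The first-order system that determines `u₁`, `u₂` and `w = c_y v₁` from `χ`. -/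
def FirstOrderSystem (χ u₁ u₂ w : ℝ → ℝ → ℝ) : Prop :=
  ∀ t x,
    deriv (fun s => u₁ s x) t = deriv (fun s => χ s x) t
      + p.b * Real.exp (-2 * p.c x) * (p.G x / p.H x) * w t x ∧
    deriv (fun s => u₂ s x) t = p.b * Real.exp (-2 * p.c x) * w t x ∧
    deriv (fun s => w s x) t = p.cy x * p.del (χ t) x
      + p.b * Real.exp (-2 * p.c x)
        * (p.G x / p.H x * p.cy x ^ 2 - p.cy x * p.dy x - 1 - p.Λ ^ 2) * χ t x

end Params

/-! ### The spherically symmetric field equations and their linearization -/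

/-- The fields `d, a, c, Φ` as functions of `(t, x)`. -/
structure Fields where
  d : ℝ → ℝ → ℝ
  a : ℝ → ℝ → ℝ
  c : ℝ → ℝ → ℝ
  Φ : ℝ → ℝ → ℝ

def Dt (f : ℝ → ℝ → ℝ) (t x : ℝ) : ℝ := deriv (fun s => f s x) t

def Dx (f : ℝ → ℝ → ℝ) (t x : ℝ) : ℝ := deriv (f t) x

namespace Fields

/-- All four fields are smooth functions on the `(t, x)`-plane. -/
def Smooth (S : Fields) : Prop :=
  ContDiff ℝ ∞ (Function.uncurry S.d) ∧ ContDiff ℝ ∞ (Function.uncurry S.a) ∧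
    ContDiff ℝ ∞ (Function.uncurry S.c) ∧ ContDiff ℝ ∞ (Function.uncurry S.Φ)

/-- `S + l • T`. -/
def perturb (S T : Fields) (l : ℝ) : Fields where
  d := fun t x => S.d t x + l * T.d t x
  a := fun t x => S.a t x + l * T.a t x
  c := fun t x => S.c t x + l * T.c t x
  Φ := fun t x => S.Φ t x + l * T.Φ t x

end Fields

variable (p : Params)

/-- The static wormhole. -/
def Params.background : Fields where
  d := fun _ x => p.d x
  a := fun _ x => p.a x
  c := fun _ x => p.c x
  Φ := fun _ x => p.Φ x

/-- Evolution equation for `a` (difference of its two sides). -/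
def Params.evolutionA (S : Fields) (t x : ℝ) : ℝ :=
  Dt (fun t x => Real.exp (S.a t x - S.d t x) * Dt S.a t x) t x
    - Dx (fun t x => Real.exp (S.d t x - S.a t x) * Dx S.d t x) t x
    - Real.exp (S.a t x - S.d t x) * Dt S.c t x ^ 2
    + Real.exp (S.d t x - S.a t x) * Dx S.c t x ^ 2
    - Real.exp (S.a t x + S.d t x - 2 * S.c t x)
    + p.κ₀ * p.Qsq * Real.exp (S.a t x + S.d t x - 4 * S.c t x)
    + p.κ / 2 * (Real.exp (S.a t x - S.d t x) * Dt S.Φ t x ^ 2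
        - Real.exp (S.d t x - S.a t x) * Dx S.Φ t x ^ 2)

/-- Evolution equation for `c` (difference of its two sides). -/
def Params.evolutionC (S : Fields) (t x : ℝ) : ℝ :=
  Dt (fun t x => Real.exp (S.a t x - S.d t x + 2 * S.c t x) * Dt S.c t x) t x
    - Dx (fun t x => Real.exp (S.d t x - S.a t x + 2 * S.c t x) * Dx S.c t x) t x
    + Real.exp (S.a t x + S.d t x)
    - p.κ₀ / 2 * p.Qsq * Real.exp (S.a t x + S.d t x - 2 * S.c t x)

/-- Wave equation for `Φ`. -/
def evolutionΦ (S : Fields) (t x : ℝ) : ℝ :=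
  Dt (fun t x => Real.exp (S.a t x - S.d t x + 2 * S.c t x) * Dt S.Φ t x) t x
    - Dx (fun t x => Real.exp (S.d t x - S.a t x + 2 * S.c t x) * Dx S.Φ t x) t x

/-- Hamiltonian constraint. -/
def Params.hamiltonian (S : Fields) (t x : ℝ) : ℝ :=
  Real.exp (S.d t x - S.a t x)
      * (2 * Dx (Dx S.c) t x + (3 * Dx S.c t x - 2 * Dx S.a t x) * Dx S.c t x)
    - Real.exp (S.a t x - S.d t x) * Dt S.c t x * (2 * Dt S.a t x + Dt S.c t x)
    - Real.exp (S.a t x + S.d t x - 2 * S.c t x)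
    + p.κ₀ / 2 * p.Qsq * Real.exp (S.a t x + S.d t x - 4 * S.c t x)
    + p.κ / 2 * (Real.exp (S.a t x - S.d t x) * Dt S.Φ t x ^ 2
        + Real.exp (S.d t x - S.a t x) * Dx S.Φ t x ^ 2)

/-- Momentum constraint. -/
def Params.momentum (S : Fields) (t x : ℝ) : ℝ :=
  2 * Dt (Dx S.c) t x + 2 * Dt S.c t x * Dx S.c t x - 2 * Dx S.d t x * Dt S.c t x
    - 2 * Dt S.a t x * Dx S.c t x + p.κ * (Dt S.Φ t x * Dx S.Φ t x)

/-- The smooth perturbation `δ` solves the field equations (evolution equations and constraints)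
linearized at the static wormhole, with the charges held fixed. -/
def Params.IsLinearizedSolution (δ : Fields) : Prop :=
  δ.Smooth ∧ ∀ t x,
    HasDerivAt (fun l => p.evolutionA (p.background.perturb δ l) t x) 0 0 ∧
    HasDerivAt (fun l => p.evolutionC (p.background.perturb δ l) t x) 0 0 ∧
    HasDerivAt (fun l => evolutionΦ (p.background.perturb δ l) t x) 0 0 ∧
    HasDerivAt (fun l => p.hamiltonian (p.background.perturb δ l) t x) 0 0 ∧
    HasDerivAt (fun l => p.momentum (p.background.perturb δ l) t x) 0 0

/-- The complex spatial profile of a perturbation `(δd, δa, δc, δΦ)`. -/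
structure Profile where
  d : ℝ → ℂ
  a : ℝ → ℂ
  c : ℝ → ℂ
  Φ : ℝ → ℂ

namespace Profile

/-- The real perturbation `Re (z e^{st} P(x))`. -/
def mode (P : Profile) (s z : ℂ) : Fields where
  d := fun t x => (z * Complex.exp (s * t) * P.d x).re
  a := fun t x => (z * Complex.exp (s * t) * P.a x).re
  c := fun t x => (z * Complex.exp (s * t) * P.c x).re
  Φ := fun t x => (z * Complex.exp (s * t) * P.Φ x).re

end Profile

namespace Params

/-- `e^{st} P(x)` is a (complex) mode of the linearized field equations: its real and imaginary
part, and hence all real combinations of them, are linearized solutions. -/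
def IsMode (s : ℂ) (P : Profile) : Prop := ∀ z : ℂ, p.IsLinearizedSolution (P.mode s z)

/-- The gauge-invariant amplitude `A = δa - e^{-a} (e^a δΦ / Φ_x)_x`. -/
def gaugeA (P : Profile) (x : ℝ) : ℂ :=
  P.a x - (Real.exp (-p.a x) : ℂ)
    * deriv (fun z : ℝ => (Real.exp (p.a z) : ℂ) * P.Φ z / ((deriv p.Φ z : ℝ) : ℂ)) x

/-- The gauge-invariant amplitude `C = δc - c_x δΦ / Φ_x`. -/
def gaugeC (P : Profile) (x : ℝ) : ℂ :=
  P.c x - ((deriv p.c x : ℝ) : ℂ) * P.Φ x / ((deriv p.Φ x : ℝ) : ℂ)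

/-- The master variable `χ = u₁ - (G/H) u₂`, where `u₁ = e^{-c} (A - C)`, `u₂ = e^{-c} C`. -/
def masterVariable (A C : ℝ → ℂ) (x : ℝ) : ℂ :=
  (Real.exp (-p.c x) : ℂ) * (A x - C x)
    - (p.G x / p.H x : ℝ) * ((Real.exp (-p.c x) : ℂ) * C x)

end Params

end GhostWormhole

end

open GhostWormhole

/-! Write ∂ = w⁻¹ d/dx with w = e^{-2d}. The regularity condition keeps w between two positive
constants, so X is L²(dx) with an equivalent norm, and the spectral problem is the equation ∂²u = (W
− E) u with W = O(1/x²). The spectral half of the proof concerns abstract w and W (`IsTame`,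
`IsSol`); the geometric half supplies the wormhole.

Geometry. One has (1 + Λ²) F = 1 + Λ² + Λ² (x/b) y + y d_y. A hyperbolic inequality gives y d_y ≥
−(1/2 + Λ|y|), and y² ≤ (x/b) y absorbs the linear term, whence F > 0 with a quantitative bound
(`le_N`). The functions c_y, d_y, R = G/H and T are closed under ∂_y and satisfy the relation
`R_mul_sub`; the remaining identities thereby become algebraic. In particular χ₀ solves the
zero-energy equation (`isSol_χ₀`). Since (w c_y)_y > 0, it has exactly one zero x₀.

Existence of a negative eigenvalue (`IsTame.exists_ground_state`). Let ψ_k be the solution for W +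
k² asymptotic to e^{kσ} at −∞, σ' = w. For large k it is positive and increasing. For small k it
cannot be positive everywhere: Picone's identity with the positive, square integrable χ₀ on (x₀, ∞)
forbids it. "Takes a negative value" and "is positive until it has risen in the region W ≥ 0" are
disjoint open conditions on k, so by connectedness some k satisfies neither. That ψ_k is positive
and decreasing near +∞, hence square integrable.

Uniqueness (`IsTame.eq_ground_state`). If f is a square integrable solution for W + s² with Re s >
0, the Wronskian of f with its conjugate shows that s is real. A combination p = f − cψ vanishes at
x₀, and on each side of x₀ the function χ₀ has a sign, so Picone's identity makes the energy form
nonnegative at p. This forces s = β and f = cψ. Distributional eigenfunctions are classical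
solutions by `exists_isSol_of_weak`, so the argument covers the whole domain.

Field equations. For a mode e^{st}, the momentum constraint and the equations for Φ and c suffice:
δd and the displacement δΦ/Φ_x drop out, leaving first-order relations between A and C. The Riccati
equation of R is exactly what reduces the second one to c_y χ_y + B χ = s² ρ u₂. Eliminating u₂
yields c_y times the master equation, and continuity removes the factor c_y, which has a single zero
(`isSol_masterVariable`). So the spectral uniqueness applies to χ, and the same relation recovers u₂
from χ. Conversely, defining u₂ by this relation from ψ_β produces a solution of all five linearized
equations (`IsSol.isLinearizedSolution`). -/

noncomputable section

open Filter Topology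

namespace GhostWormhole

/-! ### Volterra equation for the Jost solutions -/

/-- The kernel `(1 - e^{-2kz}) / (2k)` of the Volterra equation, cut off to `z ≥ 0`. -/
def jostKernel (k z : ℝ) : ℝ := (1 - Real.exp (-2 * k * max z 0)) / (2 * k)

lemma jostKernel_of_nonpos {k z : ℝ} (hz : z ≤ 0) : jostKernel k z = 0 := by
  simp [jostKernel, max_eq_right hz]

lemma abs_jostKernel_le {k₁ k : ℝ} (hk₁ : 0 < k₁) (hk : k₁ ≤ k) (z : ℝ) :
    |jostKernel k z| ≤ 1 / (2 * k₁) := by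
  have hk0 : 0 < k := hk₁.trans_le hk
  have h1 : Real.exp (-2 * k * max z 0) ≤ 1 := by
    rw [Real.exp_le_one_iff]
    have := mul_nonneg hk0.le (le_max_right z 0)
    nlinarith
  have h2 := Real.exp_pos (-2 * k * max z 0)
  unfold jostKernel
  rw [abs_of_nonneg (div_nonneg (by linarith) (by linarith))]
  exact div_le_div₀ zero_le_one (by linarith) (by linarith) (by linarith)

lemma integrable_div_one_add_sq (C : ℝ) : Integrable fun x : ℝ => C / (1 + x ^ 2) := by
  simpa [div_eq_mul_inv] using integrable_inv_one_add_sq.const_mul C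

lemma hasDerivAt_exp_arctan (N : ℝ) (x : ℝ) :
    HasDerivAt (fun x => Real.exp (N * Real.arctan x))
      (N / (1 + x ^ 2) * Real.exp (N * Real.arctan x)) x := by
  have := ((Real.hasDerivAt_arctan x).const_mul N).exp
  convert this using 1
  ring

lemma integrable_div_mul_exp_arctan (N : ℝ) :
    Integrable fun x : ℝ => N / (1 + x ^ 2) * Real.exp (N * Real.arctan x) := by
  refine (integrable_div_one_add_sq N).mul_bdd (c := Real.exp (|N| * Real.pi)) ?_ ?_
  · exact (by fun_prop : Continuous fun x : ℝ => Real.exp (N * Real.arctan x)).aestronglyMeasurable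
  · refine Eventually.of_forall fun x => ?_
    rw [Real.norm_eq_abs, Real.abs_exp, Real.exp_le_exp]
    refine (le_abs_self _).trans ?_
    rw [abs_mul]
    refine mul_le_mul_of_nonneg_left ?_ (abs_nonneg _)
    rw [abs_le]
    constructor <;> linarith [Real.arctan_lt_pi_div_two x, Real.neg_pi_div_two_lt_arctan x, Real.pi_pos]

lemma integral_Iic_div_mul_exp_arctan_le (N : ℝ) (x : ℝ) :
    ∫ s in Iic x, N / (1 + s ^ 2) * Real.exp (N * Real.arctan s) ≤ Real.exp (N * Real.arctan x) := by
  have h := integral_Iic_of_hasDerivAt_of_tendsto' (a := x)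
    (f := fun x => Real.exp (N * Real.arctan x)) (m := Real.exp (N * -(Real.pi / 2)))
    (fun y _ => hasDerivAt_exp_arctan N y) (integrable_div_mul_exp_arctan N).integrableOn ?_
  · rw [h]; linarith [Real.exp_pos (N * -(Real.pi / 2))]
  · exact (Real.continuous_exp.tendsto _).comp
      ((tendsto_nhds_of_tendsto_nhdsWithin Real.tendsto_arctan_atBot).const_mul N)

lemma integral_Iic_div_one_add_sq (C x : ℝ) :
    ∫ s in Iic x, C / (1 + s ^ 2) = C * (Real.arctan x + Real.pi / 2) := by
  have h := integral_Iic_of_hasDerivAt_of_tendsto' (a := x)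
    (f := fun x => C * Real.arctan x) (f' := fun s => C / (1 + s ^ 2)) (m := C * -(Real.pi / 2))
    (fun y _ => by simpa [div_eq_mul_inv] using (Real.hasDerivAt_arctan y).const_mul C)
    (integrable_div_one_add_sq C).integrableOn ?_
  · rw [h]; ring
  · exact (tendsto_nhds_of_tendsto_nhdsWithin Real.tendsto_arctan_atBot).const_mul C

/-- Solutions `h(k, x)` of the Volterra equation
`h(k, x) = 1 + ∫_{s ≤ x} (1 - e^{-2k(σ(x) - σ(s))}) / (2k) q(s) h(k, s) ds`, for all `k ≥ k₁` at
once, as a jointly continuous function. -/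
theorem exists_volterra {q σ : ℝ → ℝ} {C k₁ : ℝ} (hq : Continuous q) (hσ : Continuous σ)
    (hmono : Monotone σ) (hC : 0 ≤ C) (hqC : ∀ x, |q x| ≤ C / (1 + x ^ 2)) (hk₁ : 0 < k₁) :
    ∃ (h : ℝ → ℝ → ℝ) (B : ℝ), Continuous (Function.uncurry h) ∧ 0 ≤ B ∧ (∀ k x, |h k x| ≤ B) ∧
      ∀ k x, h k x = 1 + ∫ s, jostKernel (max k k₁) (σ x - σ s) * (q s * h k s) := by
  -- Kernel times potential is at most N / (2 (1 + s²)), and e' = N e / (1 + x²). In the weighted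
  -- norm sup |h| / e the Volterra operator is therefore a contraction with constant 1/2, on the
  -- whole line and for all k ≥ k₁ at once. Without the weight this would require C to be small.
  set N : ℝ := C / k₁ with hN
  have hN0 : 0 ≤ N := div_nonneg hC hk₁.le
  set e : ℝ → ℝ := fun x => Real.exp (N * Real.arctan x) with he
  have hec : Continuous e := by simp only [he]; fun_prop
  have hepos : ∀ x, 0 < e x := fun x => Real.exp_pos _
  have hker : ∀ k x s, |jostKernel (max k k₁) (σ x - σ s)| ≤ 1 / (2 * k₁) := fun k x s =>
    abs_jostKernel_le hk₁ (le_max_right _ _) _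
  have hkerc : ∀ s, Continuous fun z : ℝ × ℝ => jostKernel (max z.1 k₁) (σ z.2 - σ s) := by
    intro s
    unfold jostKernel
    refine Continuous.div (by fun_prop) (by fun_prop) fun z => ?_
    have : 0 < max z.1 k₁ := lt_max_of_lt_right hk₁
    positivity
  have hkerc' : ∀ k x, Continuous fun s => jostKernel (max k k₁) (σ x - σ s) := by
    intro k x
    unfold jostKernel
    fun_prop
  -- the basic estimate
  have hbound : ∀ (g : BoundedContinuousFunction (ℝ × ℝ) ℝ) k x s,
      ‖jostKernel (max k k₁) (σ x - σ s) * (q s * e s) * g (k, s)‖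
        ≤ (Iic x).indicator (fun s => N / (1 + s ^ 2) * e s * (‖g‖ / 2)) s := by
    intro g k x s
    by_cases hs : s ≤ x
    · rw [indicator_of_mem (by exact hs), norm_mul, norm_mul, norm_mul]
      have h1 : ‖jostKernel (max k k₁) (σ x - σ s)‖ ≤ 1 / (2 * k₁) := hker k x s
      have h2 : ‖q s‖ ≤ C / (1 + s ^ 2) := hqC s
      have h3 : ‖e s‖ = e s := by rw [Real.norm_eq_abs, abs_of_pos (hepos s)]
      have h4 := g.norm_coe_le_norm (k, s)
      rw [h3]
      have h5 := (hepos s).le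
      calc ‖jostKernel (max k k₁) (σ x - σ s)‖ * (‖q s‖ * e s) * ‖g (k, s)‖
          ≤ 1 / (2 * k₁) * (C / (1 + s ^ 2) * e s) * ‖g‖ := by gcongr
        _ = N / (1 + s ^ 2) * e s * (‖g‖ / 2) := by rw [hN]; field_simp
    · rw [indicator_of_notMem (by exact hs), jostKernel_of_nonpos]
      · simp
      · linarith [hmono (not_le.1 hs).le]
  have hint0 : ∀ c : ℝ, Integrable fun s => N / (1 + s ^ 2) * e s * c := fun c =>
    (integrable_div_mul_exp_arctan N).mul_const c
  have hest : ∀ (g : BoundedContinuousFunction (ℝ × ℝ) ℝ) k x,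
      ‖∫ s, jostKernel (max k k₁) (σ x - σ s) * (q s * e s) * g (k, s)‖ ≤ e x * (‖g‖ / 2) := by
    intro g k x
    refine (norm_integral_le_of_norm_le ((hint0 (‖g‖ / 2)).indicator measurableSet_Iic)
      (Eventually.of_forall (hbound g k x))).trans ?_
    rw [integral_indicator measurableSet_Iic, integral_mul_const]
    have := integral_Iic_div_mul_exp_arctan_le N x
    gcongr
  have hmeas : ∀ (g : BoundedContinuousFunction (ℝ × ℝ) ℝ) k x, Continuous fun s =>
      jostKernel (max k k₁) (σ x - σ s) * (q s * e s) * g (k, s) := by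
    intro g k x
    have := hkerc' k x
    fun_prop
  have hinteg : ∀ (g : BoundedContinuousFunction (ℝ × ℝ) ℝ) k x, Integrable fun s =>
      jostKernel (max k k₁) (σ x - σ s) * (q s * e s) * g (k, s) := fun g k x =>
    ((hint0 (‖g‖ / 2)).indicator measurableSet_Iic).mono' (hmeas g k x).aestronglyMeasurable
      (Eventually.of_forall (hbound g k x))
  have hcont : ∀ g : BoundedContinuousFunction (ℝ × ℝ) ℝ, Continuous fun z : ℝ × ℝ =>
      ∫ s, jostKernel (max z.1 k₁) (σ z.2 - σ s) * (q s * e s) * g (z.1, s) := by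
    intro g
    refine continuous_of_dominated (bound := fun s => N / (1 + s ^ 2) * e s * (‖g‖ / 2))
      (fun z => (hmeas g z.1 z.2).aestronglyMeasurable) (fun z => Eventually.of_forall fun s =>
        (hbound g z.1 z.2 s).trans ?_) (hint0 _) (Eventually.of_forall fun s => ?_)
    · refine indicator_le_self' (fun s _ => ?_) s
      have := (hepos s).le
      positivity
    · have := hkerc s
      fun_prop
  -- The unknown is g = h / e as a function of both k and x, so joint continuity comes with the
  -- fixed point.
  let T : BoundedContinuousFunction (ℝ × ℝ) ℝ → BoundedContinuousFunction (ℝ × ℝ) ℝ := fun g =>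
    BoundedContinuousFunction.ofNormedAddCommGroup (fun z => (e z.2)⁻¹ *
      (1 + ∫ s, jostKernel (max z.1 k₁) (σ z.2 - σ s) * (q s * e s) * g (z.1, s)))
      (by
        have := hcont g
        refine Continuous.mul ((hec.comp continuous_snd).inv₀ fun z => (hepos _).ne') (by fun_prop))
      (Real.exp (N * (Real.pi / 2)) + ‖g‖ / 2) (by
        intro z
        rw [norm_mul, norm_inv, Real.norm_of_nonneg (hepos z.2).le]
        have h1 := norm_add_le (1 : ℝ)
          (∫ s, jostKernel (max z.1 k₁) (σ z.2 - σ s) * (q s * e s) * g (z.1, s))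
        have h2 := hest g z.1 z.2
        have h3 : (e z.2)⁻¹ ≤ Real.exp (N * (Real.pi / 2)) := by
          simp only [he]
          rw [← Real.exp_neg, Real.exp_le_exp]
          nlinarith [Real.neg_pi_div_two_lt_arctan z.2]
        rw [norm_one] at h1
        calc (e z.2)⁻¹ * ‖_‖ ≤ (e z.2)⁻¹ * (1 + e z.2 * (‖g‖ / 2)) :=
              mul_le_mul_of_nonneg_left (h1.trans (by linarith)) (inv_nonneg.2 (hepos _).le)
          _ = (e z.2)⁻¹ + ‖g‖ / 2 := by field_simp [(hepos z.2).ne']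
          _ ≤ _ := by linarith)
  have hT : ContractingWith (1 / 2) T := by
    refine ⟨by rw [div_lt_one] <;> norm_num, LipschitzWith.of_dist_le_mul fun g₁ g₂ => ?_⟩
    refine (BoundedContinuousFunction.dist_le (by positivity)).2 fun z => ?_
    change dist ((e z.2)⁻¹ * _) ((e z.2)⁻¹ * _) ≤ _
    rw [Real.dist_eq, ← mul_sub, add_sub_add_left_eq_sub, ← integral_sub (hinteg _ _ _)
      (hinteg _ _ _), abs_mul, abs_inv, abs_of_pos (hepos z.2)]
    have h := hest (g₁ - g₂) z.1 z.2
    simp only [BoundedContinuousFunction.coe_sub, Pi.sub_apply, mul_sub] at h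
    rw [dist_eq_norm]
    rw [inv_mul_le_iff₀ (hepos _)]
    refine h.trans (le_of_eq ?_)
    push_cast
    ring
  obtain ⟨g, hg⟩ : ∃ g, T g = g := ⟨_, hT.fixedPoint_isFixedPt⟩
  refine ⟨fun k x => e x * g (k, x), Real.exp (N * (Real.pi / 2)) * ‖g‖, ?_, by positivity, ?_, ?_⟩
  · simp only [Function.uncurry_def]
    fun_prop
  · intro k x
    rw [abs_mul, abs_of_pos (hepos x)]
    have h1 : e x ≤ Real.exp (N * (Real.pi / 2)) := by
      simp only [he]
      rw [Real.exp_le_exp]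
      nlinarith [Real.arctan_lt_pi_div_two x]
    have h2 := g.norm_coe_le_norm (k, x)
    rw [Real.norm_eq_abs] at h2
    gcongr
  · intro k x
    have h1 : g (k, x) = (e x)⁻¹ *
      (1 + ∫ s, jostKernel (max k k₁) (σ x - σ s) * (q s * e s) * g (k, s)) := by
      conv_lhs => rw [← hg]
      rfl
    simp only
    rw [h1, mul_inv_cancel_left₀ (hepos x).ne']
    simp only [mul_assoc]

/-! ### The weighted Schrödinger equation and its Jost solutions -/

section

/-- `u` and `v = w⁻¹ u'` solve the weighted Schrödinger equation `w⁻¹ (w⁻¹ u')' = V u`. -/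
structure IsSol {E : Type*} [NormedField E] [NormedSpace ℝ E] (w : ℝ → ℝ) (V u v : ℝ → E) :
    Prop where
  fst : ∀ x, HasDerivAt u (w x • v x) x
  snd : ∀ x, HasDerivAt v (w x • (V x * u x)) x

lemma hasDerivAt_integral_Iic {f : ℝ → ℝ} (hf : Continuous f) (hi : ∀ x, IntegrableOn f (Iic x))
    (x : ℝ) : HasDerivAt (fun x => ∫ s in Iic x, f s) (f x) x := by
  have h1 : (fun x => ∫ s in Iic x, f s) = fun x => (∫ s in Iic (0 : ℝ), f s) + ∫ s in (0 : ℝ)..x, f s := by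
    funext y
    rw [← intervalIntegral.integral_Iic_sub_Iic (hi 0) (hi y)]
    ring
  rw [h1]
  exact (intervalIntegral.integral_hasDerivAt_right (hf.intervalIntegrable _ _)
    (hf.stronglyMeasurableAtFilter _ _) hf.continuousAt).const_add _

/-- The solution of `w⁻¹ (w⁻¹ ψ')' = (W + k²) ψ` that is asymptotic to `e^{kσ}` at `-∞`, with
`σ' = w`, from a solution of the Volterra equation. -/
theorem isSol_of_volterra {w W σ h : ℝ → ℝ} {C k B : ℝ} (hw : Continuous w) (hW : Continuous W)
    (hw0 : ∀ x, 0 < w x) (hσ : ∀ x, HasDerivAt σ (w x) x)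
    (hqC : ∀ x, |w x * W x| ≤ C / (1 + x ^ 2)) (hk : 0 < k) (hh : Continuous h) (hB : 0 ≤ B)
    (hhB : ∀ x, |h x| ≤ B)
    (heq : ∀ x, h x = 1 + ∫ s, jostKernel k (σ x - σ s) * (w s * W s * h s)) :
    ∃ r : ℝ → ℝ, IsSol w (fun x => W x + k ^ 2) (fun x => Real.exp (k * σ x) * h x)
        (fun x => Real.exp (k * σ x) * (k * h x + r x)) ∧
      (∀ x, |h x - 1| ≤ 1 / (2 * k) * (B * C * (Real.arctan x + Real.pi / 2))) ∧
      ∀ x, |r x| ≤ B * C * (Real.arctan x + Real.pi / 2) := by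
  have hmono : StrictMono σ := strictMono_of_deriv_pos fun x => by rw [(hσ x).deriv]; exact hw0 x
  have hσc : Continuous σ := continuous_iff_continuousAt.2 fun x => (hσ x).continuousAt
  set q : ℝ → ℝ := fun s => w s * W s * h s with hq
  have hqc : Continuous q := by simp only [hq]; fun_prop
  have hqb : ∀ s, |q s| ≤ B * C / (1 + s ^ 2) := fun s => by
    simp only [hq]
    rw [abs_mul, mul_div_assoc, mul_comm]
    exact mul_le_mul (hhB s) (hqC s) (abs_nonneg _) hB
  have hqi : Integrable q := (integrable_div_one_add_sq (B * C)).mono' hqc.aestronglyMeasurable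
    (Eventually.of_forall hqb)
  have hexp1 : ∀ x s, s ≤ x → Real.exp (-2 * k * (σ x - σ s)) ≤ 1 := fun x s hs => by
    rw [Real.exp_le_one_iff]
    have := mul_nonneg hk.le (sub_nonneg.2 (hmono.monotone hs))
    nlinarith
  have hqi' : ∀ x, IntegrableOn (fun s => Real.exp (-2 * k * (σ x - σ s)) * q s) (Iic x) := by
    intro x
    refine Integrable.mono' (g := fun s => B * C / (1 + s ^ 2))
      (integrable_div_one_add_sq (B * C)).integrableOn
      (by fun_prop : Continuous fun s => Real.exp (-2 * k * (σ x - σ s)) * q s).aestronglyMeasurable ?_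
    refine (ae_restrict_iff' measurableSet_Iic).2 (Eventually.of_forall fun s hs => ?_)
    rw [norm_mul, Real.norm_of_nonneg (Real.exp_pos _).le]
    have := hexp1 x s hs
    have h2 := hqb s
    have h3 := abs_nonneg (q s)
    rw [Real.norm_eq_abs]
    nlinarith
  have hqi'' : ∀ x, IntegrableOn (fun s => Real.exp (2 * k * σ s) * q s) (Iic x) := by
    intro x
    have := (hqi' x).const_mul (Real.exp (2 * k * σ x))
    refine this.congr (Eventually.of_forall fun s => ?_)
    simp only
    rw [← mul_assoc, ← Real.exp_add]
    congr 2
    ring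
  have hIic : ∀ x, ∫ s in Iic x, B * C / (1 + s ^ 2) = B * C * (Real.arctan x + Real.pi / 2) :=
    integral_Iic_div_one_add_sq (B * C)
  -- r is ∂h. Pulling e^{-2kσ(x)} out of the integral leaves x only in the upper limit, so r can be
  -- differentiated without assuming that h is differentiable.
  set r : ℝ → ℝ := fun x => Real.exp (-2 * k * σ x) * ∫ s in Iic x, Real.exp (2 * k * σ s) * q s
    with hr
  have hr' : ∀ x, r x = ∫ s in Iic x, Real.exp (-2 * k * (σ x - σ s)) * q s := fun x => by
    simp only [hr]
    rw [← integral_const_mul]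
    congr 1
    funext s
    rw [← mul_assoc, ← Real.exp_add]
    congr 2
    ring
  have hrb : ∀ x, |r x| ≤ B * C * (Real.arctan x + Real.pi / 2) := by
    intro x
    rw [← hIic, hr' x, ← Real.norm_eq_abs]
    refine norm_integral_le_of_norm_le (integrable_div_one_add_sq (B * C)).integrableOn ?_
    refine (ae_restrict_iff' measurableSet_Iic).2 (Eventually.of_forall fun s hs => ?_)
    rw [norm_mul, Real.norm_of_nonneg (Real.exp_pos _).le, Real.norm_eq_abs]
    have := hexp1 x s hs
    have h2 := hqb s
    have h3 := abs_nonneg (q s)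
    nlinarith
  have hker : ∀ x, (fun s => jostKernel k (σ x - σ s) * q s) = (Iic x).indicator fun s =>
      1 / (2 * k) * (q s - Real.exp (-2 * k * (σ x - σ s)) * q s) := by
    intro x
    funext s
    by_cases hs : s ≤ x
    · rw [indicator_of_mem (by exact hs), jostKernel,
        max_eq_left (sub_nonneg.2 (hmono.monotone hs))]
      ring
    · rw [indicator_of_notMem (by exact hs), jostKernel_of_nonpos, zero_mul]
      linarith [hmono (not_le.1 hs)]
  have hh' : ∀ x, h x = 1 + 1 / (2 * k) * ((∫ s in Iic x, q s) - r x) := by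
    intro x
    rw [heq x, hker x, integral_indicator measurableSet_Iic, integral_const_mul,
      integral_sub hqi.integrableOn (hqi' x), hr' x]
  have hdσ : ∀ x c, HasDerivAt (fun x => Real.exp (c * σ x)) (c * w x * Real.exp (c * σ x)) x :=
    fun x c => by
      refine ((hσ x).const_mul c).exp.congr_deriv ?_
      ring
  have hdr : ∀ x, HasDerivAt r (q x - 2 * k * w x * r x) x := by
    intro x
    have h1 := (hdσ x (-2 * k)).mul (hasDerivAt_integral_Iic (by fun_prop) hqi'' x)
    refine HasDerivAt.congr_deriv h1 ?_
    have : Real.exp (-2 * k * σ x) * Real.exp (2 * k * σ x) = 1 := by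
      rw [← Real.exp_add]; simp
    simp only [hr]
    linear_combination (q x) * this
  have hdh : ∀ x, HasDerivAt h (w x * r x) x := by
    intro x
    have h1 := (((hasDerivAt_integral_Iic hqc (fun x => hqi.integrableOn) x).sub
      (hdr x)).const_mul (1 / (2 * k))).const_add 1
    rw [show h = fun x => 1 + 1 / (2 * k) * ((∫ s in Iic x, q s) - r x) from funext hh']
    refine HasDerivAt.congr_deriv h1 ?_
    field_simp
    ring
  refine ⟨r, ⟨fun x => ?_, fun x => ?_⟩, fun x => ?_, hrb⟩
  · refine ((hdσ x k).mul (hdh x)).congr_deriv ?_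
    simp only [smul_eq_mul]
    ring
  · refine ((hdσ x k).mul (((hdh x).const_mul k).fun_add (hdr x))).congr_deriv ?_
    simp only [smul_eq_mul, hq]
    ring
  · rw [heq x, add_sub_cancel_left, hker x, integral_indicator measurableSet_Iic,
      integral_const_mul, abs_mul, abs_of_pos (by positivity), ← hIic]
    refine mul_le_mul_of_nonneg_left ?_ (by positivity)
    rw [← Real.norm_eq_abs]
    refine norm_integral_le_of_norm_le (integrable_div_one_add_sq (B * C)).integrableOn ?_
    refine (ae_restrict_iff' measurableSet_Iic).2 (Eventually.of_forall fun s hs => ?_)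
    have := hexp1 x s hs
    have h2 := hqb s
    have h3 := abs_nonneg (q s)
    have h4 := Real.exp_pos (-2 * k * (σ x - σ s))
    rw [show q s - Real.exp (-2 * k * (σ x - σ s)) * q s
      = (1 - Real.exp (-2 * k * (σ x - σ s))) * q s by ring, norm_mul,
      Real.norm_of_nonneg (by linarith), Real.norm_eq_abs]
    nlinarith

/-! ### Riccati bounds and uniqueness for the initial value problem -/

namespace IsSol

lemma reflect {E : Type*} [NormedField E] [NormedSpace ℝ E] {w : ℝ → ℝ} {V u v : ℝ → E}
    (h : IsSol w V u v) : IsSol (fun x => w (-x)) (fun x => V (-x)) (fun x => u (-x))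
      (fun x => -v (-x)) where
  fst x := by
    refine ((h.fst (-x)).scomp x (hasDerivAt_neg x)).congr_deriv ?_
    simp
  snd x := by
    refine ((h.snd (-x)).scomp x (hasDerivAt_neg x)).neg.congr_deriv ?_
    simp

variable {w V u v : ℝ → ℝ}

/-- Upper bound for the logarithmic derivative of a positive solution. -/
lemma le_mul_of_pos (h : IsSol w V u v) {σ : ℝ → ℝ} (hσ : ∀ x, HasDerivAt σ (w x) x)
    {w₀ w₁ M : ℝ} (hw₀ : 0 < w₀) (hw : ∀ x, w₀ ≤ w x) (hw' : ∀ x, w x ≤ w₁)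
    (hM : ∀ x, V x ≤ M) (hM0 : 0 ≤ M) {s : ℝ} (hu : ∀ x ∈ Icc (s - 1) s, 0 < u x) :
    v s ≤ (1 / w₀ + M * w₁) * u s := by
  set l : ℝ → ℝ := fun x => σ x - σ (s - 1) with hl
  have hlb : ∀ x ∈ Icc (s - 1) s, w₀ * (x - (s - 1)) ≤ l x ∧ l x ≤ w₁ * (x - (s - 1)) := by
    intro x hx
    have hd : Differentiable ℝ σ := fun x => (hσ x).differentiableAt
    refine ⟨?_, ?_⟩
    · exact mul_sub_le_image_sub_of_le_deriv hd (fun y => (hσ y).deriv ▸ hw y) hx.1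
    · exact image_sub_le_mul_sub_of_deriv_le hd (fun y => (hσ y).deriv ▸ hw' y) hx.1
  -- The logarithmic derivative θ = v/u satisfies θ' = w (V − θ²). Multiplying by l² and completing
  -- the square produces this monotone quantity. Since l vanishes at s − 1, nothing about θ at the
  -- left end is needed, and the outcome is θ ≤ 1/l + M l at s.
  have hd : ∀ x ∈ Icc (s - 1) s, HasDerivAt (fun x => l x - l x ^ 2 * (v x / u x) + M * l x ^ 3)
      (w x * ((1 - l x * (v x / u x)) ^ 2 + (M - V x) * l x ^ 2 + 2 * M * l x ^ 2)) x := by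
    intro x hx
    have hu0 := (hu x hx).ne'
    have hlx : HasDerivAt l (w x) x := (hσ x).sub_const _
    have := ((hlx.fun_sub ((hlx.fun_pow 2).fun_mul ((h.snd x).fun_div (h.fst x) hu0))).fun_add
      ((hlx.fun_pow 3).const_mul M))
    refine this.congr_deriv ?_
    simp only [smul_eq_mul]
    field_simp
    ring
  have hmono : MonotoneOn (fun x => l x - l x ^ 2 * (v x / u x) + M * l x ^ 3) (Icc (s - 1) s) := by
    refine monotoneOn_of_deriv_nonneg (convex_Icc _ _)
      (fun x hx => (hd x hx).continuousAt.continuousWithinAt)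
      (fun x hx => (hd x (interior_subset hx)).differentiableAt.differentiableWithinAt)
      fun x hx => ?_
    rw [(hd x (interior_subset hx)).deriv]
    have h1 : 0 ≤ w x := hw₀.le.trans (hw x)
    have h2 : 0 ≤ M - V x := sub_nonneg.2 (hM x)
    positivity
  have h1 := hmono (left_mem_Icc.2 (by linarith)) (right_mem_Icc.2 (by linarith)) (by linarith)
  have h2 : l (s - 1) = 0 := sub_self _
  simp only [h2] at h1
  obtain ⟨h3, h4⟩ := hlb s (right_mem_Icc.2 (by linarith))
  have h5 : 0 < l s := by linarith
  have hus := hu s (right_mem_Icc.2 (by linarith))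
  rw [← div_le_iff₀ hus]
  have h6 : l s * (v s / u s) ≤ 1 + M * l s ^ 2 := by
    have : l s * (l s * (v s / u s)) ≤ l s * (1 + M * l s ^ 2) := by nlinarith
    exact le_of_mul_le_mul_left this h5
  have h7 : v s / u s ≤ 1 / l s + M * l s := by
    rw [← sub_nonneg]
    have : 1 / l s + M * l s - v s / u s = (1 + M * l s ^ 2 - l s * (v s / u s)) / l s := by
      field_simp
    rw [this]
    exact div_nonneg (by linarith) h5.le
  refine h7.trans (add_le_add (one_div_le_one_div_of_le hw₀ (by linarith)) ?_)
  exact mul_le_mul_of_nonneg_left (by linarith) hM0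

lemma neg_mul_le_of_pos (h : IsSol w V u v) {σ : ℝ → ℝ} (hσ : ∀ x, HasDerivAt σ (w x) x)
    {w₀ w₁ M : ℝ} (hw₀ : 0 < w₀) (hw : ∀ x, w₀ ≤ w x) (hw' : ∀ x, w x ≤ w₁)
    (hM : ∀ x, V x ≤ M) (hM0 : 0 ≤ M) {s : ℝ} (hu : ∀ x ∈ Icc s (s + 1), 0 < u x) :
    -((1 / w₀ + M * w₁) * u s) ≤ v s := by
  have := h.reflect.le_mul_of_pos (σ := fun x => -σ (-x)) (s := -s) (M := M)
    (fun x => ((hσ (-x)).scomp x (hasDerivAt_neg x)).neg.congr_deriv (by simp)) hw₀ (fun x => hw _)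
    (fun x => hw' _) (fun x => hM _) hM0 (fun x hx => hu _ ⟨by linarith [hx.2], by linarith [hx.1]⟩)
  simp only [neg_neg] at this
  linarith

/-- Uniqueness for the initial value problem with vanishing data. -/
lemma eq_zero (h : IsSol w V u v) {w₁ M : ℝ} (hw : ∀ x, 0 ≤ w x) (hw' : ∀ x, w x ≤ w₁)
    (hM : ∀ x, |V x| ≤ M) {z : ℝ} (hu : u z = 0) (hv : v z = 0) (x : ℝ) : u x = 0 ∧ v x = 0 := by
  have hM0 : 0 ≤ M := (abs_nonneg _).trans (hM 0)
  have hw1 : 0 ≤ w₁ := (hw 0).trans (hw' 0)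
  -- Grönwall's inequality for u² + v², with e^{-Kx} to the right of z and e^{Kx} to the left.
  set K := w₁ * (1 + M) with hK
  have hd : ∀ x, HasDerivAt (fun x => u x ^ 2 + v x ^ 2) (2 * w x * (u x * v x) * (1 + V x)) x := by
    intro x
    refine (((h.fst x).pow 2).add ((h.snd x).pow 2)).congr_deriv ?_
    simp only [smul_eq_mul]
    ring
  have hb : ∀ x, |2 * w x * (u x * v x) * (1 + V x)| ≤ K * (u x ^ 2 + v x ^ 2) := by
    intro x
    have h1 : |2 * (u x * v x)| ≤ u x ^ 2 + v x ^ 2 := by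
      rw [abs_le]; constructor <;> nlinarith [sq_nonneg (u x + v x), sq_nonneg (u x - v x)]
    have h2 : |1 + V x| ≤ 1 + M := (abs_add_le _ _).trans (by rw [abs_one]; linarith [hM x])
    calc |2 * w x * (u x * v x) * (1 + V x)| = w x * |1 + V x| * |2 * (u x * v x)| := by
          rw [show 2 * w x * (u x * v x) * (1 + V x) = w x * (1 + V x) * (2 * (u x * v x)) by ring,
            abs_mul, abs_mul, abs_of_nonneg (hw x)]
      _ ≤ w₁ * (1 + M) * (u x ^ 2 + v x ^ 2) := by
          gcongr
          exact hw' x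
  have hz : u z ^ 2 + v z ^ 2 = 0 := by rw [hu, hv]; ring
  have hE : ∀ c x, HasDerivAt (fun x => Real.exp (c * x)) (c * Real.exp (c * x)) x := fun c x => by
    refine ((hasDerivAt_id x).const_mul c).exp.congr_deriv ?_
    simp [mul_comm]
  have key : u x ^ 2 + v x ^ 2 ≤ 0 := by
    rcases le_total z x with hzx | hzx
    · have hanti : Antitone fun x => (u x ^ 2 + v x ^ 2) * Real.exp (-K * x) := by
        refine antitone_of_deriv_nonpos (fun x => ((hd x).fun_mul (hE (-K) x)).differentiableAt)
          fun x => ?_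
        rw [((hd x).fun_mul (hE (-K) x)).deriv]
        have h1 := (abs_le.1 (hb x)).2
        have h2 := Real.exp_pos (-K * x)
        nlinarith
      have := hanti hzx
      simp only [hz, zero_mul] at this
      exact nonpos_of_mul_nonpos_left this (Real.exp_pos _)
    · have hmono : Monotone fun x => (u x ^ 2 + v x ^ 2) * Real.exp (K * x) := by
        refine monotone_of_deriv_nonneg (fun x => ((hd x).fun_mul (hE K x)).differentiableAt)
          fun x => ?_
        rw [((hd x).fun_mul (hE K x)).deriv]
        have h1 := (abs_le.1 (hb x)).1
        have h2 := Real.exp_pos (K * x)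
        nlinarith
      have := hmono hzx
      simp only [hz, zero_mul] at this
      exact nonpos_of_mul_nonpos_left this (Real.exp_pos _)
  constructor <;> nlinarith [sq_nonneg (u x), sq_nonneg (v x)]

end IsSol

end

/-! ### Decay of square integrable solutions -/

section

/-- A weight `w` bounded above and away from `0`, and a potential `W` that decays like `1 / x²` and
is nonnegative near `+∞`. -/
structure IsTame (w W : ℝ → ℝ) (w₀ w₁ C R : ℝ) : Prop where
  contw : Continuous w
  contW : Continuous W
  pos : 0 < w₀
  le : ∀ x, w₀ ≤ w x
  ge : ∀ x, w x ≤ w₁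
  C_nonneg : 0 ≤ C
  decay : ∀ x, |w x * W x| ≤ C / (1 + x ^ 2)
  nonneg : ∀ x, R ≤ x → 0 ≤ W x

lemma IsTame.w_pos {w W : ℝ → ℝ} {w₀ w₁ C R : ℝ} (h : IsTame w W w₀ w₁ C R) (x : ℝ) : 0 < w x :=
  h.pos.trans_le (h.le x)

lemma IsTame.abs_potential_le {w W : ℝ → ℝ} {w₀ w₁ C R : ℝ} (h : IsTame w W w₀ w₁ C R) (x : ℝ) :
    |W x| ≤ C / w₀ := by
  rw [le_div_iff₀ h.pos]
  have h1 := h.decay x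
  have h2 : C / (1 + x ^ 2) ≤ C := div_le_self h.C_nonneg (by nlinarith [sq_nonneg x])
  rw [abs_mul, abs_of_pos (h.w_pos x)] at h1
  nlinarith [h.le x, abs_nonneg (W x)]

lemma not_integrableOn_Ioi_of_one_le {f : ℝ → ℝ} {T : ℝ} (h : ∀ x ∈ Ioi T, 1 ≤ f x) :
    ¬ IntegrableOn f (Ioi T) := by
  intro hf
  have h1 : IntegrableOn (fun _ : ℝ => (1 : ℝ)) (Ioi T) := by
    refine Integrable.mono' hf aestronglyMeasurable_const ?_
    refine (ae_restrict_iff' measurableSet_Ioi).2 (Eventually.of_forall fun x hx => ?_)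
    simpa using h x hx
  rw [integrableOn_const_iff (by simp)] at h1
  simp at h1

namespace IsSol

lemma ofReal {w V u v : ℝ → ℝ} (h : IsSol w V u v) :
    IsSol w (fun x => (V x : ℂ)) (fun x => (u x : ℂ)) (fun x => (v x : ℂ)) where
  fst x := (h.fst x).ofReal_comp.congr_deriv (by simp)
  snd x := (h.snd x).ofReal_comp.congr_deriv (by simp)

variable {w : ℝ → ℝ} {V u v : ℝ → ℂ}

lemma continuous_fst (h : IsSol w V u v) : Continuous u :=
  continuous_iff_continuousAt.2 fun x => (h.fst x).continuousAt

lemma continuous_snd (h : IsSol w V u v) : Continuous v :=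
  continuous_iff_continuousAt.2 fun x => (h.snd x).continuousAt

lemma hasDerivAt_norm_sq_fst (h : IsSol w V u v) (x : ℝ) :
    HasDerivAt (fun x => ‖u x‖ ^ 2) (2 * w x * inner ℝ (u x) (v x)) x :=
  (h.fst x).norm_sq.congr_deriv (by rw [real_inner_smul_right]; ring)

lemma hasDerivAt_norm_sq_snd (h : IsSol w V u v) (x : ℝ) :
    HasDerivAt (fun x => ‖v x‖ ^ 2) (2 * w x * inner ℝ (v x) (V x * u x)) x :=
  (h.snd x).norm_sq.congr_deriv (by rw [real_inner_smul_right]; ring)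

lemma hasDerivAt_inner (h : IsSol w V u v) (x : ℝ) :
    HasDerivAt (fun x => inner ℝ (u x) (v x))
      (w x * (‖v x‖ ^ 2 + inner ℝ (u x) (V x * u x))) x := by
  refine ((h.fst x).inner ℝ (h.snd x)).congr_deriv ?_
  rw [real_inner_smul_right, real_inner_smul_left, real_inner_self_eq_norm_sq]
  ring

lemma abs_inner_mul_le {M : ℝ} (hM : ∀ x, ‖V x‖ ≤ M) (x : ℝ) (z : ℂ) :
    |inner ℝ z (V x * u x)| ≤ M * (‖z‖ * ‖u x‖) := by
  refine (abs_real_inner_le_norm _ _).trans ?_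
  rw [norm_mul]
  nlinarith [hM x, norm_nonneg z, norm_nonneg (u x), mul_nonneg (norm_nonneg z) (norm_nonneg (u x))]

/-- A square integrable solution has a square integrable derivative. -/
lemma integrableOn_norm_sq_snd (h : IsSol w V u v) {w₀ w₁ M a : ℝ} (hw₀ : 0 < w₀)
    (hw : ∀ x, w₀ ≤ w x) (hw' : ∀ x, w x ≤ w₁) (hM : ∀ x, ‖V x‖ ≤ M)
    (hu : IntegrableOn (fun x => ‖u x‖ ^ 2) (Ioi a)) :
    IntegrableOn (fun x => ‖v x‖ ^ 2) (Ioi a) := by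
  have hM0 : 0 ≤ M := (norm_nonneg _).trans (hM 0)
  have hw1 : 0 ≤ w₁ := hw₀.le.trans ((hw 0).trans (hw' 0))
  have huc : Continuous fun x => ‖u x‖ ^ 2 := (h.continuous_fst.norm).pow 2
  set I : ℝ → ℝ := fun x => ∫ s in a..x, ‖u s‖ ^ 2 with hI
  have hId : ∀ x, HasDerivAt I (‖u x‖ ^ 2) x := fun x =>
    intervalIntegral.integral_hasDerivAt_right (huc.intervalIntegrable _ _)
      (huc.stronglyMeasurableAtFilter _ _) huc.continuousAt
  have hIb : ∀ x, a ≤ x → I x ≤ ∫ s in Ioi a, ‖u s‖ ^ 2 := by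
    intro x hx
    simp only [hI]
    rw [intervalIntegral.integral_of_le hx]
    exact setIntegral_mono_set hu (Eventually.of_forall fun x => by positivity)
      (Ioc_subset_Ioi_self.eventuallyLE)
  -- The added integral makes J increasing with derivative at least w₀ ‖v‖². If J is unbounded then
  -- ⟨u, v⟩ is eventually large, because the integral is bounded; then ‖u‖² has derivative at least
  -- 1, contradicting integrability. If J converges, ‖v‖² is integrable.
  set J : ℝ → ℝ := fun x => inner ℝ (u x) (v x) + w₁ * M * I x with hJ
  have hJd : ∀ x, HasDerivAt J
      (w x * (‖v x‖ ^ 2 + inner ℝ (u x) (V x * u x)) + w₁ * M * ‖u x‖ ^ 2) x := fun x =>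
    (h.hasDerivAt_inner x).fun_add ((hId x).const_mul _)
  have hJge : ∀ x, w₀ * ‖v x‖ ^ 2
      ≤ w x * (‖v x‖ ^ 2 + inner ℝ (u x) (V x * u x)) + w₁ * M * ‖u x‖ ^ 2 := by
    intro x
    have h1 := (abs_le.1 (abs_inner_mul_le (u := u) hM x (u x))).1
    have h2 := hw x
    have h3 := hw' x
    have h4 : 0 ≤ w x := by linarith
    have h5 : 0 ≤ M * ‖u x‖ ^ 2 := by positivity
    nlinarith [sq_nonneg ‖v x‖, mul_le_mul_of_nonneg_left h1 h4, mul_le_mul_of_nonneg_right h3 h5]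
  have hJmono : Monotone J := by
    refine monotone_of_deriv_nonneg (fun x => (hJd x).differentiableAt) fun x => ?_
    rw [(hJd x).deriv]
    exact le_trans (by positivity) (hJge x)
  rcases tendsto_atTop_of_monotone hJmono with hlim | ⟨l, hl⟩
  · exfalso
    have h1 : ∀ᶠ x in atTop, 1 / (2 * w₀) + w₁ * M * ∫ s in Ioi a, ‖u s‖ ^ 2 ≤ J x :=
      hlim.eventually_ge_atTop _
    obtain ⟨T, hT⟩ := eventually_atTop.1 (h1.and (eventually_ge_atTop a))
    have hTa := (hT T le_rfl).2
    have h2 : ∀ x, T ≤ x → 1 ≤ 2 * w x * inner ℝ (u x) (v x) := by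
      intro x hx
      have h3 := (hT x hx).1
      have h4 := mul_le_mul_of_nonneg_left (hIb x (hTa.trans hx)) (mul_nonneg hw1 hM0)
      have h5 : 1 / (2 * w₀) ≤ inner ℝ (u x) (v x) := by simp only [hJ] at h3; linarith
      have h6 : 1 ≤ 2 * w₀ * inner ℝ (u x) (v x) := by
        rw [div_le_iff₀ (by positivity)] at h5; linarith
      have h7 : 0 ≤ inner ℝ (u x) (v x) := le_trans (by positivity) h5
      nlinarith [hw x]
    have h3 : ∀ x ∈ Ioi (T + 1), 1 ≤ ‖u x‖ ^ 2 := by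
      intro x hx
      have h4 : 1 * (x - T) ≤ ‖u x‖ ^ 2 - ‖u T‖ ^ 2 := by
        refine Convex.mul_sub_le_image_sub_of_le_deriv (convex_Ici T)
          (f := fun x => ‖u x‖ ^ 2) huc.continuousOn
          (fun y _ => (h.hasDerivAt_norm_sq_fst y).differentiableAt.differentiableWithinAt)
          (fun y hy => ?_) T self_mem_Ici x ?_ ?_
        · rw [(h.hasDerivAt_norm_sq_fst y).deriv]
          exact h2 y (interior_subset hy)
        · have : T + 1 < x := hx
          exact (by linarith : T ≤ x)
        · have : T + 1 < x := hx
          linarith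
      have : T + 1 < x := hx
      nlinarith [sq_nonneg ‖u T‖]
    exact not_integrableOn_Ioi_of_one_le h3
      (hu.mono_set (Ioi_subset_Ioi (by linarith)))
  · have h1 := integrableOn_Ioi_deriv_of_nonneg' (a := a) (fun x _ => hJd x)
      (fun x _ => le_trans (by positivity) (hJge x)) hl
    have h2 : IntegrableOn (fun x => w₀ * ‖v x‖ ^ 2) (Ioi a) := by
      refine Integrable.mono' h1
        (((h.continuous_snd.norm).pow 2).const_mul w₀).aestronglyMeasurable
        (Eventually.of_forall fun x => ?_)
      rw [Real.norm_of_nonneg (by positivity)]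
      exact hJge x
    refine (h2.const_mul w₀⁻¹).congr (Eventually.of_forall fun x => ?_)
    field_simp

/-- Square integrable solutions and their derivatives tend to zero at `+∞`. -/
lemma tendsto_atTop_zero (h : IsSol w V u v) {w₀ w₁ M a : ℝ} (hwc : Continuous w) (hw₀ : 0 < w₀)
    (hw : ∀ x, w₀ ≤ w x) (hw' : ∀ x, w x ≤ w₁) (hVc : Continuous V) (hM : ∀ x, ‖V x‖ ≤ M)
    (hu : IntegrableOn (fun x => ‖u x‖ ^ 2) (Ioi a)) :
    Tendsto u atTop (𝓝 0) ∧ Tendsto v atTop (𝓝 0) := by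
  have hM0 : 0 ≤ M := (norm_nonneg _).trans (hM 0)
  have hw1 : 0 ≤ w₁ := hw₀.le.trans ((hw 0).trans (hw' 0))
  have hv := h.integrableOn_norm_sq_snd hw₀ hw hw' hM hu
  have huc := h.continuous_fst
  have hvc := h.continuous_snd
  have hsum : IntegrableOn (fun x => ‖u x‖ ^ 2 + ‖v x‖ ^ 2) (Ioi a) := hu.add hv
  have hmul : ∀ x, ‖v x‖ * ‖u x‖ ≤ ‖u x‖ ^ 2 + ‖v x‖ ^ 2 := fun x => by
    nlinarith [sq_nonneg (‖u x‖ - ‖v x‖), sq_nonneg ‖u x‖, sq_nonneg ‖v x‖]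
  have hsq : ∀ f : ℝ → ℂ, Tendsto (fun x => ‖f x‖ ^ 2) atTop (𝓝 0) → Tendsto f atTop (𝓝 0) := by
    intro f hf
    rw [tendsto_zero_iff_norm_tendsto_zero]
    have := (Real.continuous_sqrt.tendsto 0).comp hf
    simpa [Function.comp_def, Real.sqrt_sq] using this
  constructor
  -- An integrable function with integrable derivative tends to zero; this is applied to ‖u‖² and to
  -- ‖v‖².
  · refine hsq u (tendsto_zero_of_hasDerivAt_of_integrableOn_Ioi
      (fun x _ => h.hasDerivAt_norm_sq_fst x) ?_ hu)
    refine Integrable.mono' (hsum.const_mul (2 * w₁))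
      (by fun_prop : Continuous fun x => 2 * w x * inner ℝ (u x) (v x)).aestronglyMeasurable
      (Eventually.of_forall fun x => ?_)
    rw [norm_mul, Real.norm_of_nonneg (by linarith [hw x])]
    have h1 : ‖inner ℝ (u x) (v x)‖ ≤ ‖u x‖ * ‖v x‖ := norm_inner_le_norm _ _
    have h2 := hmul x
    have h3 := hw' x
    have h4 : ‖inner ℝ (u x) (v x)‖ ≤ ‖u x‖ ^ 2 + ‖v x‖ ^ 2 := by linarith [mul_comm ‖u x‖ ‖v x‖]
    gcongr
  · refine hsq v (tendsto_zero_of_hasDerivAt_of_integrableOn_Ioi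
      (fun x _ => h.hasDerivAt_norm_sq_snd x) ?_ hv)
    refine Integrable.mono' (hsum.const_mul (2 * w₁ * M))
      (by fun_prop : Continuous fun x => 2 * w x * inner ℝ (v x) (V x * u x)).aestronglyMeasurable
      (Eventually.of_forall fun x => ?_)
    rw [norm_mul, Real.norm_of_nonneg (by linarith [hw x]), mul_assoc (2 * w₁)]
    have h1 := abs_inner_mul_le (u := u) hM x (v x)
    have h2 := mul_le_mul_of_nonneg_left (hmul x) hM0
    have h3 := hw' x
    rw [Real.norm_eq_abs]
    have h4 := h1.trans h2
    gcongr

/-- Square integrable solutions and their derivatives tend to zero at `-∞`. -/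
lemma tendsto_atBot_zero (h : IsSol w V u v) {w₀ w₁ M a : ℝ} (hwc : Continuous w) (hw₀ : 0 < w₀)
    (hw : ∀ x, w₀ ≤ w x) (hw' : ∀ x, w x ≤ w₁) (hVc : Continuous V) (hM : ∀ x, ‖V x‖ ≤ M)
    (hu : IntegrableOn (fun x => ‖u x‖ ^ 2) (Iio a)) :
    Tendsto u atBot (𝓝 0) ∧ Tendsto v atBot (𝓝 0) := by
  have hr := h.reflect.tendsto_atTop_zero (a := -a) (by fun_prop) hw₀ (fun x => hw _)
    (fun x => hw' _) (by fun_prop) (fun x => hM _)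
    (by
      have := ((Measure.measurePreserving_neg (volume : Measure ℝ)).integrableOn_comp_preimage
        (Homeomorph.neg ℝ).measurableEmbedding (f := fun x => ‖u x‖ ^ 2) (s := Iio a)).2 hu
      simpa [Function.comp_def] using this)
  exact ⟨by simpa [Function.comp_def] using hr.1.comp tendsto_neg_atBot_atTop,
    by simpa [Function.comp_def] using hr.2.neg.comp tendsto_neg_atBot_atTop⟩

end IsSol

end

/-! ### Positive solutions and existence of the ground state -/

namespace IsSol

variable {w V u v : ℝ → ℝ}

lemma continuous_fst_real (h : IsSol w V u v) : Continuous u :=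
  continuous_iff_continuousAt.2 fun x => (h.fst x).continuousAt

lemma continuous_snd_real (h : IsSol w V u v) : Continuous v :=
  continuous_iff_continuousAt.2 fun x => (h.snd x).continuousAt

/-- A solution that is positive and increasing at `z` stays so as long as the potential is
nonnegative. -/
lemma pos_of_nonneg (h : IsSol w V u v) (hw : ∀ x, 0 ≤ w x) {z : ℝ} (hV : ∀ x, z ≤ x → 0 ≤ V x)
    (hu : 0 < u z) (hv : 0 < v z) {x : ℝ} (hx : z ≤ x) : 0 < u x ∧ 0 < v x := by
  -- The product u v is nondecreasing where V ≥ 0, so it stays positive and u cannot reach a zero.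
  have hd : ∀ x, HasDerivAt (fun x => u x * v x) (w x * (v x ^ 2 + V x * u x ^ 2)) x := fun x =>
    ((h.fst x).fun_mul (h.snd x)).congr_deriv (by simp only [smul_eq_mul]; ring)
  have hmono : MonotoneOn (fun x => u x * v x) (Ici z) := by
    refine monotoneOn_of_deriv_nonneg (convex_Ici z)
      (fun x _ => (hd x).continuousAt.continuousWithinAt)
      (fun x _ => (hd x).differentiableAt.differentiableWithinAt) fun x hx => ?_
    rw [(hd x).deriv]
    have := hV x (interior_subset hx)
    have := hw x
    positivity
  have hpos : ∀ x, z ≤ x → 0 < u x * v x := fun x hx =>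
    (mul_pos hu hv).trans_le (hmono self_mem_Ici hx hx)
  have hux : 0 < u x := by
    by_contra hneg
    obtain ⟨y, hy, hy0⟩ := intermediate_value_Icc' hx h.continuous_fst_real.continuousOn
      (⟨not_lt.1 hneg, hu.le⟩ : (0 : ℝ) ∈ Icc (u x) (u z))
    have := hpos y hy.1
    simp [hy0] at this
  exact ⟨hux, (mul_pos_iff_of_pos_left hux).1 (hpos x hx)⟩

/-- A nonnegative nontrivial solution is positive. -/
lemma pos_of_forall_nonneg (h : IsSol w V u v) {w₁ M : ℝ} (hw : ∀ x, 0 < w x)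
    (hw' : ∀ x, w x ≤ w₁) (hM : ∀ x, |V x| ≤ M) (hu : ∀ x, 0 ≤ u x) {z : ℝ} (hz : u z ≠ 0) (x : ℝ) :
    0 < u x := by
  refine (hu x).lt_of_ne fun hx => hz ?_
  have hmin : IsLocalMin u x := Eventually.of_forall fun y => hx ▸ hu y
  have h1 := hmin.hasDerivAt_eq_zero (h.fst x)
  have h2 : v x = 0 := by simpa [(hw x).ne'] using h1
  exact (h.eq_zero (fun x => (hw x).le) hw' hM hx.symm h2 z).1

end IsSol

/-- A positive solution for `W + k²` restricts the half-line energy of a solution `u` for `W`. -/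
lemma IsTame.mul_sub_le_of_pos {w W : ℝ → ℝ} {w₀ w₁ C R : ℝ} (hT : IsTame w W w₀ w₁ C R)
    {u v ψ π : ℝ → ℝ} (h : IsSol w W u v) {s k : ℝ} (hu : IntegrableOn (fun x => u x ^ 2) (Ioi s))
    (hk : k ^ 2 ≤ 1) (hψ : IsSol w (fun x => W x + k ^ 2) ψ π) (hpos : ∀ x, 0 < ψ x) :
    u s * v s - u s ^ 2 * (1 / w₀ + (C / w₀ + 1) * w₁) ≤ k ^ 2 * (w₁ * ∫ x in Ioi s, u x ^ 2) := by
  -- The Riccati bound for any potential at most C / w₀ + 1. It serves every k with k² ≤ 1, which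
  -- allows s to be fixed before k is chosen.
  set m := 1 / w₀ + (C / w₀ + 1) * w₁ with hm
  set σ : ℝ → ℝ := fun x => ∫ t in (0 : ℝ)..x, w t with hσdef
  have hσ : ∀ x, HasDerivAt σ (w x) x := fun x =>
    intervalIntegral.integral_hasDerivAt_right (hT.contw.intervalIntegrable _ _)
      (hT.contw.stronglyMeasurableAtFilter _ _) hT.contw.continuousAt
  have hC0 : 0 ≤ C / w₀ := div_nonneg hT.C_nonneg hT.pos.le
  have hVb : ∀ x, W x + k ^ 2 ≤ C / w₀ + 1 := fun x => by linarith [(abs_le.1 (hT.abs_potential_le x)).2]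
  have hup : ∀ x, π x / ψ x ≤ m := fun x => by
    rw [div_le_iff₀ (hpos x)]
    exact hψ.le_mul_of_pos hσ hT.pos hT.le hT.ge hVb (by linarith) fun y _ => hpos y
  have hlow : ∀ x, -m ≤ π x / ψ x := fun x => by
    rw [le_div_iff₀ (hpos x)]
    have := hψ.neg_mul_le_of_pos hσ hT.pos hT.le hT.ge hVb (by linarith) (s := x) fun y _ => hpos y
    linarith
  have huc : Continuous fun x => u x ^ 2 := h.continuous_fst_real.pow 2
  -- Picone's identity: f' = w (v − u π/ψ)² − k² w u². Adding k² w₁ ∫ u² gives an increasing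
  -- function, and f tends to 0 at +∞ since u and v do and π/ψ is bounded.
  set f : ℝ → ℝ := fun x => u x * v x - u x ^ 2 * (π x / ψ x) with hf
  set g : ℝ → ℝ := fun x => f x + k ^ 2 * (w₁ * ∫ t in s..x, u t ^ 2) with hg
  have hgd : ∀ x, HasDerivAt g
      (w x * (v x - u x * (π x / ψ x)) ^ 2 + k ^ 2 * (w₁ - w x) * u x ^ 2) x := by
    intro x
    have h1 := ((h.fst x).fun_mul (h.snd x)).fun_sub (((h.fst x).fun_pow 2).fun_mul
      ((hψ.snd x).fun_div (hψ.fst x) (hpos x).ne'))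
    have h2 := ((intervalIntegral.integral_hasDerivAt_right (huc.intervalIntegrable s x)
      (huc.stronglyMeasurableAtFilter _ _) huc.continuousAt).const_mul w₁).const_mul (k ^ 2)
    refine (h1.fun_add h2).congr_deriv ?_
    have := (hpos x).ne'
    simp only [smul_eq_mul]
    field_simp
    ring
  have hgm : Monotone g := by
    refine monotone_of_deriv_nonneg (fun x => (hgd x).differentiableAt) fun x => ?_
    rw [(hgd x).deriv]
    have h1 := hT.w_pos x
    have h2 := sub_nonneg.2 (hT.ge x)
    positivity
  have hlim : Tendsto f atTop (𝓝 0) := by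
    have hc := h.ofReal.tendsto_atTop_zero (a := s) (M := C / w₀) hT.contw hT.pos hT.le hT.ge
      (Complex.continuous_ofReal.comp hT.contW)
      (fun x => by rw [Complex.norm_real]; exact hT.abs_potential_le x) (by simpa using hu)
    have hu0 : Tendsto u atTop (𝓝 0) := by
      simpa [Function.comp_def] using (Complex.continuous_re.tendsto 0).comp hc.1
    have hv0 : Tendsto v atTop (𝓝 0) := by
      simpa [Function.comp_def] using (Complex.continuous_re.tendsto 0).comp hc.2
    have h1 : Tendsto (fun x => u x * v x) atTop (𝓝 0) := by simpa using hu0.mul hv0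
    have h2 : Tendsto (fun x => u x ^ 2 * (π x / ψ x)) atTop (𝓝 0) := by
      have h3 : Tendsto (fun x => u x ^ 2 * m) atTop (𝓝 0) := by
        simpa using (hu0.pow 2).mul_const m
      have h4 : Tendsto (fun x => -(u x ^ 2 * m)) atTop (𝓝 0) := by simpa using h3.neg
      refine tendsto_of_tendsto_of_tendsto_of_le_of_le h4 h3 (fun x => ?_) fun x => ?_
      · nlinarith [hlow x, sq_nonneg (u x)]
      · exact mul_le_mul_of_nonneg_left (hup x) (sq_nonneg _)
    simpa using h1.sub h2
  have hle : ∀ x, s ≤ x → f s ≤ f x + k ^ 2 * (w₁ * ∫ x in Ioi s, u x ^ 2) := by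
    intro x hx
    have h1 := hgm hx
    simp only [hg, intervalIntegral.integral_same, mul_zero, add_zero] at h1
    have h2 : ∫ t in s..x, u t ^ 2 ≤ ∫ x in Ioi s, u x ^ 2 := by
      rw [intervalIntegral.integral_of_le hx]
      exact setIntegral_mono_set hu (Eventually.of_forall fun x => by positivity)
        (Ioc_subset_Ioi_self.eventuallyLE)
    have h3 : 0 ≤ w₁ := (hT.w_pos 0).le.trans (hT.ge 0)
    have h4 := mul_le_mul_of_nonneg_left (mul_le_mul_of_nonneg_left h2 h3) (sq_nonneg k)
    linarith
  have h5 : f s ≤ 0 + k ^ 2 * (w₁ * ∫ x in Ioi s, u x ^ 2) :=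
    ge_of_tendsto (hlim.add_const _) ((eventually_ge_atTop s).mono hle)
  have h6 : u s ^ 2 * (π s / ψ s) ≤ u s ^ 2 * m := mul_le_mul_of_nonneg_left (hup s) (sq_nonneg _)
  simp only [hf] at h5
  linarith

/-- Square integrability of a positive solution that does not grow at `+∞`. -/
lemma IsTame.integrableOn_sq_Ioi {w W : ℝ → ℝ} {w₀ w₁ C R : ℝ} (hT : IsTame w W w₀ w₁ C R)
    {ψ π : ℝ → ℝ} {β : ℝ} (hβ : 0 < β) (h : IsSol w (fun x => W x + β ^ 2) ψ π)
    (hpos : ∀ x, 0 < ψ x) (hanti : AntitoneOn ψ (Ici R)) {a : ℝ} (ha : R < a) :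
    IntegrableOn (fun x => ψ x ^ 2) (Ioi a) := by
  have hπ : ∀ x, R < x → π x ≤ 0 := by
    intro x hx
    have h1 : derivWithin ψ (Ici R) x ≤ 0 := hanti.derivWithin_nonpos
    rw [((h.fst x).hasDerivWithinAt).derivWithin (uniqueDiffOn_Ici R x hx.le), smul_eq_mul] at h1
    exact nonpos_of_mul_nonpos_right h1 (hT.w_pos x)
  have hge : ∀ x, R ≤ x → w₀ * β ^ 2 * ψ x ≤ w x * ((W x + β ^ 2) * ψ x) := by
    intro x hx
    have h1 := hT.le x
    have h2 := hT.nonneg x hx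
    have h3 := (hpos x).le
    have h4 := hT.pos.le
    calc w₀ * β ^ 2 * ψ x = w₀ * (β ^ 2 * ψ x) := by ring
      _ ≤ w x * ((W x + β ^ 2) * ψ x) := by
        have h5 : β ^ 2 ≤ W x + β ^ 2 := by linarith
        have h6 : 0 ≤ w x := h4.trans h1
        gcongr
  -- Beyond R, π is nonpositive and nondecreasing, hence convergent, so its derivative is
  -- integrable. That derivative dominates ψ, and ψ² ≤ ψ(a) ψ. The maximum with a gives a function
  -- that is monotone on the whole line.
  have hmono : Monotone fun x => π (max x a) := by
    have hon : MonotoneOn π (Ici R) := by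
      refine monotoneOn_of_deriv_nonneg (convex_Ici R) h.continuous_snd_real.continuousOn
        (fun x _ => (h.snd x).differentiableAt.differentiableWithinAt) fun x hx => ?_
      rw [(h.snd x).deriv]
      have h1 := hT.pos.le
      have h3 := (hpos x).le
      exact le_trans (by positivity) (hge x (interior_subset hx))
    intro x y hxy
    exact hon (ha.le.trans (le_max_right _ _)) (ha.le.trans (le_max_right _ _))
      (max_le_max_right _ hxy)
  obtain ⟨l, hl⟩ : ∃ l, Tendsto π atTop (𝓝 l) := by
    rcases tendsto_atTop_of_monotone hmono with hlim | ⟨l, hl⟩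
    · exfalso
      obtain ⟨x, hx⟩ := (hlim.eventually_ge_atTop 1).exists
      linarith [hπ (max x a) (ha.trans_le (le_max_right _ _))]
    · refine ⟨l, hl.congr' ?_⟩
      filter_upwards [eventually_ge_atTop a] with x hx
      rw [max_eq_left hx]
  have h1 := integrableOn_Ioi_deriv_of_nonneg' (a := a) (fun x _ => h.snd x)
    (fun x hx => le_trans (by
      have h1 := hT.pos.le
      have h3 := (hpos x).le
      positivity) (hge x (ha.trans hx).le)) hl
  have h2 := h1.const_mul (ψ a / (w₀ * β ^ 2))
  refine Integrable.mono' h2 (h.continuous_fst_real.pow 2).aestronglyMeasurable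
    ((ae_restrict_iff' measurableSet_Ioi).2 (Eventually.of_forall fun x hx => ?_))
  have h3 := hge x (ha.trans hx).le
  have h4 := hanti (mem_Ici.2 ha.le) (mem_Ici.2 (ha.trans hx).le) (le_of_lt hx)
  have h5 := hpos x
  have h6 := hpos a
  have h7 := hT.pos
  rw [Real.norm_of_nonneg (by positivity)]
  calc ψ x ^ 2 ≤ ψ a * ψ x := by rw [sq]; gcongr
    _ = ψ a / (w₀ * β ^ 2) * (w₀ * β ^ 2 * ψ x) := by field_simp
    _ ≤ _ := by gcongr; exact h3

/-- If the zero-energy equation has a solution on a half-line `(x₀, ∞)` that is positive, square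
integrable and vanishes at `x₀`, then there is a positive square integrable solution on the line
with negative energy. -/
theorem IsTame.exists_ground_state {w W : ℝ → ℝ} {w₀ w₁ C R : ℝ} (hT : IsTame w W w₀ w₁ C R)
    {u v : ℝ → ℝ} (h : IsSol w W u v) {x₀ : ℝ} (hu0 : u x₀ = 0) (hv0 : 0 < v x₀)
    (hupos : ∀ x, x₀ < x → 0 < u x) (hu : Integrable fun x => u x ^ 2) :
    ∃ β : ℝ, 0 < β ∧ ∃ ψ π : ℝ → ℝ, IsSol w (fun x => W x + β ^ 2) ψ π ∧ (∀ x, 0 < ψ x) ∧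
      Integrable fun x => ψ x ^ 2 := by
  have hw₁ : 0 < w₁ := (hT.w_pos 0).trans_le (hT.ge 0)
  set m := 1 / w₀ + (C / w₀ + 1) * w₁ with hm
  -- At x₀ the quantity v − m u equals v x₀ > 0, so u v − m u² is positive just to the right of x₀.
  obtain ⟨s, hs, hsu⟩ : ∃ s, 0 < u s * v s - u s ^ 2 * m ∧ 0 < u s := by
    have hc : ContinuousAt (fun x => v x - u x * m) x₀ :=
      (h.continuous_snd_real.sub (h.continuous_fst_real.mul_const m)).continuousAt
    have h1 : ∀ᶠ x in 𝓝 x₀, 0 < v x - u x * m :=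
      hc.eventually (lt_mem_nhds (by simpa [hu0] using hv0))
    obtain ⟨s, h2, h3⟩ := ((h1.filter_mono (nhdsWithin_le_nhds (s := Ioi x₀))).and
      self_mem_nhdsWithin).exists
    refine ⟨s, ?_, hupos s h3⟩
    have := mul_pos (hupos s h3) h2
    linarith
  set I := w₁ * ∫ x in Ioi s, u x ^ 2 with hI
  have hI0 : 0 ≤ I := mul_nonneg hw₁.le (integral_nonneg fun x => by positivity)
  set δ := u s * v s - u s ^ 2 * m with hδ
  -- Chosen so that k₁² I < δ; by `IsTame.mul_sub_le_of_pos` the solution with parameter k₁ then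
  -- cannot be positive on the whole line.
  set k₁ := min 1 (δ / (I + 1)) with hk₁def
  have hk₁ : 0 < k₁ := lt_min one_pos (by positivity)
  have hk₁1 : k₁ ≤ 1 := min_le_left _ _
  have hk₁sq : k₁ ^ 2 * I < δ := by
    have h1 : k₁ ≤ δ / (I + 1) := min_le_right _ _
    rw [le_div_iff₀ (by linarith)] at h1
    nlinarith [mul_nonneg hk₁.le hI0, mul_nonneg (mul_nonneg hk₁.le hI0) (sub_nonneg.2 hk₁1)]
  set σ : ℝ → ℝ := fun x => ∫ t in (0 : ℝ)..x, w t with hσdef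
  have hσ : ∀ x, HasDerivAt σ (w x) x := fun x =>
    intervalIntegral.integral_hasDerivAt_right (hT.contw.intervalIntegrable _ _)
      (hT.contw.stronglyMeasurableAtFilter _ _) hT.contw.continuousAt
  have hσd : Differentiable ℝ σ := fun x => (hσ x).differentiableAt
  have hσc : Continuous σ := hσd.continuous
  have hσm : Monotone σ := monotone_of_deriv_nonneg hσd fun x => by
    rw [(hσ x).deriv]; exact (hT.w_pos x).le
  obtain ⟨h', B, hhc, hB, hhB, hheq⟩ := exists_volterra (q := fun x => w x * W x)
    (hT.contw.mul hT.contW) hσc hσm hT.C_nonneg hT.decay hk₁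
  -- Truncation at k₁ extends the family of solutions to all real k, so that connectedness of ℝ
  -- itself can be used.
  set K : ℝ → ℝ := fun k => max k k₁ with hK
  have hKk : ∀ k, k₁ ≤ K k := fun k => le_max_right _ _
  have hKpos : ∀ k, 0 < K k := fun k => hk₁.trans_le (hKk k)
  have hsol := fun k => isSol_of_volterra (k := K k) (h := h' k) hT.contw hT.contW hT.w_pos hσ
    hT.decay (hKpos k) (by fun_prop) hB (hhB k) (hheq k)
  choose r hr hr1 hr2 using hsol
  set Ψ : ℝ → ℝ → ℝ := fun k x => Real.exp (K k * σ x) * h' k x with hΨ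
  set Θ : ℝ → ℝ → ℝ := fun k x => Real.exp (K k * σ x) * (K k * h' k x + r k x) with hΘ
  have hΨc : Continuous (Function.uncurry Ψ) := by
    have : Function.uncurry Ψ = fun z : ℝ × ℝ =>
      Real.exp (max z.1 k₁ * σ z.2) * Function.uncurry h' z := rfl
    rw [this]
    fun_prop
  have hbd : ∀ k x, |W x + K k ^ 2| ≤ C / w₀ + K k ^ 2 := fun k x =>
    (abs_add_le _ _).trans (add_le_add (hT.abs_potential_le x) (abs_of_nonneg (sq_nonneg _)).le)
  -- uniform positivity near `-∞`
  obtain ⟨xL, hxL⟩ : ∃ xL, ∀ x, x ≤ xL → B * C * (Real.arctan x + Real.pi / 2) ≤ k₁ / 4 := by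
    have h1 : Tendsto (fun x => B * C * (Real.arctan x + Real.pi / 2)) atBot
        (𝓝 (B * C * (-(Real.pi / 2) + Real.pi / 2))) :=
      ((tendsto_nhds_of_tendsto_nhdsWithin Real.tendsto_arctan_atBot).add_const _).const_mul _
    rw [neg_add_cancel, mul_zero] at h1
    exact eventually_atBot.1 (h1.eventually_le_const (by positivity))
  -- To the left of `xL` one has h ≥ 7/8 and |r| ≤ k₁/4 for every k, so both the solution and its
  -- derivative are positive there, uniformly in k.
  have hleft : ∀ k x, x ≤ xL → 0 < Ψ k x ∧ 0 < Θ k x := by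
    intro k x hx
    have h1 := hxL x hx
    have h2 : h' k x ≥ 7 / 8 := by
      have h3 : 1 / (2 * K k) * (B * C * (Real.arctan x + Real.pi / 2)) ≤ 1 / 8 := by
        rw [one_div_mul_eq_div, div_le_iff₀ (by linarith [hKpos k])]
        linarith [hKk k]
      linarith [(abs_le.1 (hr1 k x)).1]
    have h4 := (abs_le.1 (hr2 k x)).1
    have h5 := Real.exp_pos (K k * σ x)
    refine ⟨mul_pos h5 (by linarith), mul_pos h5 ?_⟩
    nlinarith [hKk k]
  have hposK : ∀ k, (∀ x, 0 ≤ Ψ k x) → ∀ x, 0 < Ψ k x := fun k hk x =>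
    (hr k).pos_of_forall_nonneg hT.w_pos hT.ge (hbd k) hk (hleft k xL le_rfl).1.ne' x
  -- In A the solution takes a negative value. In D it is positive up to x₂ and has already risen
  -- inside [R, ∞), where the potential is nonnegative. Since positivity left of `xL` is automatic,
  -- D only asks for positivity on a compact interval, and this makes it open.
  set A : Set ℝ := {k | ∃ x, Ψ k x < 0} with hA
  set D : Set ℝ := {k | ∃ x₁ x₂, R ≤ x₁ ∧ x₁ < x₂ ∧ Ψ k x₁ < Ψ k x₂ ∧
    ∀ x ∈ Icc xL x₂, 0 < Ψ k x} with hD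
  have hΨk : ∀ x, Continuous fun k => Ψ k x := fun x =>
    hΨc.comp (by fun_prop : Continuous fun k : ℝ => (k, x))
  have hAo : IsOpen A := by
    simp only [hA, ofPred_exists]
    exact isOpen_iUnion fun x => isOpen_lt (hΨk x) continuous_const
  have hDo : IsOpen D := by
    refine isOpen_iff_mem_nhds.2 fun k hk => ?_
    obtain ⟨x₁, x₂, h1, h2, h3, h4⟩ := hk
    have h5 : ∀ᶠ k' in 𝓝 k, ∀ x ∈ Icc xL x₂, 0 < Ψ k' x := by
      refine isCompact_Icc.eventually_forall_of_forall_eventually fun x hx => ?_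
      exact hΨc.continuousAt.eventually (lt_mem_nhds (h4 x hx))
    have h6 : ∀ᶠ k' in 𝓝 k, Ψ k' x₁ < Ψ k' x₂ :=
      (isOpen_lt (hΨk x₁) (hΨk x₂)).mem_nhds h3
    filter_upwards [h5, h6] with k' h7 h8
    exact ⟨x₁, x₂, h1, h2, h8, h7⟩
  have hdisj : ¬ (univ ∩ (A ∩ D)).Nonempty := by
    rintro ⟨k, -, ⟨y, hy⟩, x₁, x₂, h1, h2, h3, h4⟩
    -- The mean value theorem gives a point beyond R at which the solution and its derivative are
    -- positive; from there on it stays positive, so it is never negative.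
    obtain ⟨ξ, hξ, hξ'⟩ := exists_hasDerivAt_eq_slope (Ψ k) (fun x => w x • Θ k x) h2
      (hr k).continuous_fst_real.continuousOn (fun x _ => (hr k).fst x)
    have h5 : 0 < Θ k ξ := by
      have h6 : 0 < w ξ * Θ k ξ := by
        rw [← smul_eq_mul, hξ']
        exact div_pos (by linarith) (by linarith)
      exact (mul_pos_iff_of_pos_left (hT.w_pos ξ)).1 h6
    have h7 : ∀ x, x ≤ x₂ → 0 < Ψ k x := fun x hx => by
      rcases le_total x xL with hx' | hx'
      · exact (hleft k x hx').1
      · exact h4 x ⟨hx', hx⟩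
    have h8 : 0 < Ψ k y := by
      rcases le_total y ξ with hy' | hy'
      · exact h7 y (hy'.trans hξ.2.le)
      · refine ((hr k).pos_of_nonneg (fun x => (hT.w_pos x).le) (z := ξ) (fun x hx => ?_)
          (h7 ξ hξ.2.le) h5 hy').1
        have := hT.nonneg x (h1.trans (hξ.1.le.trans hx))
        positivity
    linarith
  have hAne : (univ ∩ A).Nonempty := by
    refine ⟨k₁, mem_univ _, ?_⟩
    by_contra hcon
    have hK1 : K k₁ = k₁ := max_self _
    have h1 : ∀ x, 0 ≤ Ψ k₁ x := fun x => not_lt.1 fun hx => hcon ⟨x, hx⟩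
    have h2 := hT.mul_sub_le_of_pos h (s := s) (k := K k₁) hu.integrableOn
      (by rw [hK1]; nlinarith) (hr k₁) (hposK k₁ h1)
    rw [hK1] at h2
    linarith
  have hDne : (univ ∩ D).Nonempty := by
    -- For this k one has K² ≥ K ≥ C/w₀ + 1, so W + K² is positive everywhere and the solution
    -- increases from `xL` onwards.
    refine ⟨C / w₀ + 1, mem_univ _, max R xL, max R xL + 1, le_max_left _ _, by linarith, ?_, ?_⟩
    all_goals
      have hC0 : 0 ≤ C / w₀ := div_nonneg hT.C_nonneg hT.pos.le
      have h1 : C / w₀ + 1 ≤ K (C / w₀ + 1) := le_max_left _ _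
      have h2 : ∀ x, xL ≤ x → 0 < Ψ (C / w₀ + 1) x ∧ 0 < Θ (C / w₀ + 1) x := fun x hx =>
        (hr _).pos_of_nonneg (fun x => (hT.w_pos x).le) (z := xL)
          (fun x _ => by nlinarith [(abs_le.1 (hT.abs_potential_le x)).1]) (hleft _ xL le_rfl).1
          (hleft _ xL le_rfl).2 hx
    · refine strictMonoOn_of_deriv_pos (convex_Ici xL)
        (hr _).continuous_fst_real.continuousOn (fun x hx => ?_) (le_max_right R xL)
        ((le_max_right R xL).trans (by linarith)) (by linarith)
      rw [((hr _).fst x).deriv]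
      exact mul_pos (hT.w_pos x) (h2 x (interior_subset hx)).2
    · exact fun x hx => (h2 x hx.1).1
  obtain ⟨k, hkA, hkD⟩ : ∃ k, k ∉ A ∧ k ∉ D := by
    by_contra hcon
    push Not at hcon
    refine hdisj (isPreconnected_univ A D hAo hDo (fun k _ => ?_) hAne hDne)
    by_cases hk : k ∈ A
    · exact Or.inl hk
    · exact Or.inr (hcon k hk)
  have hpos : ∀ x, 0 < Ψ k x := hposK k fun x => not_lt.1 fun hx => hkA ⟨x, hx⟩
  have hanti : AntitoneOn (Ψ k) (Ici R) := by
    intro x₁ hx₁ x₂ _ h12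
    by_contra hcon
    push Not at hcon
    have hne : x₁ ≠ x₂ := fun he => by rw [he] at hcon; exact lt_irrefl _ hcon
    exact hkD ⟨x₁, x₂, hx₁, lt_of_le_of_ne h12 hne, hcon, fun x _ => hpos x⟩
  refine ⟨K k, hKpos k, Ψ k, Θ k, hr k, hpos, ?_⟩
  have hcont : Continuous fun x => Ψ k x ^ 2 := (hr k).continuous_fst_real.pow 2
  have hright := hT.integrableOn_sq_Ioi (hKpos k) (hr k) hpos hanti
    (a := max (R + 1) 0) (by linarith [le_max_left (R + 1) 0])
  have hmid : IntegrableOn (fun x => Ψ k x ^ 2) (Icc 0 (max (R + 1) 0)) :=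
    hcont.continuousOn.integrableOn_compact isCompact_Icc
  -- For x ≤ 0 one has σ x ≤ w₀ x, so e^{2Kσ} decays exponentially while h stays bounded.
  have hlft : IntegrableOn (fun x => Ψ k x ^ 2) (Iic 0) := by
    have h1 : IntegrableOn (fun x => B ^ 2 * Real.exp (2 * K k * w₀ * x)) (Iic 0) :=
      (integrableOn_exp_mul_Iic (by have := hKpos k; have := hT.pos; positivity) 0).const_mul _
    refine Integrable.mono' h1 hcont.aestronglyMeasurable
      ((ae_restrict_iff' measurableSet_Iic).2 (Eventually.of_forall fun x hx => ?_))
    have h2 : σ x ≤ w₀ * x := by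
      have := mul_sub_le_image_sub_of_le_deriv hσd (fun y => (hσ y).deriv ▸ hT.le y)
        (mem_Iic.1 hx)
      have h0 : σ 0 = 0 := by simp [hσdef]
      rw [h0] at this
      linarith
    rw [Real.norm_of_nonneg (by positivity)]
    simp only [hΨ]
    rw [mul_pow, ← Real.exp_nat_mul, mul_comm]
    have h3 : h' k x ^ 2 ≤ B ^ 2 := sq_le_sq' (by linarith [(abs_le.1 (hhB k x)).1])
      (abs_le.1 (hhB k x)).2
    have h4 : ((2 : ℕ) : ℝ) * (K k * σ x) ≤ 2 * K k * w₀ * x := by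
      push_cast
      nlinarith [hKpos k]
    gcongr
  rw [← integrableOn_univ]
  refine ((hlft.union hmid).union hright).mono_set fun x _ => ?_
  rcases le_total x 0 with hx | hx
  · exact Or.inl (Or.inl hx)
  · rcases le_or_gt x (max (R + 1) 0) with hx' | hx'
    · exact Or.inl (Or.inr ⟨hx, hx'⟩)
    · exact Or.inr hx'

/-! ### Uniqueness of the ground state -/

namespace IsSol

lemma conj {w : ℝ → ℝ} {V u v : ℝ → ℂ} (h : IsSol w V u v) :
    IsSol w (fun x => star (V x)) (fun x => star (u x)) (fun x => star (v x)) where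
  fst x := (h.fst x).star.congr_deriv (by simp)
  snd x := (h.snd x).star.congr_deriv (by simp)

lemma neg {w V u v : ℝ → ℝ} (h : IsSol w V u v) : IsSol w V (fun x => -u x) (fun x => -v x) where
  fst x := (h.fst x).fun_neg.congr_deriv (by simp)
  snd x := (h.snd x).fun_neg.congr_deriv (by simp)

/-- Solutions that vanish at infinity together with their derivatives, and whose potentials differ
by a nonzero constant, are orthogonal. -/
lemma integral_mul_eq_zero {w : ℝ → ℝ} {V₁ V₂ f g p q : ℝ → ℂ} (h₁ : IsSol w V₁ f g)
    (h₂ : IsSol w V₂ p q) {c : ℂ} (hc : c ≠ 0) (hV : ∀ x, V₂ x - V₁ x = c)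
    (hi : Integrable fun x => (w x : ℂ) * (f x * p x))
    (hf : Tendsto f atTop (𝓝 0)) (hf' : Tendsto f atBot (𝓝 0))
    (hg : Tendsto g atTop (𝓝 0)) (hg' : Tendsto g atBot (𝓝 0))
    (hp : Tendsto p atTop (𝓝 0)) (hp' : Tendsto p atBot (𝓝 0))
    (hq : Tendsto q atTop (𝓝 0)) (hq' : Tendsto q atBot (𝓝 0)) :
    ∫ x, (w x : ℂ) * (f x * p x) = 0 := by
  -- The Wronskian has derivative c w f p and vanishes at both ends.
  have hd : ∀ x, HasDerivAt (fun x => f x * q x - g x * p x) (c * ((w x : ℂ) * (f x * p x))) x := by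
    intro x
    refine (((h₁.fst x).fun_mul (h₂.snd x)).fun_sub ((h₁.snd x).fun_mul (h₂.fst x))).congr_deriv ?_
    simp only [Complex.real_smul]
    rw [← hV x]
    ring
  have h3 := integral_of_hasDerivAt_of_tendsto hd (hi.const_mul c)
    (by simpa using (hf'.mul hq').sub (hg'.mul hp')) (by simpa using (hf.mul hq).sub (hg.mul hp))
  rw [integral_const_mul, sub_self] at h3
  exact (mul_eq_zero.1 h3).resolve_left hc

end IsSol

/-- Positivity of the energy form on functions `p` vanishing at `x₀`, on a half-line `(x₀, ∞)` where
the zero-energy equation has a positive solution that vanishes at `x₀`. -/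
lemma IsTame.setIntegral_inner_nonpos {w W : ℝ → ℝ} {w₀ w₁ M x₀ : ℝ} (hwc : Continuous w)
    (hw₀ : 0 < w₀) (hw : ∀ x, w₀ ≤ w x) (hw' : ∀ x, w x ≤ w₁) (hWM : ∀ x, W x ≤ M) (hM : 0 ≤ M)
    {u v : ℝ → ℝ} (h : IsSol w W u v) (hu0 : u x₀ = 0) (hv0 : v x₀ ≠ 0)
    (hupos : ∀ x, x₀ < x → 0 < u x) {p q S : ℝ → ℂ} (hS : Continuous S)
    (hp : ∀ x, HasDerivAt p (w x • q x) x)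
    (hq : ∀ x, HasDerivAt q (w x • ((W x : ℂ) * p x + S x)) x) (hp0 : p x₀ = 0)
    (hplim : Tendsto p atTop (𝓝 0)) (hqlim : Tendsto q atTop (𝓝 0))
    (hi : IntegrableOn (fun x => w x * inner ℝ (p x) (S x)) (Ioi x₀)) :
    ∫ x in Ioi x₀, w x * inner ℝ (p x) (S x) ≤ 0 := by
  have hpc : Continuous p := continuous_iff_continuousAt.2 fun x => (hp x).continuousAt
  have hqc : Continuous q := continuous_iff_continuousAt.2 fun x => (hq x).continuousAt
  have hic : Continuous fun x => w x * inner ℝ (p x) (S x) := by fun_prop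
  -- Picone's identity again: J' = w (‖q − (v/u) p‖² + ⟨p, S⟩). Hence F, which is J minus the
  -- integral of the source term, is nondecreasing; it tends to 0 at x₀ and to minus the full
  -- integral at +∞.
  set J : ℝ → ℝ := fun x => inner ℝ (p x) (q x) - ‖p x‖ ^ 2 * (v x / u x) with hJ
  set F : ℝ → ℝ := fun x => J x - ∫ t in x₀..x, w t * inner ℝ (p t) (S t) with hF
  have hFd : ∀ x, x₀ < x → HasDerivAt F (w x * ‖q x - (v x / u x) • p x‖ ^ 2) x := by
    intro x hx
    have hux := (hupos x hx).ne'
    have h1 := ((hp x).inner ℝ (hq x)).fun_sub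
      ((hp x).norm_sq.fun_mul ((h.snd x).fun_div (h.fst x) hux))
    have h2 := intervalIntegral.integral_hasDerivAt_right (hic.intervalIntegrable x₀ x)
      (hic.stronglyMeasurableAtFilter _ _) hic.continuousAt
    refine (h1.fun_sub h2).congr_deriv ?_
    have h3 : (W x : ℂ) * p x = W x • p x := (Complex.real_smul).symm
    rw [h3, norm_sub_sq_real, norm_smul, mul_pow, Real.norm_eq_abs, sq_abs]
    simp only [real_inner_smul_right, real_inner_smul_left, inner_add_right, smul_eq_mul,
      real_inner_self_eq_norm_sq]
    rw [real_inner_comm (q x) (p x)]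
    field_simp
    ring
  have hFm : MonotoneOn F (Ioi x₀) := by
    refine monotoneOn_of_deriv_nonneg (convex_Ioi x₀)
      (fun x hx => (hFd x hx).continuousAt.continuousWithinAt)
      (fun x hx => (hFd x (interior_subset hx)).differentiableAt.differentiableWithinAt)
      fun x hx => ?_
    rw [(hFd x (interior_subset hx)).deriv]
    have := hw₀.le.trans (hw x)
    positivity
  have hF0 : Tendsto F (𝓝[>] x₀) (𝓝 0) := by
    have hle : 𝓝[>] x₀ ≤ 𝓝 x₀ := nhdsWithin_le_nhds
    have h1 : Tendsto (fun x => inner ℝ (p x) (q x)) (𝓝[>] x₀) (𝓝 0) := by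
      have : Tendsto (fun x => inner ℝ (p x) (q x)) (𝓝 x₀) (𝓝 (inner ℝ (p x₀) (q x₀))) :=
        (hpc.inner hqc).tendsto x₀
      rw [hp0, inner_zero_left] at this
      exact this.mono_left hle
    have h2 : Tendsto (fun x => ∫ t in x₀..x, w t * inner ℝ (p t) (S t)) (𝓝[>] x₀) (𝓝 0) := by
      have h3 := (intervalIntegral.integral_hasDerivAt_right (hic.intervalIntegrable x₀ x₀)
        (hic.stronglyMeasurableAtFilter _ _) hic.continuousAt).continuousAt
      have h4 := h3.tendsto.mono_left hle
      rwa [intervalIntegral.integral_same] at h4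
    -- Here ‖p‖²/u is ‖p‖ times a quotient of slopes at x₀. The slope of u has a nonzero limit
    -- because the zero is simple, and p vanishes at x₀.
    have h5 : Tendsto (fun x => ‖p x‖ ^ 2 * (v x / u x)) (𝓝[>] x₀) (𝓝 0) := by
      have hne : 𝓝[>] x₀ ≤ 𝓝[≠] x₀ := nhdsWithin_mono _ fun x hx => ne_of_gt hx
      have h6 : Tendsto (slope u x₀) (𝓝[>] x₀) (𝓝 (w x₀ • v x₀)) :=
        (h.fst x₀).tendsto_slope.mono_left hne
      have h7 : Tendsto (fun x => ‖slope p x₀ x‖) (𝓝[>] x₀) (𝓝 ‖w x₀ • q x₀‖) :=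
        ((hp x₀).tendsto_slope.mono_left hne).norm
      have h8 : Tendsto (fun x => ‖p x‖) (𝓝[>] x₀) (𝓝 0) := by
        have : Tendsto (fun x => ‖p x‖) (𝓝 x₀) (𝓝 ‖p x₀‖) := hpc.norm.tendsto x₀
        rw [hp0, norm_zero] at this
        exact this.mono_left hle
      have h9 : Tendsto v (𝓝[>] x₀) (𝓝 (v x₀)) :=
        (h.continuous_snd_real.tendsto x₀).mono_left hle
      have h10 : w x₀ • v x₀ ≠ 0 := smul_ne_zero (hw₀.trans_le (hw x₀)).ne' hv0
      have h11 := (h8.mul (h7.div h6 h10)).mul h9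
      rw [zero_mul, zero_mul] at h11
      refine h11.congr' ?_
      filter_upwards [self_mem_nhdsWithin] with x hx
      have hx0 : 0 < x - x₀ := sub_pos.2 hx
      have hux := (hupos x hx).ne'
      simp only [Pi.div_apply]
      rw [slope_def_field, slope_def_module, hu0, hp0, sub_zero, sub_zero, norm_smul, norm_inv,
        Real.norm_of_nonneg hx0.le]
      field_simp
    simpa [hF, hJ] using (h1.sub h5).sub h2
  have hFinf : Tendsto F atTop (𝓝 (-∫ x in Ioi x₀, w x * inner ℝ (p x) (S x))) := by
    have h1 : Tendsto (fun x => inner ℝ (p x) (q x)) atTop (𝓝 0) := by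
      simpa using hplim.inner (𝕜 := ℝ) hqlim
    have h2 := intervalIntegral_tendsto_integral_Ioi x₀ hi tendsto_id
    -- The Riccati bounds keep v/u bounded away from x₀, so the decay of p suffices.
    have h3 : Tendsto (fun x => ‖p x‖ ^ 2 * (v x / u x)) atTop (𝓝 0) := by
      set σ : ℝ → ℝ := fun x => ∫ t in (0 : ℝ)..x, w t with hσdef
      have hσ : ∀ x, HasDerivAt σ (w x) x := fun x =>
        intervalIntegral.integral_hasDerivAt_right (hwc.intervalIntegrable _ _)
          (hwc.stronglyMeasurableAtFilter _ _) hwc.continuousAt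
      set m := 1 / w₀ + M * w₁ with hm
      have h4 : Tendsto (fun x => ‖p x‖ ^ 2 * m) atTop (𝓝 0) := by
        simpa using (hplim.norm.pow 2).mul_const m
      have h5 : Tendsto (fun x => -(‖p x‖ ^ 2 * m)) atTop (𝓝 0) := by simpa using h4.neg
      refine tendsto_of_tendsto_of_tendsto_of_le_of_le' h5 h4 ?_ ?_
      · filter_upwards [eventually_gt_atTop x₀] with x hx
        have h6 := h.neg_mul_le_of_pos hσ hw₀ hw hw' hWM hM (s := x)
          fun y hy => hupos y (hx.trans_le hy.1)
        have h7 : -m ≤ v x / u x := by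
          rw [le_div_iff₀ (hupos x hx)]; linarith
        nlinarith [sq_nonneg ‖p x‖]
      · filter_upwards [eventually_gt_atTop (x₀ + 1)] with x hx
        have h6 := h.le_mul_of_pos hσ hw₀ hw hw' hWM hM (s := x)
          fun y hy => hupos y (by linarith [hy.1])
        have h7 : v x / u x ≤ m := by
          rw [div_le_iff₀ (hupos x (by linarith))]; linarith
        exact mul_le_mul_of_nonneg_left h7 (sq_nonneg _)
    simpa [hF, hJ] using (h1.sub h3).sub h2
  have h1 : ∀ a, x₀ < a → F a ≤ -∫ x in Ioi x₀, w x * inner ℝ (p x) (S x) := fun a ha =>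
    ge_of_tendsto hFinf ((eventually_ge_atTop a).mono fun x hx => hFm ha (lt_of_lt_of_le ha hx) hx)
  have h2 : (0 : ℝ) ≤ -∫ x in Ioi x₀, w x * inner ℝ (p x) (S x) :=
    le_of_tendsto hF0 (eventually_nhdsWithin_of_forall h1)
  linarith

lemma Continuous.eq_zero_of_integral_norm_sq_nonpos {w : ℝ → ℝ} (hwc : Continuous w)
    (hw : ∀ x, 0 < w x) {f : ℝ → ℂ} (hf : Continuous f) (hi : Integrable fun x => w x * ‖f x‖ ^ 2)
    (h : ∫ x, w x * ‖f x‖ ^ 2 ≤ 0) : f = 0 := by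
  have h0 : ∀ x, 0 ≤ w x * ‖f x‖ ^ 2 := fun x => mul_nonneg (hw x).le (sq_nonneg _)
  have h1 : (fun x => w x * ‖f x‖ ^ 2) =ᵐ[volume] 0 :=
    (integral_eq_zero_iff_of_nonneg h0 hi).1 (le_antisymm h (integral_nonneg h0))
  have h2 : (fun x => w x * ‖f x‖ ^ 2) = 0 :=
    (Continuous.ae_eq_iff_eq volume (by fun_prop) continuous_zero).1 h1
  funext x
  simpa [(hw x).ne'] using congrFun h2 x

/-- If the zero-energy equation has a square integrable solution with exactly one node, then a
positive square integrable solution of negative energy is the only square integrable solution off the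
nonnegative half-line, up to complex multiples. -/
theorem IsTame.eq_ground_state {w W : ℝ → ℝ} {w₀ w₁ C R : ℝ} (hT : IsTame w W w₀ w₁ C R)
    {u v : ℝ → ℝ} (h : IsSol w W u v) {x₀ : ℝ} (hu0 : u x₀ = 0) (hv0 : v x₀ ≠ 0)
    (hupos : ∀ x, x₀ < x → 0 < u x) (huneg : ∀ x, x < x₀ → u x < 0) {β : ℝ} (hβ : 0 < β)
    {ψ π : ℝ → ℝ} (hψ : IsSol w (fun x => W x + β ^ 2) ψ π) (hψpos : ∀ x, 0 < ψ x)
    (hψi : Integrable fun x => ψ x ^ 2) {s : ℂ} (hs : 0 < s.re) {f g : ℝ → ℂ}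
    (hf : IsSol w (fun x => (W x : ℂ) + s ^ 2) f g) (hfi : Integrable fun x => ‖f x‖ ^ 2)
    (hf0 : f ≠ 0) : s = β ∧ ∃ k : ℂ, ∀ x, f x = k * ψ x := by
  have hWc : Continuous fun x => (W x : ℂ) := Complex.continuous_ofReal.comp hT.contW
  have hwc := hT.contw
  have hWC : ∀ x, ‖(W x : ℂ)‖ ≤ C / w₀ := fun x => by
    rw [Complex.norm_real]; exact hT.abs_potential_le x
  have hb : ∀ c : ℂ, ∀ x, ‖(W x : ℂ) + c‖ ≤ C / w₀ + ‖c‖ := fun c x =>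
    (norm_add_le _ _).trans (by linarith [hWC x])
  have hfc := hf.continuous_fst
  have hψ' : IsSol w (fun x => (W x : ℂ) + (β : ℂ) ^ 2) (fun x => (ψ x : ℂ)) (fun x => (π x : ℂ)) := by
    simpa using hψ.ofReal
  have hψc := hψ'.continuous_fst
  have hψi' : Integrable fun x => ‖(ψ x : ℂ)‖ ^ 2 := by simpa using hψi
  obtain ⟨hft, hgt⟩ := hf.tendsto_atTop_zero (a := 0) hwc hT.pos hT.le hT.ge (by fun_prop) (hb _)
    hfi.integrableOn
  obtain ⟨hft', hgt'⟩ := hf.tendsto_atBot_zero (a := 0) hwc hT.pos hT.le hT.ge (by fun_prop) (hb _)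
    hfi.integrableOn
  obtain ⟨hpt, hqt⟩ := hψ'.tendsto_atTop_zero (a := 0) hwc hT.pos hT.le hT.ge (by fun_prop) (hb _)
    hψi'.integrableOn
  obtain ⟨hpt', hqt'⟩ := hψ'.tendsto_atBot_zero (a := 0) hwc hT.pos hT.le hT.ge (by fun_prop) (hb _)
    hψi'.integrableOn
  have hint : ∀ {F p q : ℝ → ℂ}, Continuous F → Integrable (fun x => ‖p x‖ ^ 2) →
      Integrable (fun x => ‖q x‖ ^ 2) → (∀ x, ‖F x‖ ≤ ‖p x‖ * ‖q x‖) →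
      Integrable fun x => (w x : ℂ) * F x := by
    intro F p q hF hp hq hFle
    refine Integrable.mono' ((hp.add hq).const_mul w₁)
      (by fun_prop : Continuous fun x => (w x : ℂ) * F x).aestronglyMeasurable
      (Eventually.of_forall fun x => ?_)
    rw [norm_mul, Complex.norm_real, Real.norm_of_nonneg (hT.w_pos x).le]
    have h1 : ‖F x‖ ≤ ‖p x‖ ^ 2 + ‖q x‖ ^ 2 := by
      nlinarith [hFle x, sq_nonneg (‖p x‖ - ‖q x‖), sq_nonneg ‖p x‖, sq_nonneg ‖q x‖]
    have h2 := hT.ge x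
    have h3 : 0 ≤ w₁ := (hT.w_pos x).le.trans h2
    simp only [Pi.add_apply]
    gcongr
  have hintR : ∀ {F : ℝ → ℝ} {p q : ℝ → ℂ}, Continuous F → Integrable (fun x => ‖p x‖ ^ 2) →
      Integrable (fun x => ‖q x‖ ^ 2) → (∀ x, |F x| ≤ ‖p x‖ * ‖q x‖) →
      Integrable fun x => w x * F x := by
    intro F p q hF hp hq hFle
    have := (hint (F := fun x => (F x : ℂ)) (by fun_prop) hp hq
      (fun x => by rw [Complex.norm_real]; exact hFle x)).re
    simpa using this
  have hwf : Integrable fun x => w x * ‖f x‖ ^ 2 :=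
    hintR (by fun_prop) hfi hfi fun x => by rw [abs_of_nonneg (by positivity), sq]
  -- `s` is real
  have him : s.im = 0 := by
    by_contra him
    -- The conjugate of f solves the equation with s̄² in place of s². The imaginary part of the
    -- difference is −4 (Re s)(Im s), so the orthogonality relation would give ∫ w ‖f‖² = 0.
    have hc : (star s) ^ 2 - s ^ 2 ≠ 0 := by
      intro hc
      have := congrArg Complex.im hc
      simp [sq] at this
      have h2 : s.re * s.im = 0 := by linarith
      rcases mul_eq_zero.1 h2 with h3 | h3
      · exact hs.ne' h3
      · exact him h3
    have hst : ∀ {p : ℝ → ℂ} {l : Filter ℝ}, Tendsto p l (𝓝 0) →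
        Tendsto (fun x => star (p x)) l (𝓝 0) := fun hp => by simpa using hp.star
    have h1 := hf.integral_mul_eq_zero hf.conj hc (fun x => by simp)
      (hint (by fun_prop) hfi hfi fun x => by rw [norm_mul, norm_star])
      hft hft' hgt hgt' (hst hft) (hst hft') (hst hgt) (hst hgt')
    have h2 : ∫ x, (w x * ‖f x‖ ^ 2 : ℝ) = 0 := by
      have h3 : ∀ x, (w x : ℂ) * (f x * star (f x)) = ((w x * ‖f x‖ ^ 2 : ℝ) : ℂ) := fun x => by
        have := Complex.mul_conj' (f x)
        simp only [Complex.star_def]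
        rw [this]
        push_cast
        ring
      simp only [h3] at h1
      have h4 := (integral_ofReal (𝕜 := ℂ) (μ := volume) (f := fun x => w x * ‖f x‖ ^ 2)).symm.trans h1
      exact Complex.ofReal_eq_zero.1 h4
    exact hf0 (Continuous.eq_zero_of_integral_norm_sq_nonpos hwc hT.w_pos hfc hwf h2.le)
  obtain ⟨t, rfl⟩ : ∃ t : ℝ, s = t := ⟨s.re, Complex.ext rfl (by simpa using him)⟩
  have ht : 0 < t := by simpa using hs
  -- c is chosen so that p = f − cψ vanishes at x₀, where the Picone argument needs it.
  set c : ℂ := f x₀ / ψ x₀ with hc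
  set p : ℝ → ℂ := fun x => f x - c * ψ x with hp
  set q : ℝ → ℂ := fun x => g x - c * π x with hq
  set S : ℝ → ℂ := fun x => (t : ℂ) ^ 2 * f x - c * (β : ℂ) ^ 2 * ψ x with hS
  have hpc : Continuous p := by simp only [hp]; fun_prop
  have hSc : Continuous S := by simp only [hS]; fun_prop
  have hp0 : p x₀ = 0 := by
    have : (ψ x₀ : ℂ) ≠ 0 := by exact_mod_cast (hψpos x₀).ne'
    simp only [hp, hc]
    field_simp
    ring
  have hpd : ∀ x, HasDerivAt p (w x • q x) x := fun x =>
    ((hf.fst x).fun_sub ((hψ'.fst x).const_mul c)).congr_deriv (by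
      simp only [hq, Complex.real_smul]; ring)
  have hqd : ∀ x, HasDerivAt q (w x • ((W x : ℂ) * p x + S x)) x := fun x =>
    ((hf.snd x).fun_sub ((hψ'.snd x).const_mul c)).congr_deriv (by
      simp only [hp, hS, Complex.real_smul]; ring)
  have hlim : ∀ {a b : ℝ → ℂ} {l : Filter ℝ}, Tendsto a l (𝓝 0) → Tendsto b l (𝓝 0) →
      Tendsto (fun x => a x - c * b x) l (𝓝 0) := fun ha hb => by
    simpa using ha.sub (hb.const_mul c)
  have hsq : ∀ z₁ z₂ : ℂ, ‖z₁ - z₂‖ ^ 2 ≤ 2 * ‖z₁‖ ^ 2 + 2 * ‖z₂‖ ^ 2 := fun z₁ z₂ => by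
    have := norm_sub_le z₁ z₂
    nlinarith [norm_nonneg (z₁ - z₂), norm_nonneg z₁, norm_nonneg z₂, sq_nonneg (‖z₁‖ - ‖z₂‖)]
  have hlin : ∀ a b : ℂ, Integrable fun x => ‖a * f x - b * ψ x‖ ^ 2 := fun a b => by
    refine Integrable.mono' (((hfi.const_mul (2 * ‖a‖ ^ 2)).add (hψi'.const_mul (2 * ‖b‖ ^ 2))))
      (by fun_prop : Continuous fun x => ‖a * f x - b * ψ x‖ ^ 2).aestronglyMeasurable
      (Eventually.of_forall fun x => ?_)
    rw [Real.norm_of_nonneg (by positivity)]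
    refine (hsq _ _).trans (le_of_eq ?_)
    simp only [norm_mul, mul_pow, Pi.add_apply]
    ring
  have hpi : Integrable fun x => ‖p x‖ ^ 2 := by simpa [hp] using hlin 1 c
  have hSi : Integrable fun x => ‖S x‖ ^ 2 := by simpa [hS] using hlin ((t : ℂ) ^ 2) (c * (β : ℂ) ^ 2)
  have hpS : Integrable fun x => w x * inner ℝ (p x) (S x) :=
    hintR (by fun_prop) hpi hSi fun x => abs_real_inner_le_norm _ _
  have hC0 : 0 ≤ C / w₀ := div_nonneg hT.C_nonneg hT.pos.le
  have hWle : ∀ x, W x ≤ C / w₀ := fun x => (le_abs_self _).trans (hT.abs_potential_le x)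
  have hright := IsTame.setIntegral_inner_nonpos hwc hT.pos hT.le hT.ge hWle hC0 h hu0 hv0 hupos
    hSc hpd hqd hp0 (hlim hft hpt) (hlim hgt hqt) hpS.integrableOn
  -- Reflection turns the left half-line into the right one; −u(−x) is the solution that is positive
  -- beyond −x₀.
  have hleft : ∫ x in Iic x₀, w x * inner ℝ (p x) (S x) ≤ 0 := by
    have h1 := IsTame.setIntegral_inner_nonpos (x₀ := -x₀) (w := fun x => w (-x))
      (W := fun x => W (-x)) (p := fun x => p (-x)) (q := fun x => -q (-x))
      (S := fun x => S (-x)) (by fun_prop) hT.pos (fun x => hT.le _) (fun x => hT.ge _)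
      (fun x => hWle _) hC0 h.reflect.neg (by simp [hu0]) (by simpa using hv0)
      (fun x hx => by linarith [huneg (-x) (by linarith)]) (by fun_prop)
      (fun x => ((hpd (-x)).scomp x (hasDerivAt_neg x)).congr_deriv (by simp))
      (fun x => ((hqd (-x)).scomp x (hasDerivAt_neg x)).neg.congr_deriv (by simp; ring))
      (by simpa using hp0) ((hlim hft' hpt').comp tendsto_neg_atTop_atBot)
      (by simpa only [Function.comp_def, neg_zero] using
        ((hlim hgt' hqt').comp tendsto_neg_atTop_atBot).neg)
      (by
        have := hpS.comp_neg
        exact this.integrableOn)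
    have h2 := integral_comp_neg_Ioi (-x₀) (fun x => w x * inner ℝ (p x) (S x))
    rw [neg_neg] at h2
    rw [← h2]
    exact h1
  have hall : ∫ x, w x * inner ℝ (p x) (S x) ≤ 0 := by
    rw [← intervalIntegral.integral_Iic_add_Ioi hpS.integrableOn hpS.integrableOn (b := x₀)]
    linarith
  -- If t = β the source is t² p, so ∫ w ‖p‖² ≤ 0 and p = 0. Otherwise f and ψ are orthogonal, the
  -- cross terms drop out, and the integral is t² ∫ w ‖f‖² + ‖c‖² β² ∫ w ψ², so f = 0.
  by_cases heq : t = β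
  · subst heq
    refine ⟨rfl, c, ?_⟩
    have h1 : ∀ x, w x * inner ℝ (p x) (S x) = t ^ 2 * (w x * ‖p x‖ ^ 2) := by
      intro x
      have : S x = (t ^ 2 : ℝ) • p x := by
        simp only [hS, hp, Complex.real_smul]
        push_cast
        ring
      rw [this, real_inner_smul_right, real_inner_self_eq_norm_sq]
      ring
    simp only [h1] at hall
    rw [integral_const_mul] at hall
    have h2 : ∫ x, w x * ‖p x‖ ^ 2 ≤ 0 := nonpos_of_mul_nonpos_right hall (by positivity)
    have h3 := Continuous.eq_zero_of_integral_norm_sq_nonpos hwc hT.w_pos hpc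
      (hintR (by fun_prop) hpi hpi fun x => by rw [abs_of_nonneg (by positivity), sq]) h2
    intro x
    have h4 := congrFun h3 x
    simp only [hp, Pi.zero_apply] at h4
    linear_combination h4
  · exfalso
    have hne : (β : ℂ) ^ 2 - (t : ℂ) ^ 2 ≠ 0 := by
      intro h0
      have h1 : β ^ 2 - t ^ 2 = 0 := by exact_mod_cast h0
      have h2 : (β - t) * (β + t) = 0 := by linarith
      rcases mul_eq_zero.1 h2 with h3 | h3
      · exact heq (by linarith)
      · linarith
    have hfψ : Integrable fun x => (w x : ℂ) * (f x * ψ x) :=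
      hint (by fun_prop) hfi hψi' fun x => by rw [norm_mul]
    have horth := hf.integral_mul_eq_zero hψ' hne (fun x => by ring) hfψ
      hft hft' hgt hgt' hpt hpt' hqt hqt'
    have h1 : ∀ x, w x * inner ℝ (p x) (S x) = t ^ 2 * (w x * ‖f x‖ ^ 2)
        + ‖c‖ ^ 2 * β ^ 2 * (w x * ψ x ^ 2)
        - (t ^ 2 + β ^ 2) * (star c * ((w x : ℂ) * (f x * ψ x))).re := by
      intro x
      have h2 : S x = (t ^ 2 : ℝ) • f x - (β ^ 2 * ψ x : ℝ) • c := by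
        simp only [hS, Complex.real_smul]
        push_cast
        ring
      have h3 : p x = f x - (ψ x : ℝ) • c := by
        simp only [hp, Complex.real_smul]
        ring
      have h4 : (star c * ((w x : ℂ) * (f x * ψ x))).re = w x * ψ x * inner ℝ (f x) c := by
        rw [Complex.inner]
        simp
        ring
      rw [h4, h2, h3]
      simp only [inner_sub_left, inner_sub_right, real_inner_smul_left, real_inner_smul_right,
        real_inner_self_eq_norm_sq]
      rw [real_inner_comm (f x) c]
      ring
    have h5 : ∫ x, (star c * ((w x : ℂ) * (f x * ψ x))).re = 0 := by
      have h6 := (hfψ.const_mul (star c))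
      have h7 := integral_re h6
      simp only [RCLike.re_to_complex] at h7
      rw [h7, integral_const_mul, horth]
      simp
    have hwψ : Integrable fun x => w x * ψ x ^ 2 :=
      hintR (by have := hψ.continuous_fst_real; fun_prop) hψi' hψi' fun x => by
        rw [Complex.norm_real, Real.norm_eq_abs, abs_mul_abs_self, abs_of_nonneg (sq_nonneg _), sq]
    have h8 : Integrable fun x => (star c * ((w x : ℂ) * (f x * ψ x))).re := (hfψ.const_mul _).re
    simp only [h1] at hall
    have h11 : Integrable fun x => t ^ 2 * (w x * ‖f x‖ ^ 2)
        + ‖c‖ ^ 2 * β ^ 2 * (w x * ψ x ^ 2) := (hwf.const_mul _).add (hwψ.const_mul _)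
    rw [integral_sub h11 (h8.const_mul _),
      integral_add (hwf.const_mul _) (hwψ.const_mul _), integral_const_mul, integral_const_mul,
      integral_const_mul, h5] at hall
    have h9 : 0 ≤ ‖c‖ ^ 2 * β ^ 2 * ∫ x, w x * ψ x ^ 2 :=
      mul_nonneg (by positivity) (integral_nonneg fun x => mul_nonneg (hT.w_pos x).le (sq_nonneg _))
    have h10 : ∫ x, w x * ‖f x‖ ^ 2 ≤ 0 :=
      nonpos_of_mul_nonpos_right (by linarith : t ^ 2 * ∫ x, w x * ‖f x‖ ^ 2 ≤ 0) (by positivity)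
    exact hf0 (Continuous.eq_zero_of_integral_norm_sq_nonpos hwc hT.w_pos hfc hwf h10)

/-! ### Distributional solutions are classical -/

lemma HasCompactSupport.exists_Icc {φ : ℝ → ℝ} (hφ : HasCompactSupport φ) :
    ∃ N : ℝ, 0 < N ∧ ∀ x, x ∉ Icc (-N) N → φ x = 0 := by
  obtain ⟨N, hN, h⟩ := hφ.isCompact.isBounded.subset_ball_lt 0 0
  refine ⟨N, hN, fun x hx => ?_⟩
  by_contra hne
  have := h (subset_tsupport φ hne)
  rw [mem_ball_zero_iff, Real.norm_eq_abs, abs_lt] at this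
  exact hx ⟨this.1.le, this.2.le⟩

lemma integral_eq_intervalIntegral_of_Icc {φ : ℝ → ℝ} {N : ℝ} (hN : 0 < N)
    (h : ∀ x, x ∉ Icc (-N) N → φ x = 0) : ∫ x, φ x = ∫ x in (-N)..N, φ x := by
  rw [intervalIntegral.integral_of_le (by linarith), ← integral_Icc_eq_integral_Ioc]
  exact (setIntegral_eq_integral_of_forall_compl_eq_zero h).symm

/-- A test function with vanishing integral is the derivative of a test function. -/
lemma exists_primitive {η : ℝ → ℝ} (hη : ContDiff ℝ ∞ η) (hη' : HasCompactSupport η)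
    (h0 : ∫ x, η x = 0) :
    ∃ φ : ℝ → ℝ, ContDiff ℝ ∞ φ ∧ HasCompactSupport φ ∧ deriv φ = η := by
  obtain ⟨N, hN, hsupp⟩ := HasCompactSupport.exists_Icc hη'
  have hc := hη.continuous
  set φ : ℝ → ℝ := fun x => ∫ t in (-N)..x, η t with hφ
  have hd : ∀ x, HasDerivAt φ (η x) x := fun x =>
    intervalIntegral.integral_hasDerivAt_right (hc.intervalIntegrable _ _)
      (hc.stronglyMeasurableAtFilter _ _) hc.continuousAt
  have hderiv : deriv φ = η := funext fun x => (hd x).deriv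
  refine ⟨φ, ?_, ?_, hderiv⟩
  · rw [contDiff_infty_iff_deriv, hderiv]
    exact ⟨fun x => (hd x).differentiableAt, hη⟩
  · refine HasCompactSupport.intro (isCompact_Icc (a := -N) (b := N)) fun x hx => ?_
    simp only [hφ]
    rcases lt_or_ge x (-N) with h | h
    · rw [intervalIntegral.integral_zero_ae]
      have hne : ∀ᵐ t : ℝ, t ≠ -N := by simp [ae_iff, measure_singleton]
      filter_upwards [hne] with t ht0 ht
      rw [uIoc_of_ge h.le] at ht
      exact hsupp t fun h' => ht0 (le_antisymm ht.2 h'.1)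
    · have hxN : N < x := by
        by_contra hcon
        exact hx ⟨h, not_lt.1 hcon⟩
      rw [← intervalIntegral.integral_add_adjacent_intervals (b := N)
        (hc.intervalIntegrable _ _) (hc.intervalIntegrable _ _),
        ← integral_eq_intervalIntegral_of_Icc hN hsupp, h0, zero_add,
        intervalIntegral.integral_zero_ae]
      refine Eventually.of_forall fun t ht => ?_
      rw [uIoc_of_le hxN.le] at ht
      exact hsupp t fun h' => not_lt.2 h'.2 ht.1

lemma exists_test_integral_eq_one :
    ∃ η : ℝ → ℝ, ContDiff ℝ ∞ η ∧ HasCompactSupport η ∧ ∫ x, η x = 1 := by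
  let f : ContDiffBump (0 : ℝ) := ⟨1, 2, one_pos, one_lt_two⟩
  exact ⟨f.normed volume, f.contDiff_normed, f.hasCompactSupport_normed, f.integral_normed⟩

lemma LocallyIntegrable.integrable_mul_test {f φ : ℝ → ℝ} (hf : LocallyIntegrable f)
    (hφ : Continuous φ) (hφ' : HasCompactSupport φ) : Integrable fun x => f x * φ x := by
  have := hf.integrable_smul_left_of_hasCompactSupport hφ hφ'
  refine this.congr (Eventually.of_forall fun x => ?_)
  simp [mul_comm]

/-- The du Bois-Reymond lemma. -/
lemma ae_eq_const_of_integral_mul_deriv {f : ℝ → ℝ} (hf : LocallyIntegrable f)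
    (h : ∀ φ : ℝ → ℝ, ContDiff ℝ ∞ φ → HasCompactSupport φ → ∫ x, f x * deriv φ x = 0) :
    ∃ c : ℝ, ∀ᵐ x, f x = c := by
  obtain ⟨η₀, h1, h2, h3⟩ := exists_test_integral_eq_one
  -- Since η₀ has integral 1, this is the only possible constant. A test function η minus (∫ η) η₀
  -- has mean zero, hence is the derivative of a test function.
  set c := ∫ x, f x * η₀ x with hc
  refine ⟨c, ?_⟩
  have key := ae_eq_zero_of_integral_contDiff_smul_eq_zero (f := fun x => f x - c) (μ := volume)
    (hf.sub (locallyIntegrable_const c)) fun η hη hη' => ?_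
  · filter_upwards [key] with x hx
    linarith
  · set m := ∫ x, η x with hm
    have hηi : Integrable η := hη.continuous.integrable_of_hasCompactSupport hη'
    have hη₀i : Integrable η₀ := h1.continuous.integrable_of_hasCompactSupport h2
    obtain ⟨φ, hφ, hφ', hd⟩ := exists_primitive (η := fun x => η x - m * η₀ x)
      (hη.sub (contDiff_const.mul h1)) (hη'.sub (h2.mul_left (f := fun _ => m))) (by
        rw [integral_sub hηi (hη₀i.const_mul m), integral_const_mul, h3, mul_one, sub_self])
    have h4 := h φ hφ hφ'
    rw [hd] at h4
    have hi1 := LocallyIntegrable.integrable_mul_test hf hη.continuous hη'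
    have hi2 := LocallyIntegrable.integrable_mul_test hf h1.continuous h2
    have h5 : ∫ x, f x * η x - m * (f x * η₀ x) = 0 := by
      rw [← h4]; congr 1; funext x; ring
    rw [integral_sub hi1 (hi2.const_mul m), integral_const_mul, ← hc] at h5
    have h6 : ∫ x, η x • (f x - c) = ∫ x, f x * η x - c * η x := by
      congr 1; funext x; rw [smul_eq_mul]; ring
    rw [h6, integral_sub hi1 (hηi.const_mul c), integral_const_mul, ← hm]
    linarith

/-- Integration by parts against a test function, for a primitive of a locally integrable function. -/
lemma integral_primitive_mul_deriv {h : ℝ → ℝ} (hh : LocallyIntegrable h) {φ : ℝ → ℝ}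
    (hφ : ContDiff ℝ ∞ φ) (hφ' : HasCompactSupport φ) :
    ∫ x, (∫ t in (0 : ℝ)..x, h t) * deriv φ x = -∫ x, h x * φ x := by
  obtain ⟨N, hN, hsupp⟩ := HasCompactSupport.exists_Icc hφ'
  set H : ℝ → ℝ := fun x => ∫ t in (0 : ℝ)..x, h t with hH
  have hhi : ∀ a b, IntervalIntegrable h volume a b := fun a b =>
    (hh.integrableOn_isCompact isCompact_uIcc).intervalIntegrable
  obtain ⟨N', hN', hsupp'⟩ := HasCompactSupport.exists_Icc hφ'.deriv
  -- The extra 1 makes φ vanish at the endpoints ±K, so integration by parts has no boundary terms.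
  set K := max N N' + 1 with hK
  have hK0 : 0 < K := by have := le_max_left N N'; linarith
  have hs1 : ∀ x, x ∉ Ioo (-K) K → φ x = 0 := fun x hx => hsupp x fun h' => hx
    ⟨by have := le_max_left N N'; linarith [h'.1], by have := le_max_left N N'; linarith [h'.2]⟩
  have hs2 : ∀ x, x ∉ Ioo (-K) K → deriv φ x = 0 := fun x hx => hsupp' x fun h' => hx
    ⟨by have := le_max_right N N'; linarith [h'.1], by have := le_max_right N N'; linarith [h'.2]⟩
  have hIoo : ∀ x, x ∉ Icc (-K) K → x ∉ Ioo (-K) K := fun x hx h' => hx (Ioo_subset_Icc_self h')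
  have hHac : AbsolutelyContinuousOnInterval H (-K) K :=
    (hhi (-K) K).absolutelyContinuousOnInterval_intervalIntegral
      (by rw [uIcc_of_le (by linarith)]; exact ⟨by linarith, by linarith⟩)
  have hφac : AbsolutelyContinuousOnInterval φ (-K) K :=
    ((hφ.of_le (by simp)).contDiffOn).absolutelyContinuousOnInterval
  have hibp := hHac.integral_mul_deriv_eq_deriv_mul hφac
  rw [hs1 K (by simp), hs1 (-K) (by simp), mul_zero, mul_zero, sub_zero, zero_sub] at hibp
  rw [integral_eq_intervalIntegral_of_Icc hK0 (φ := fun x => H x * deriv φ x)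
    (fun x hx => by rw [hs2 x (hIoo x hx), mul_zero]),
    integral_eq_intervalIntegral_of_Icc hK0 (φ := fun x => h x * φ x)
    (fun x hx => by rw [hs1 x (hIoo x hx), mul_zero]), hibp]
  congr 1
  refine intervalIntegral.integral_congr_ae ?_
  filter_upwards [_root_.LocallyIntegrable.ae_hasDerivAt_integral hh] with x hx _
  rw [(hx 0).deriv]

lemma continuous_primitive {h : ℝ → ℝ} (hh : LocallyIntegrable h) :
    Continuous fun x => ∫ t in (0 : ℝ)..x, h t :=
  intervalIntegral.continuous_primitive (fun _ _ =>
    (hh.integrableOn_isCompact isCompact_uIcc).intervalIntegrable) 0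

/-- Regularity of weak solutions of `f' = h`. -/
lemma ae_eq_primitive_of_weak {f h : ℝ → ℝ} (hf : LocallyIntegrable f) (hh : LocallyIntegrable h)
    (heq : ∀ φ : ℝ → ℝ, ContDiff ℝ ∞ φ → HasCompactSupport φ →
      ∫ x, f x * deriv φ x = -∫ x, h x * φ x) :
    ∃ c : ℝ, ∀ᵐ x, f x = c + ∫ t in (0 : ℝ)..x, h t := by
  have hHl := (continuous_primitive hh).locallyIntegrable (μ := (volume : Measure ℝ))
  obtain ⟨c, hc⟩ := ae_eq_const_of_integral_mul_deriv (f := fun x => f x - ∫ t in (0 : ℝ)..x, h t)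
    (hf.sub hHl) fun φ hφ hφ' => by
      have hd : Continuous (deriv φ) := hφ.continuous_deriv (by simp)
      have e : ∀ x, (f x - ∫ t in (0 : ℝ)..x, h t) * deriv φ x
        = f x * deriv φ x - (∫ t in (0 : ℝ)..x, h t) * deriv φ x := fun x => by ring
      simp only [e]
      rw [integral_sub (LocallyIntegrable.integrable_mul_test hf hd hφ'.deriv)
        (LocallyIntegrable.integrable_mul_test hHl hd hφ'.deriv), heq φ hφ hφ',
        integral_primitive_mul_deriv hh hφ hφ', sub_self]
  refine ⟨c, ?_⟩
  filter_upwards [hc] with x hx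
  linarith

/-- Regularity of weak solutions of `(w⁻¹ f')' = h`. -/
lemma ae_eq_of_weak_second_order {w f h : ℝ → ℝ} (hw : ContDiff ℝ ∞ w) (hw0 : ∀ x, 0 < w x)
    (hf : LocallyIntegrable f) (hh : LocallyIntegrable h)
    (heq : ∀ φ : ℝ → ℝ, ContDiff ℝ ∞ φ → HasCompactSupport φ →
      ∫ x, f x * deriv (fun z => (w z)⁻¹ * deriv φ z) x = ∫ x, h x * φ x) :
    ∃ c B : ℝ, ∀ᵐ x, f x = c + ∫ t in (0 : ℝ)..x, w t * ((∫ r in (0 : ℝ)..t, h r) - B) := by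
  set H : ℝ → ℝ := fun x => ∫ t in (0 : ℝ)..x, h t with hH
  have hHc : Continuous H := continuous_primitive hh
  have hwinv : ContDiff ℝ ∞ fun x => (w x)⁻¹ := hw.inv fun x => (hw0 x).ne'
  have hwH : LocallyIntegrable fun x => w x * H x :=
    (hw.continuous.mul hHc).locallyIntegrable (μ := (volume : Measure ℝ))
  obtain ⟨η, h1, h2, h3⟩ := exists_test_integral_eq_one
  -- The hypothesis only tests against ∂φ = w⁻¹ φ'. A general ζ has this form once w ζ has mean
  -- zero, and subtracting a multiple of ζ₁ = w⁻¹ η achieves that; B records the contribution of ζ₁.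
  set ζ₁ : ℝ → ℝ := fun x => (w x)⁻¹ * η x with hζ₁
  have hζ₁c : ContDiff ℝ ∞ ζ₁ := hwinv.mul h1
  have hζ₁s : HasCompactSupport ζ₁ := h2.mul_left (f := fun x => (w x)⁻¹)
  have hζ₁d : Continuous (deriv ζ₁) := hζ₁c.continuous_deriv (by simp)
  set B := (∫ x, f x * deriv ζ₁ x) + ∫ x, w x * H x * ζ₁ x with hB
  have hloc : LocallyIntegrable fun x => w x * (H x - B) :=
    (hw.continuous.mul (hHc.sub continuous_const)).locallyIntegrable (μ := (volume : Measure ℝ))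
  obtain ⟨c, hc⟩ := ae_eq_primitive_of_weak hf hloc fun ζ hζ hζs => by
    set m := ∫ x, w x * ζ x with hm
    have hζd : Continuous (deriv ζ) := hζ.continuous_deriv (by simp)
    have hwζ : Integrable fun x => w x * ζ x :=
      (hw.continuous.mul hζ.continuous).integrable_of_hasCompactSupport (hζs.mul_left (f := w))
    have hη : ∀ x, w x * ζ₁ x = η x := fun x => by
      simp only [hζ₁]; rw [mul_inv_cancel_left₀ (hw0 x).ne']
    obtain ⟨φ, hφ, hφ', hd⟩ := exists_primitive (η := fun x => w x * ζ x - m * η x)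
      ((hw.mul hζ).sub (contDiff_const.mul h1))
      ((hζs.mul_left (f := w)).sub (h2.mul_left (f := fun _ => m))) (by
        rw [integral_sub hwζ ((h1.continuous.integrable_of_hasCompactSupport h2).const_mul m),
          integral_const_mul, h3, mul_one, sub_self])
    have h4 := heq φ hφ hφ'
    have h5 : (fun z => (w z)⁻¹ * deriv φ z) = fun z => ζ z - m * ζ₁ z := by
      funext z
      have := (hw0 z).ne'
      rw [hd]
      simp only [hζ₁]
      field_simp
    have h6 : ∀ x, deriv (fun z => ζ z - m * ζ₁ z) x = deriv ζ x - m * deriv ζ₁ x := fun x => by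
      have e1 := (hζ.differentiable (by simp) x).hasDerivAt
      have e2 := (hζ₁c.differentiable (by simp) x).hasDerivAt
      exact (e1.fun_sub (e2.const_mul m)).deriv
    rw [h5] at h4
    simp only [h6] at h4
    have hi1 := LocallyIntegrable.integrable_mul_test hf hζd hζs.deriv
    have hi2 := LocallyIntegrable.integrable_mul_test hf hζ₁d hζ₁s.deriv
    have e3 : ∀ x, f x * (deriv ζ x - m * deriv ζ₁ x)
      = f x * deriv ζ x - m * (f x * deriv ζ₁ x) := fun x => by ring
    simp only [e3] at h4
    rw [integral_sub hi1 (hi2.const_mul m), integral_const_mul] at h4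
    have h7 : ∫ x, H x * deriv φ x = -∫ x, h x * φ x := integral_primitive_mul_deriv hh hφ hφ'
    rw [hd] at h7
    have hi3 := LocallyIntegrable.integrable_mul_test hwH hζ.continuous hζs
    have hi4 := LocallyIntegrable.integrable_mul_test hwH hζ₁c.continuous hζ₁s
    have e4 : ∀ x, H x * (w x * ζ x - m * η x) = w x * H x * ζ x - m * (w x * H x * ζ₁ x) :=
      fun x => by rw [← hη x]; ring
    simp only [e4] at h7
    rw [integral_sub hi3 (hi4.const_mul m), integral_const_mul] at h7
    have e5 : ∀ x, w x * (H x - B) * ζ x = w x * H x * ζ x - B * (w x * ζ x) := fun x => by ring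
    simp only [e5]
    rw [integral_sub hi3 (hwζ.const_mul B), integral_const_mul, ← hm, hB]
    linear_combination h4 + h7
  exact ⟨c, B, hc⟩

/-- Regularity of weak solutions of `w⁻¹ (w⁻¹ f')' = V f`. -/
theorem exists_isSol_of_weak {w : ℝ → ℝ} {V f : ℝ → ℂ} (hw : ContDiff ℝ ∞ w) (hw0 : ∀ x, 0 < w x)
    (hV : Continuous V) (hf : LocallyIntegrable f)
    (heq : ∀ φ : ℝ → ℝ, ContDiff ℝ ∞ φ → HasCompactSupport φ →
      ∫ x, (deriv (fun z => (w z)⁻¹ * deriv φ z) x : ℝ) • f x = ∫ x, φ x • (w x • (V x * f x))) :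
    ∃ u v : ℝ → ℂ, IsSol w V u v ∧ f =ᵐ[volume] u := by
  set h : ℝ → ℂ := fun x => w x • (V x * f x) with hh
  have hwinv : ContDiff ℝ ∞ fun x => (w x)⁻¹ := hw.inv fun x => (hw0 x).ne'
  have hwc := hw.continuous
  have hhl : LocallyIntegrable h := by
    rw [locallyIntegrable_iff]
    intro K hK
    have h1 : ContinuousOn (fun x => (w x : ℂ) * V x) K := by fun_prop
    refine ((hf.integrableOn_isCompact hK).continuousOn_mul h1 hK).congr
      (Eventually.of_forall fun x => ?_)
    simp only [hh, Complex.real_smul]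
    ring
  have hre : ∀ {F : ℝ → ℂ}, LocallyIntegrable F → LocallyIntegrable fun x => (F x).re := fun hF =>
    locallyIntegrable_iff.2 fun K hK => (hF.integrableOn_isCompact hK).re
  have him : ∀ {F : ℝ → ℂ}, LocallyIntegrable F → LocallyIntegrable fun x => (F x).im := fun hF =>
    locallyIntegrable_iff.2 fun K hK => (hF.integrableOn_isCompact hK).im
  have hreI : ∀ {F : ℝ → ℂ} {φ : ℝ → ℝ}, Integrable (fun x => φ x • F x) →
      ∫ x, (F x).re * φ x = (∫ x, φ x • F x).re := fun hF => by
    have := integral_re hF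
    simp only [RCLike.re_to_complex] at this
    rw [← this]
    congr 1
    funext x
    simp [mul_comm]
  have himI : ∀ {F : ℝ → ℂ} {φ : ℝ → ℝ}, Integrable (fun x => φ x • F x) →
      ∫ x, (F x).im * φ x = (∫ x, φ x • F x).im := fun hF => by
    have := integral_im hF
    simp only [RCLike.im_to_complex] at this
    rw [← this]
    congr 1
    funext x
    simp [mul_comm]
  have hψ : ∀ φ : ℝ → ℝ, ContDiff ℝ ∞ φ → HasCompactSupport φ →
      Continuous (deriv (fun z => (w z)⁻¹ * deriv φ z)) ∧
        HasCompactSupport (deriv (fun z => (w z)⁻¹ * deriv φ z)) := fun φ hφ hφs => by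
    have h1 : ContDiff ℝ ∞ (deriv φ) := (contDiff_infty_iff_deriv.1 hφ).2
    exact ⟨(hwinv.mul h1).continuous_deriv (by simp),
      (hφs.deriv.mul_left (f := fun z => (w z)⁻¹)).deriv⟩
  obtain ⟨c₁, B₁, h1⟩ := ae_eq_of_weak_second_order hw hw0 (hre hf) (hre hhl) fun φ hφ hφs => by
    obtain ⟨k1, k2⟩ := hψ φ hφ hφs
    rw [hreI (hf.integrable_smul_left_of_hasCompactSupport k1 k2),
      hreI (hhl.integrable_smul_left_of_hasCompactSupport hφ.continuous hφs), heq φ hφ hφs]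
  obtain ⟨c₂, B₂, h2⟩ := ae_eq_of_weak_second_order hw hw0 (him hf) (him hhl) fun φ hφ hφs => by
    obtain ⟨k1, k2⟩ := hψ φ hφ hφs
    rw [himI (hf.integrable_smul_left_of_hasCompactSupport k1 k2),
      himI (hhl.integrable_smul_left_of_hasCompactSupport hφ.continuous hφs), heq φ hφ hφs]
  set H₁ : ℝ → ℝ := fun x => ∫ r in (0 : ℝ)..x, (h r).re with hH₁
  set H₂ : ℝ → ℝ := fun x => ∫ r in (0 : ℝ)..x, (h r).im with hH₂
  have hH₁c : Continuous H₁ := continuous_primitive (hre hhl)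
  have hH₂c : Continuous H₂ := continuous_primitive (him hhl)
  set u : ℝ → ℂ := fun x => ((c₁ + ∫ t in (0 : ℝ)..x, w t * (H₁ t - B₁) : ℝ) : ℂ)
    + ((c₂ + ∫ t in (0 : ℝ)..x, w t * (H₂ t - B₂) : ℝ) : ℂ) * Complex.I with hu
  have hae : f =ᵐ[volume] u := by
    filter_upwards [h1, h2] with x hx1 hx2
    refine Complex.ext ?_ ?_
    · simp only [hu, hx1]
      simp
      rfl
    · simp only [hu, hx2]
      simp
      rfl
  have hFTC : ∀ {F : ℝ → ℝ}, Continuous F → ∀ x, HasDerivAt (fun x => ∫ t in (0 : ℝ)..x, F t) (F x) x :=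
    fun hF x => intervalIntegral.integral_hasDerivAt_right (hF.intervalIntegrable _ _)
      (hF.stronglyMeasurableAtFilter _ _) hF.continuousAt
  have hud : ∀ x, HasDerivAt u (w x • (((H₁ x - B₁ : ℝ) : ℂ) + ((H₂ x - B₂ : ℝ) : ℂ) * Complex.I)) x := by
    intro x
    have e1 := ((hFTC (F := fun t => w t * (H₁ t - B₁)) (by fun_prop) x).const_add c₁).ofReal_comp
    have e2 := ((hFTC (F := fun t => w t * (H₂ t - B₂)) (by fun_prop) x).const_add c₂).ofReal_comp
    refine (e1.fun_add (e2.mul_const Complex.I)).congr_deriv ?_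
    simp only [Complex.real_smul]
    push_cast
    ring
  have huc : Continuous u := continuous_iff_continuousAt.2 fun x => (hud x).continuousAt
  have hhu : h =ᵐ[volume] fun x => w x • (V x * u x) := by
    filter_upwards [hae] with x hx
    simp only [hh, hx]
  have hwu : Continuous fun x => w x • (V x * u x) := by fun_prop
  -- The primitive depends only on the almost everywhere class, so f may be replaced by its
  -- continuous representative u; the integrand becomes continuous and the fundamental theorem holds
  -- at every point.
  have hH₁' : H₁ = fun x => ∫ r in (0 : ℝ)..x, (w r • (V r * u r)).re := by
    funext x
    refine intervalIntegral.integral_congr_ae ?_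
    filter_upwards [hhu] with t ht _
    rw [ht]
  have hH₂' : H₂ = fun x => ∫ r in (0 : ℝ)..x, (w r • (V r * u r)).im := by
    funext x
    refine intervalIntegral.integral_congr_ae ?_
    filter_upwards [hhu] with t ht _
    rw [ht]
  refine ⟨u, fun x => ((H₁ x - B₁ : ℝ) : ℂ) + ((H₂ x - B₂ : ℝ) : ℂ) * Complex.I,
    ⟨hud, fun x => ?_⟩, hae⟩
  have e1 := hFTC (Complex.continuous_re.comp hwu) x
  have e2 := hFTC (Complex.continuous_im.comp hwu) x
  simp only [Function.comp_def, ← hH₁'] at e1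
  simp only [Function.comp_def, ← hH₂'] at e2
  refine ((e1.sub_const B₁).ofReal_comp.fun_add
    ((e2.sub_const B₂).ofReal_comp.mul_const Complex.I)).congr_deriv ?_
  exact Complex.re_add_im _

/-- Solutions of an equation with smooth coefficients are smooth. -/
lemma IsSol.contDiff {w V u v : ℝ → ℝ} (h : IsSol w V u v) (hw : ContDiff ℝ ∞ w)
    (hV : ContDiff ℝ ∞ V) : ContDiff ℝ ∞ u ∧ ContDiff ℝ ∞ v := by
  have key : ∀ n : ℕ, ContDiff ℝ n u ∧ ContDiff ℝ n v := by
    intro n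
    induction n with
    | zero => exact ⟨contDiff_zero.2 h.continuous_fst_real, contDiff_zero.2 h.continuous_snd_real⟩
    | succ n ih =>
      have hw' : ContDiff ℝ n w := hw.of_le (by exact_mod_cast le_top)
      have hV' : ContDiff ℝ n V := hV.of_le (by exact_mod_cast le_top)
      have e1 : deriv u = fun x => w x * v x := funext fun x => (h.fst x).deriv
      have e2 : deriv v = fun x => w x * (V x * u x) := funext fun x => (h.snd x).deriv
      refine ⟨?_, ?_⟩
      · push_cast
        rw [contDiff_succ_iff_deriv, e1]
        exact ⟨fun x => (h.fst x).differentiableAt, by simp, hw'.mul ih.2⟩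
      · push_cast
        rw [contDiff_succ_iff_deriv, e2]
        exact ⟨fun x => (h.snd x).differentiableAt, by simp, hw'.mul (hV'.mul ih.1)⟩
  exact ⟨contDiff_infty.2 fun n => (key n).1, contDiff_infty.2 fun n => (key n).2⟩

section

/-! ### Elementary inequalities -/

/-- Monotonicity of tanh without denominators: the difference of the two sides is sinh (v − |u|). -/
lemma abs_sinh_mul_cosh_le {u v : ℝ} (h : |u| ≤ v) :
    |Real.sinh u| * Real.cosh v ≤ Real.sinh v * Real.cosh u := by
  have h1 : 0 ≤ Real.sinh (v - |u|) := Real.sinh_nonneg_iff.2 (sub_nonneg.2 h)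
  rw [Real.sinh_sub, Real.cosh_abs, ← Real.abs_sinh] at h1
  linarith [mul_comm (Real.cosh v) |Real.sinh u|]

/-- In double-angle form this reads 2u (cosh 2u − sinh 2u) ≤ sinh 2u, where the bracket is e^{-2u};
so it reduces to 4u + 1 ≤ e^{4u}. -/
lemma mul_cosh_sq_add_sinh_sq_le (u : ℝ) :
    u * (Real.cosh u ^ 2 + Real.sinh u ^ 2) ≤ Real.cosh u * Real.sinh u * (1 + 2 * u) := by
  have h1 : 2 * u * Real.exp (-(2 * u)) ≤ Real.sinh (2 * u) := by
    have h2 : Real.sinh (2 * u) = (Real.exp (2 * u) - Real.exp (-(2 * u))) / 2 := Real.sinh_eq _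
    have h3 : Real.exp (2 * u) = Real.exp (4 * u) * Real.exp (-(2 * u)) := by
      rw [← Real.exp_add]; ring_nf
    have h4 := Real.add_one_le_exp (4 * u)
    have h5 := Real.exp_pos (-(2 * u))
    rw [h2, h3]
    nlinarith
  have h6 : Real.exp (-(2 * u)) = Real.cosh (2 * u) - Real.sinh (2 * u) := by
    rw [Real.cosh_sub_sinh]
  rw [h6, Real.sinh_two_mul, Real.cosh_two_mul] at h1
  nlinarith

/-- The inequality is affine in g, so only the two extreme values |g| sinh u = l cosh u matter. At
one of them it is cosh² ≥ sinh², at the other it is `mul_cosh_sq_add_sinh_sq_le`; together these are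
|c a| ≤ P. -/
lemma mul_sinh_sub_le_of_pos {l g u : ℝ} (hl : 0 < l) (hu : 0 < u)
    (hg : |g| * Real.sinh u ≤ l * Real.cosh u) :
    u * (l * Real.sinh u - g * Real.cosh u)
      ≤ (1 / 2 + u) * (l * Real.cosh u - g * Real.sinh u) := by
  have hk := mul_cosh_sq_add_sinh_sq_le u
  set s := Real.sinh u with hs
  set c := Real.cosh u with hc
  have hs0 : 0 < s := Real.sinh_pos_iff.2 hu
  have hc0 : 0 < c := Real.cosh_pos u
  have hcs : c ^ 2 = s ^ 2 + 1 := Real.cosh_sq u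
  set a := (1 / 2 + u) * s - u * c with ha
  set P := s * ((1 / 2 + u) * c - u * s) with hP
  have h1 : |c * a| ≤ P := by
    rw [abs_le]
    constructor <;> simp only [ha, hP] <;> nlinarith
  have h2 : g * s * a ≤ l * P := by
    have h3 : g * s * a ≤ |g| * s * |a| := by
      rw [← abs_of_pos hs0, ← abs_mul, ← abs_mul, abs_of_pos hs0]
      exact le_abs_self _
    have h4 : |g| * s * |a| ≤ l * c * |a| := mul_le_mul_of_nonneg_right hg (abs_nonneg a)
    have h5 : l * c * |a| = l * |c * a| := by rw [abs_mul, abs_of_pos hc0]; ring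
    have h6 := mul_le_mul_of_nonneg_left h1 hl.le
    linarith
  have h7 : 0 ≤ s * ((1 / 2 + u) * (l * c - g * s) - u * (l * s - g * c)) := by
    have : s * ((1 / 2 + u) * (l * c - g * s) - u * (l * s - g * c)) = l * P - g * s * a := by
      simp only [ha, hP]; ring
    rw [this]; linarith
  linarith [nonneg_of_mul_nonneg_right h7 hs0]

lemma mul_sinh_sub_le {l g u : ℝ} (hl : 0 < l) (hg : |g| * |Real.sinh u| ≤ l * Real.cosh u) :
    u * (l * Real.sinh u - g * Real.cosh u)
      ≤ (1 / 2 + |u|) * (l * Real.cosh u - g * Real.sinh u) := by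
  rcases lt_trichotomy u 0 with hu | hu | hu
  · have h := mul_sinh_sub_le_of_pos (g := -g) (u := -u) hl (by linarith) (by
      rw [abs_neg, Real.cosh_neg, Real.sinh_neg]
      have : |Real.sinh u| = -Real.sinh u := abs_of_neg (Real.sinh_neg_iff.2 hu)
      rwa [this] at hg)
    rw [Real.sinh_neg, Real.cosh_neg] at h
    rw [abs_of_neg hu]
    linarith
  · subst hu
    simp
    linarith
  · rw [abs_of_pos hu]
    rw [abs_of_pos (Real.sinh_pos_iff.2 hu)] at hg
    exact mul_sinh_sub_le_of_pos hl hu hg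

lemma arctan_sq_le (z : ℝ) : Real.arctan z ^ 2 ≤ z * Real.arctan z := by
  have key : ∀ z : ℝ, 0 ≤ z → Real.arctan z ≤ z := fun z hz => by
    have := Real.le_tan (Real.arctan_nonneg.2 hz) (Real.arctan_lt_pi_div_two z)
    rwa [Real.tan_arctan] at this
  rcases le_total 0 z with hz | hz
  · nlinarith [key z hz, Real.arctan_nonneg.2 hz]
  · have h1 := key (-z) (by linarith)
    have h2 := Real.arctan_le_zero.2 hz
    rw [Real.arctan_neg] at h1
    nlinarith

/-- For |z| ≥ 1 the factor 2 suffices because arctan 1 = π/4 > 1/2. -/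
lemma abs_le_two_mul_one_add_mul_arctan (z : ℝ) : |z| ≤ 2 * (1 + z * Real.arctan z) := by
  have key : ∀ z : ℝ, 0 ≤ z → z ≤ 2 * (1 + z * Real.arctan z) := fun z hz => by
    rcases le_total z 1 with h | h
    · nlinarith [mul_nonneg hz (Real.arctan_nonneg.2 hz)]
    · have h1 : Real.pi / 4 ≤ Real.arctan z := by
        rw [← Real.arctan_one]; exact Real.arctan_le_arctan_iff.2 h
      nlinarith [Real.pi_gt_three]
  rcases le_total 0 z with hz | hz
  · rw [abs_of_nonneg hz]; exact key z hz
  · rw [abs_of_nonpos hz]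
    have := key (-z) (by linarith)
    rw [Real.arctan_neg] at this
    linarith

/-! ### The static background and its closed differential system -/

namespace Params

variable (p : Params)

/-- `e^{γ₀ - d}`. -/
def den (x : ℝ) : ℝ := Real.cosh (p.Λ * p.y x) - p.γ₁ * (Real.sinh (p.Λ * p.y x) / p.Λ)

/-- `(1 + Λ²) F`. -/
def N (x : ℝ) : ℝ := 1 + p.Λ ^ 2 + p.Λ ^ 2 * (x / p.b * p.y x) + p.y x * p.dy x

/-- The quotient `G / H`. -/
def R (x : ℝ) : ℝ := p.G x / p.H x

/-- The function `Λ² y / ((1 + Λ²) F)`, which satisfies `(1 + Λ²) G/H - Λ² = c_y T`. -/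
def T (x : ℝ) : ℝ := p.Λ ^ 2 * p.y x / p.N x

/-- The weight `e^{-2d}`. -/
def w (x : ℝ) : ℝ := Real.exp (-2 * p.d x)

lemma w_pos (x : ℝ) : 0 < p.w x := Real.exp_pos _

lemma y_sq_le (x : ℝ) : p.y x ^ 2 ≤ x / p.b * p.y x := arctan_sq_le _

lemma one_le_one_add_mul_y (x : ℝ) : 1 ≤ 1 + x / p.b * p.y x := by
  linarith [p.y_sq_le x, sq_nonneg (p.y x)]

namespace IsSubcriticalWormhole

variable {p}

lemma Λ_sq (hp : p.IsSubcriticalWormhole) :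
    p.Λ ^ 2 = p.γ₁ ^ 2 - Real.exp (2 * p.γ₀) * p.εsq :=
  Real.sq_sqrt (Real.sqrt_pos.1 hp.subcritical).le

lemma S_pos (hp : p.IsSubcriticalWormhole) (x : ℝ) : 0 < x ^ 2 + p.b ^ 2 := by
  have := hp.b_pos; positivity

lemma abs_y_lt (hp : p.IsSubcriticalWormhole) (x : ℝ) : |p.Λ * p.y x| ≤ p.Λ * (Real.pi / 2) := by
  rw [abs_mul, abs_of_pos hp.subcritical]
  refine mul_le_mul_of_nonneg_left ?_ hp.subcritical.le
  rw [abs_le]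
  exact ⟨(Real.neg_pi_div_two_lt_arctan _).le, (Real.arctan_lt_pi_div_two _).le⟩

/-- A constant `r < 1` with `|γ₁ sinh (Λ y) / Λ| ≤ r cosh (Λ y)`. -/
lemma exists_ratio (hp : p.IsSubcriticalWormhole) : ∃ r : ℝ, 0 ≤ r ∧ r < 1 ∧
    ∀ x, |p.γ₁| * |Real.sinh (p.Λ * p.y x)| ≤ r * (p.Λ * Real.cosh (p.Λ * p.y x)) := by
  have hΛ := hp.subcritical
  set v := p.Λ * (Real.pi / 2) with hv
  have hv0 : 0 ≤ v := by have := Real.pi_pos; positivity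
  have hc := Real.cosh_pos v
  refine ⟨Real.tanh v / p.Λ * |p.γ₁|, ?_, hp.regular, fun x => ?_⟩
  · rw [Real.tanh_eq_sinh_div_cosh]
    have := Real.sinh_nonneg_iff.2 hv0
    positivity
  · have h := abs_sinh_mul_cosh_le (hp.abs_y_lt x)
    rw [← hv] at h
    have h1 := mul_le_mul_of_nonneg_left h (abs_nonneg p.γ₁)
    rw [Real.tanh_eq_sinh_div_cosh]
    have : Real.sinh v / Real.cosh v / p.Λ * |p.γ₁| * (p.Λ * Real.cosh (p.Λ * p.y x))
      = |p.γ₁| * (Real.sinh v * Real.cosh (p.Λ * p.y x)) / Real.cosh v := by field_simp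
    rw [this, le_div_iff₀ hc]
    linarith

/-- This is where the regularity condition enters: γ₁ sinh(Λy)/Λ is at most r cosh(Λy) in absolute
value with r < 1, so the denominator never degenerates. The bounds make the weight e^{-2d}
comparable with 1. -/
lemma exists_den_bounds (hp : p.IsSubcriticalWormhole) : ∃ c₀ c₁ : ℝ, 0 < c₀ ∧
    ∀ x, c₀ ≤ p.den x ∧ p.den x ≤ c₁ := by
  have hΛ := hp.subcritical
  obtain ⟨r, hr0, hr1, hr⟩ := hp.exists_ratio
  refine ⟨1 - r, 2 * Real.cosh (p.Λ * (Real.pi / 2)), by linarith, fun x => ?_⟩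
  have h1 : |p.γ₁ * (Real.sinh (p.Λ * p.y x) / p.Λ)| ≤ r * Real.cosh (p.Λ * p.y x) := by
    rw [abs_mul, abs_div, abs_of_pos hΛ, ← mul_div_assoc, div_le_iff₀ hΛ]
    linarith [hr x]
  have h2 := Real.one_le_cosh (p.Λ * p.y x)
  have h3 : Real.cosh (p.Λ * p.y x) ≤ Real.cosh (p.Λ * (Real.pi / 2)) := by
    rw [Real.cosh_le_cosh]
    exact (hp.abs_y_lt x).trans (le_abs_self _)
  obtain ⟨h4, h5⟩ := abs_le.1 h1
  unfold den
  constructor <;> nlinarith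

lemma den_pos (hp : p.IsSubcriticalWormhole) (x : ℝ) : 0 < p.den x := by
  obtain ⟨c₀, c₁, h, h'⟩ := hp.exists_den_bounds
  exact h.trans_le (h' x).1

lemma hasDerivAt_y (hp : p.IsSubcriticalWormhole) (x : ℝ) :
    HasDerivAt p.y (p.b / (x ^ 2 + p.b ^ 2)) x := by
  have hb := hp.b_pos
  refine (((hasDerivAt_id x).div_const p.b).arctan).congr_deriv ?_
  have := hp.S_pos x
  simp only [id]
  field_simp
  ring

lemma hasDerivAt_den (hp : p.IsSubcriticalWormhole) (x : ℝ) :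
    HasDerivAt p.den (p.b / (x ^ 2 + p.b ^ 2) *
      (p.Λ * Real.sinh (p.Λ * p.y x) - p.γ₁ * Real.cosh (p.Λ * p.y x))) x := by
  have hΛ := hp.subcritical.ne'
  have h1 := (hp.hasDerivAt_y x).const_mul p.Λ
  refine (h1.cosh.fun_sub ((h1.sinh.div_const p.Λ).const_mul p.γ₁)).congr_deriv ?_
  field_simp

lemma d_eq (x : ℝ) : p.d x = p.γ₀ - Real.log (p.den x) := rfl

lemma hasDerivAt_d_aux (hp : p.IsSubcriticalWormhole) (x : ℝ) :
    HasDerivAt p.d (p.b / (x ^ 2 + p.b ^ 2) *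
      (-(p.Λ * Real.sinh (p.Λ * p.y x) - p.γ₁ * Real.cosh (p.Λ * p.y x)) / p.den x)) x := by
  refine (((hp.hasDerivAt_den x).log (hp.den_pos x).ne').const_sub p.γ₀).congr_deriv ?_
  ring

lemma dy_eq (hp : p.IsSubcriticalWormhole) (x : ℝ) : p.dy x =
    -(p.Λ * Real.sinh (p.Λ * p.y x) - p.γ₁ * Real.cosh (p.Λ * p.y x)) / p.den x := by
  have hb := hp.b_pos
  have := hp.S_pos x
  rw [dy, derivY, (hp.hasDerivAt_d_aux x).deriv]
  field_simp

lemma hasDerivAt_d (hp : p.IsSubcriticalWormhole) (x : ℝ) :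
    HasDerivAt p.d (p.b / (x ^ 2 + p.b ^ 2) * p.dy x) x := by
  rw [hp.dy_eq]; exact hp.hasDerivAt_d_aux x

/-- Energy conservation for `e^{γ₀ - d}`. -/
lemma dy_sq_sub (hp : p.IsSubcriticalWormhole) (x : ℝ) :
    p.dy x ^ 2 - p.Λ ^ 2 = Real.exp (2 * p.d x) * p.εsq := by
  have hΛ := hp.subcritical.ne'
  have hq := (hp.den_pos x).ne'
  have h1 : Real.exp (2 * p.d x) = Real.exp (2 * p.γ₀) / p.den x ^ 2 := by
    rw [d_eq, mul_sub, Real.exp_sub]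
    congr 1
    rw [show 2 * Real.log (p.den x) = Real.log (p.den x ^ 2) by rw [Real.log_pow]; norm_num,
      Real.exp_log (by positivity)]
  have h2 := hp.Λ_sq
  have h3 := Real.cosh_sq (p.Λ * p.y x)
  have h4 : Real.exp (2 * p.γ₀) * p.εsq = p.γ₁ ^ 2 - p.Λ ^ 2 := by linarith
  rw [h1, div_mul_eq_mul_div, h4, hp.dy_eq, div_pow]
  field_simp
  unfold den
  field_simp
  linear_combination (p.γ₁ ^ 2 - p.Λ ^ 2) * h3

/-- The Riccati equation d_yy = d_y² − Λ². Together with the corresponding formulas for c_y, R and T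
it closes the system under ∂_y, so that later verifications are algebraic. -/
lemma hasDerivAt_dy (hp : p.IsSubcriticalWormhole) (x : ℝ) :
    HasDerivAt p.dy (p.b / (x ^ 2 + p.b ^ 2) * (p.dy x ^ 2 - p.Λ ^ 2)) x := by
  have hΛ := hp.subcritical.ne'
  have hq := (hp.den_pos x).ne'
  have h1 := (hp.hasDerivAt_y x).const_mul p.Λ
  have h2 := (((h1.sinh.const_mul p.Λ).fun_sub (h1.cosh.const_mul p.γ₁)).fun_neg).fun_div
    (hp.hasDerivAt_den x) hq
  rw [show p.dy = _ from funext hp.dy_eq]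
  refine h2.congr_deriv ?_
  have h3 : p.Λ * p.Λ * Real.cosh (p.Λ * p.y x) - p.γ₁ * (p.Λ * Real.sinh (p.Λ * p.y x))
    = p.Λ ^ 2 * p.den x := by unfold den; field_simp
  field_simp
  linear_combination (-p.den x * p.b / (x ^ 2 + p.b ^ 2)) * h3

lemma cy_eq (hp : p.IsSubcriticalWormhole) (x : ℝ) : p.cy x = x / p.b - p.dy x := by
  have hb := hp.b_pos
  have hS := hp.S_pos x
  have h1 : HasDerivAt (fun x : ℝ => x ^ 2 + p.b ^ 2) (2 * x) x := by
    simpa using (hasDerivAt_pow 2 x).add_const (p.b ^ 2)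
  have h2 := ((h1.sqrt hS.ne').log (Real.sqrt_pos.2 hS).ne').fun_sub (hp.hasDerivAt_d x)
  have h3 : HasDerivAt p.c _ x := h2
  rw [cy, derivY, h3.deriv]
  have h4 : Real.sqrt (x ^ 2 + p.b ^ 2) ≠ 0 := (Real.sqrt_pos.2 hS).ne'
  have h5 := Real.sq_sqrt hS.le
  field_simp
  rw [h5]
  ring

lemma hasDerivAt_c (hp : p.IsSubcriticalWormhole) (x : ℝ) :
    HasDerivAt p.c (p.b / (x ^ 2 + p.b ^ 2) * p.cy x) x := by
  have hb := hp.b_pos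
  have hS := hp.S_pos x
  have h1 : HasDerivAt (fun x : ℝ => x ^ 2 + p.b ^ 2) (2 * x) x := by
    simpa using (hasDerivAt_pow 2 x).add_const (p.b ^ 2)
  have h2 := ((h1.sqrt hS.ne').log (Real.sqrt_pos.2 hS).ne').fun_sub (hp.hasDerivAt_d x)
  have h3 : HasDerivAt p.c _ x := h2
  refine h3.congr_deriv ?_
  have h4 : Real.sqrt (x ^ 2 + p.b ^ 2) ≠ 0 := (Real.sqrt_pos.2 hS).ne'
  have h5 := Real.sq_sqrt hS.le
  rw [hp.cy_eq]
  field_simp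
  rw [h5]
  ring

lemma hasDerivAt_cy (hp : p.IsSubcriticalWormhole) (x : ℝ) :
    HasDerivAt p.cy (p.b / (x ^ 2 + p.b ^ 2)
      * (1 + p.Λ ^ 2 + p.cy x ^ 2 + 2 * p.cy x * p.dy x)) x := by
  have hb := hp.b_pos
  have hS := hp.S_pos x
  rw [show p.cy = _ from funext hp.cy_eq]
  refine (((hasDerivAt_id x).div_const p.b).fun_sub (hp.hasDerivAt_dy x)).congr_deriv ?_
  field_simp
  ring

lemma exp_two_c (hp : p.IsSubcriticalWormhole) (x : ℝ) :
    Real.exp (2 * p.c x) = (x ^ 2 + p.b ^ 2) * Real.exp (-2 * p.d x) := by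
  have hS := hp.S_pos x
  rw [c, mul_sub, Real.exp_sub, Real.log_sqrt hS.le, mul_div_cancel₀ _ two_ne_zero,
    Real.exp_log hS, div_eq_mul_inv, ← Real.exp_neg]
  ring_nf

lemma exp_neg_two_c (hp : p.IsSubcriticalWormhole) (x : ℝ) :
    Real.exp (-2 * p.c x) = 1 / ((x ^ 2 + p.b ^ 2) * p.w x) := by
  rw [w, ← hp.exp_two_c, one_div, ← Real.exp_neg]
  ring_nf

lemma exp_neg_four_c (hp : p.IsSubcriticalWormhole) (x : ℝ) :
    Real.exp (-4 * p.c x) = 1 / ((x ^ 2 + p.b ^ 2) * p.w x) ^ 2 := by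
  rw [show -4 * p.c x = ((2 : ℕ) : ℝ) * (-2 * p.c x) by push_cast; ring, Real.exp_nat_mul,
    hp.exp_neg_two_c, one_div_pow]

lemma κ₀_mul_Qsq (hp : p.IsSubcriticalWormhole) (x : ℝ) :
    p.κ₀ * p.Qsq = 2 * p.b ^ 2 * (p.dy x ^ 2 - p.Λ ^ 2) * p.w x := by
  have hb := hp.b_pos.ne'
  rw [hp.dy_sq_sub, w, εsq]
  have : Real.exp (2 * p.d x) * Real.exp (-(2 * p.d x)) = 1 := by rw [← Real.exp_add]; simp
  field_simp
  linear_combination (-(p.κ₀ * p.Qsq)) * this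

/-! ### Positivity of `F` -/

lemma N_eq (hp : p.IsSubcriticalWormhole) (x : ℝ) : p.N x = (1 + p.Λ ^ 2) * p.F x := by
  have : 1 + p.Λ ^ 2 ≠ 0 := by positivity
  rw [N, F, hp.cy_eq]
  field_simp
  ring

/-- `mul_sinh_sub_le` with l = Λ, g = γ₁, u = Λy, divided by the positive denominator of d_y. -/
lemma le_y_mul_dy (hp : p.IsSubcriticalWormhole) (x : ℝ) :
    -(1 / 2 + |p.Λ * p.y x|) ≤ p.y x * p.dy x := by
  have hΛ := hp.subcritical
  have hq := hp.den_pos x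
  obtain ⟨r, hr0, hr1, hr⟩ := hp.exists_ratio
  have h1 := mul_sinh_sub_le (g := p.γ₁) (u := p.Λ * p.y x) hΛ
    ((hr x).trans (by
      have := mul_pos hΛ (Real.cosh_pos (p.Λ * p.y x))
      nlinarith))
  have h2 : p.Λ * Real.cosh (p.Λ * p.y x) - p.γ₁ * Real.sinh (p.Λ * p.y x) = p.Λ * p.den x := by
    unfold den; field_simp
  rw [h2, mul_assoc p.Λ] at h1
  rw [hp.dy_eq, ← mul_div_assoc, le_div_iff₀ hq]
  have h3 : p.Λ * (p.y x * (p.Λ * Real.sinh (p.Λ * p.y x) - p.γ₁ * Real.cosh (p.Λ * p.y x)))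
    ≤ p.Λ * ((1 / 2 + |p.Λ * p.y x|) * p.den x) := by linarith
  linarith [le_of_mul_le_mul_left h3 hΛ]

/-- The loss 1/2 + |Λy| from `le_y_mul_dy` is absorbed by |Λy| ≤ 1/3 + (3/4) Λ² y² and y² ≤ (x/b) y.
Keeping a quarter of the growing term, rather than mere positivity, bounds R and gives the decay of
χ₀. -/
lemma le_N (hp : p.IsSubcriticalWormhole) (x : ℝ) :
    p.Λ ^ 2 / 4 * (1 + x / p.b * p.y x) ≤ p.N x := by
  have h1 := hp.le_y_mul_dy x
  have h2 := p.y_sq_le x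
  have h3 : |p.Λ * p.y x| ^ 2 = p.Λ ^ 2 * p.y x ^ 2 := by rw [sq_abs]; ring
  have h4 := mul_le_mul_of_nonneg_left h2 (sq_nonneg p.Λ)
  unfold N
  nlinarith [sq_nonneg (|p.Λ * p.y x| - 2 / 3), sq_nonneg p.Λ]

lemma N_pos (hp : p.IsSubcriticalWormhole) (x : ℝ) : 0 < p.N x := by
  have h1 := hp.le_N x
  have h2 := p.one_le_one_add_mul_y x
  have h3 := hp.subcritical
  exact lt_of_lt_of_le (by positivity) h1

lemma F_pos (hp : p.IsSubcriticalWormhole) (x : ℝ) : 0 < p.F x := by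
  have h := hp.N_pos x
  rw [hp.N_eq] at h
  exact (mul_pos_iff_of_pos_left (by positivity)).1 h

/-! ### The quotient `R = G / H` -/

lemma R_eq (hp : p.IsSubcriticalWormhole) (x : ℝ) :
    p.R x = p.Λ ^ 2 * (1 + x / p.b * p.y x) / p.N x := by
  have h1 : 1 + p.Λ ^ 2 ≠ 0 := by positivity
  have h2 := (hp.F_pos x).ne'
  have h3 := (Real.exp_pos (-p.c x)).ne'
  rw [R, G, H, hp.N_eq]
  field_simp

/-- At the zero of c_y the left side vanishes, so its quotient by c_y extends smoothly, to T. This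
relation removes T from the later identities. -/
lemma R_mul_sub (hp : p.IsSubcriticalWormhole) (x : ℝ) :
    (1 + p.Λ ^ 2) * p.R x - p.Λ ^ 2 = p.cy x * p.T x := by
  have h2 := (hp.N_pos x).ne'
  have hb := hp.b_pos.ne'
  rw [hp.R_eq, T, hp.cy_eq]
  field_simp
  unfold N
  field_simp
  ring

lemma hasDerivAt_N (hp : p.IsSubcriticalWormhole) (x : ℝ) :
    HasDerivAt p.N (p.b / (x ^ 2 + p.b ^ 2) * (p.Λ ^ 2 * (x / p.b) + p.dy x
      + p.y x * (p.Λ ^ 2 * (x / p.b) ^ 2 + p.dy x ^ 2))) x := by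
  have hb := hp.b_pos.ne'
  have hS := (hp.S_pos x).ne'
  refine (((((hasDerivAt_id x).div_const p.b).fun_mul (hp.hasDerivAt_y x)).const_mul
    (p.Λ ^ 2)).const_add (1 + p.Λ ^ 2)).fun_add ((hp.hasDerivAt_y x).fun_mul
    (hp.hasDerivAt_dy x)) |>.congr_deriv ?_
  simp only [id]
  field_simp
  ring

/-- This Riccati equation is what singles out R: it cancels the u₂ terms without s² when χ = u₁ − R
u₂ is differentiated. -/
lemma hasDerivAt_R (hp : p.IsSubcriticalWormhole) (x : ℝ) :
    HasDerivAt p.R (p.b / (x ^ 2 + p.b ^ 2)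
      * (-p.cy x * p.R x ^ 2 + p.cy x * p.R x + p.T x)) x := by
  have hb := hp.b_pos.ne'
  have hS := (hp.S_pos x).ne'
  have hN := (hp.N_pos x).ne'
  rw [hp.R_eq, T, hp.cy_eq, show p.R = _ from funext hp.R_eq]
  refine (((((hasDerivAt_id x).div_const p.b).fun_mul (hp.hasDerivAt_y x)).const_add 1).const_mul
    (p.Λ ^ 2)).fun_div (hp.hasDerivAt_N x) hN |>.congr_deriv ?_
  simp only [id]
  field_simp
  unfold N
  field_simp
  ring

lemma hasDerivAt_T (hp : p.IsSubcriticalWormhole) (x : ℝ) :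
    HasDerivAt p.T (p.b / (x ^ 2 + p.b ^ 2) * ((1 + p.Λ ^ 2) * p.R x * (1 - p.R x)
      - p.cy x * p.T x - 2 * p.dy x * p.T x)) x := by
  have hb := hp.b_pos.ne'
  have hS := (hp.S_pos x).ne'
  have hN := (hp.N_pos x).ne'
  rw [hp.R_eq, hp.cy_eq]
  refine ((hp.hasDerivAt_y x).const_mul (p.Λ ^ 2)).fun_div (hp.hasDerivAt_N x) hN
    |>.congr_deriv ?_
  rw [T]
  field_simp
  unfold N
  field_simp
  ring

lemma hasDerivAt_F (hp : p.IsSubcriticalWormhole) (x : ℝ) :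
    HasDerivAt p.F (p.b / (x ^ 2 + p.b ^ 2) * (p.F x * (p.cy x * p.R x + p.dy x))) x := by
  have h1 : 1 + p.Λ ^ 2 ≠ 0 := by positivity
  have hb := hp.b_pos.ne'
  have hS := (hp.S_pos x).ne'
  have hN := (hp.N_pos x).ne'
  have hF : p.F = fun x => p.N x / (1 + p.Λ ^ 2) := by
    funext x; rw [hp.N_eq]; field_simp
  rw [hp.R_eq, hp.cy_eq, hF]
  refine ((hp.hasDerivAt_N x).div_const _).congr_deriv ?_
  field_simp
  unfold N
  field_simp
  ring

end IsSubcriticalWormhole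
end Params

end

namespace Params

variable {p : Params}

lemma del_eq (f : ℝ → ℝ) (x : ℝ) : p.del f x = (p.w x)⁻¹ * deriv f x := by
  rw [del, w, a, ← Real.exp_neg]
  ring_nf

namespace IsSubcriticalWormhole

/-! ### Smoothness of the background -/

lemma contDiff_y : ContDiff ℝ ∞ p.y := (contDiff_id.div_const _).arctan

lemma contDiff_den : ContDiff ℝ ∞ p.den := by
  have h : ContDiff ℝ ∞ fun x => p.Λ * p.y x := contDiff_const.mul contDiff_y
  exact h.cosh.sub (contDiff_const.mul (h.sinh.div_const _))

lemma contDiff_d (hp : p.IsSubcriticalWormhole) : ContDiff ℝ ∞ p.d :=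
  contDiff_const.sub (contDiff_den.log fun x => (hp.den_pos x).ne')

lemma contDiff_c (hp : p.IsSubcriticalWormhole) : ContDiff ℝ ∞ p.c := by
  have h : ContDiff ℝ ∞ fun x : ℝ => x ^ 2 + p.b ^ 2 := by fun_prop
  exact ((h.sqrt fun x => (hp.S_pos x).ne').log
    fun x => (Real.sqrt_pos.2 (hp.S_pos x)).ne').sub hp.contDiff_d

lemma contDiff_dy (hp : p.IsSubcriticalWormhole) : ContDiff ℝ ∞ p.dy := by
  have h : ContDiff ℝ ∞ fun x => p.Λ * p.y x := contDiff_const.mul contDiff_y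
  rw [show p.dy = _ from funext hp.dy_eq]
  exact ((contDiff_const.mul h.sinh).sub (contDiff_const.mul h.cosh)).neg.div contDiff_den
    fun x => (hp.den_pos x).ne'

lemma contDiff_cy (hp : p.IsSubcriticalWormhole) : ContDiff ℝ ∞ p.cy := by
  rw [show p.cy = _ from funext hp.cy_eq]
  exact (contDiff_id.div_const _).sub hp.contDiff_dy

lemma contDiff_F (hp : p.IsSubcriticalWormhole) : ContDiff ℝ ∞ p.F :=
  (contDiff_const.add ((contDiff_id.div_const _).mul contDiff_y)).sub
    ((contDiff_y.mul hp.contDiff_cy).div_const _)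

lemma contDiff_w (hp : p.IsSubcriticalWormhole) : ContDiff ℝ ∞ p.w :=
  (contDiff_const.mul hp.contDiff_d).exp

lemma contDiff_R (hp : p.IsSubcriticalWormhole) : ContDiff ℝ ∞ p.R := by
  have hc : ContDiff ℝ ∞ fun x => Real.exp (-p.c x) := hp.contDiff_c.neg.exp
  have hG : ContDiff ℝ ∞ p.G := hc.mul (contDiff_const.mul
    (contDiff_const.add ((contDiff_id.div_const _).mul contDiff_y)))
  exact hG.div (hc.mul hp.contDiff_F) fun x => (mul_pos (Real.exp_pos _) (hp.F_pos x)).ne'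

/-- The potential in terms of `R`. -/
lemma W_eq (hp : p.IsSubcriticalWormhole) (x : ℝ) :
    p.W x = p.b ^ 2 / ((x ^ 2 + p.b ^ 2) * p.w x) ^ 2 *
      (-3 * (1 + p.Λ ^ 2) + 2 * p.dy x * (p.dy x - p.cy x)
        - 4 * p.R x * (p.cy x * p.dy x + 1 + p.Λ ^ 2) + 2 * p.cy x ^ 2 * p.R x ^ 2) := by
  rw [W, hp.exp_neg_four_c, mul_one_div]
  rfl

lemma contDiff_W (hp : p.IsSubcriticalWormhole) : ContDiff ℝ ∞ p.W := by
  have h1 := hp.contDiff_R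
  have h2 := hp.contDiff_cy
  have h3 := hp.contDiff_dy
  have h4 := hp.contDiff_w
  rw [show p.W = _ from funext hp.W_eq]
  have h5 : ContDiff ℝ ∞ fun x : ℝ => p.b ^ 2 / ((x ^ 2 + p.b ^ 2) * p.w x) ^ 2 :=
    contDiff_const.div (by fun_prop) fun x => by
      have := hp.S_pos x
      have := p.w_pos x
      positivity
  exact h5.mul (by fun_prop)

lemma contDiff_χ₀ (hp : p.IsSubcriticalWormhole) : ContDiff ℝ ∞ p.χ₀ :=
  hp.contDiff_cy.div (hp.contDiff_c.exp.mul hp.contDiff_F) fun x =>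
    (mul_pos (Real.exp_pos _) (hp.F_pos x)).ne'

/-! ### Bounds -/

lemma exists_w_bounds (hp : p.IsSubcriticalWormhole) : ∃ w₀ w₁ : ℝ, 0 < w₀ ∧
    ∀ x, w₀ ≤ p.w x ∧ p.w x ≤ w₁ := by
  obtain ⟨c₀, c₁, h0, h⟩ := hp.exists_den_bounds
  have hw : ∀ x, p.w x = Real.exp (-2 * p.γ₀) * p.den x ^ 2 := fun x => by
    have hq := hp.den_pos x
    rw [w, d_eq, ← Real.exp_log (show 0 < p.den x ^ 2 by positivity), ← Real.exp_add,
      Real.log_pow]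
    congr 1
    push_cast
    ring
  refine ⟨Real.exp (-2 * p.γ₀) * c₀ ^ 2, Real.exp (-2 * p.γ₀) * c₁ ^ 2, by positivity,
    fun x => ?_⟩
  have hq := (hp.den_pos x).le
  obtain ⟨h1, h2⟩ := h x
  rw [hw]
  constructor <;> gcongr

lemma exists_abs_dy_le (hp : p.IsSubcriticalWormhole) : ∃ D : ℝ, 0 ≤ D ∧ ∀ x, |p.dy x| ≤ D := by
  obtain ⟨c₀, c₁, h0, h⟩ := hp.exists_den_bounds
  have hΛ := hp.subcritical
  set K := Real.cosh (p.Λ * (Real.pi / 2)) with hK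
  have hK0 : 0 < K := Real.cosh_pos _
  refine ⟨(p.Λ * K + |p.γ₁| * K) / c₀, by positivity, fun x => ?_⟩
  have hq := hp.den_pos x
  have h1 : Real.cosh (p.Λ * p.y x) ≤ K := by
    rw [hK, Real.cosh_le_cosh]
    exact (hp.abs_y_lt x).trans (le_abs_self _)
  have h2 : |Real.sinh (p.Λ * p.y x)| ≤ K := by
    rw [Real.abs_sinh]
    refine (Real.sinh_lt_cosh _).le.trans ?_
    rwa [Real.cosh_abs]
  rw [hp.dy_eq, abs_div, abs_neg, abs_of_pos hq]
  have h3 : |p.Λ * Real.sinh (p.Λ * p.y x) - p.γ₁ * Real.cosh (p.Λ * p.y x)|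
      ≤ p.Λ * K + |p.γ₁| * K := by
    refine (abs_sub _ _).trans ?_
    rw [abs_mul, abs_mul, abs_of_pos hΛ, abs_of_pos (Real.cosh_pos _)]
    gcongr
  gcongr
  exact (h x).1

lemma R_nonneg (hp : p.IsSubcriticalWormhole) (x : ℝ) : 0 ≤ p.R x := by
  have h1 := hp.N_pos x
  have h2 := p.one_le_one_add_mul_y x
  rw [hp.R_eq]
  positivity

lemma R_le (hp : p.IsSubcriticalWormhole) (x : ℝ) : p.R x ≤ 4 := by
  rw [hp.R_eq, div_le_iff₀ (hp.N_pos x)]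
  linarith [hp.le_N x]

/-- Here π/4 ≤ y < 2, so Λ² (x/b) y ≥ 1 + 2D outweighs the terms 1 + y d_y of N. The lower bound
makes 2 c_y² R² the dominant term of W near +∞. -/
lemma half_le_R (hp : p.IsSubcriticalWormhole) {D x : ℝ} (hD : |p.dy x| ≤ D) (hx : 1 ≤ x / p.b)
    (hx' : 2 + 4 * D ≤ p.Λ ^ 2 * (x / p.b)) : 1 / 2 ≤ p.R x := by
  have h1 : Real.pi / 4 ≤ p.y x := by
    rw [← Real.arctan_one]; exact Real.arctan_le_arctan_iff.2 hx
  have h2 : p.y x ≤ Real.pi / 2 := (Real.arctan_lt_pi_div_two _).le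
  have h3 := Real.pi_gt_three
  have h4 := Real.pi_lt_four
  have h5 : p.y x * p.dy x ≤ 2 * D := by
    have h6 := le_abs_self (p.dy x)
    have h7 := abs_nonneg (p.dy x)
    nlinarith
  rw [hp.R_eq, le_div_iff₀ (hp.N_pos x)]
  unfold N
  have h8 : 0 ≤ p.Λ ^ 2 * (x / p.b) * (p.y x - 1 / 2) :=
    mul_nonneg (by positivity) (by linarith)
  nlinarith [sq_nonneg p.Λ]

lemma exists_isTame (hp : p.IsSubcriticalWormhole) :
    ∃ w₀ w₁ C R : ℝ, IsTame p.w p.W w₀ w₁ C R := by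
  obtain ⟨w₀, w₁, hw0, hw⟩ := hp.exists_w_bounds
  obtain ⟨D, hD0, hD⟩ := hp.exists_abs_dy_le
  have hb := hp.b_pos
  have hΛ := hp.subcritical
  -- Collects the terms of the bracket in W under |c_y| ≤ |x/b| + D, |d_y| ≤ D and 0 ≤ R ≤ 4, each
  -- measured against 1 + (x/b)².
  set M := 3 * (1 + p.Λ ^ 2) + 2 * D * (2 * D + 1) + 16 * ((1 + D) * D + 1 + p.Λ ^ 2)
    + 64 * (1 + D ^ 2) with hM
  refine ⟨w₀, w₁, M / w₀ * (1 + 1 / p.b ^ 2), p.b * (1 + (2 + 4 * D) / p.Λ ^ 2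
    + (D + 36 * D + 38 * (1 + p.Λ ^ 2))), hp.contDiff_w.continuous, hp.contDiff_W.continuous,
    hw0, fun x => (hw x).1, fun x => (hw x).2, by positivity, fun x => ?_, fun x hx => ?_⟩
  · have hS := hp.S_pos x
    have hwx := p.w_pos x
    have h1 := hD x
    have hγ : |p.cy x| ≤ |x / p.b| + D := by
      rw [hp.cy_eq]; exact (abs_sub _ _).trans (by linarith)
    have hR0 := hp.R_nonneg x
    have hR4 := hp.R_le x
    set X := |x / p.b| with hX
    have hX0 : 0 ≤ X := abs_nonneg _
    have hU : |-3 * (1 + p.Λ ^ 2) + 2 * p.dy x * (p.dy x - p.cy x)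
        - 4 * p.R x * (p.cy x * p.dy x + 1 + p.Λ ^ 2) + 2 * p.cy x ^ 2 * p.R x ^ 2|
        ≤ M * (1 + X ^ 2) := by
      have e1 : |2 * p.dy x * (p.dy x - p.cy x)| ≤ 2 * D * (D + (X + D)) := by
        rw [abs_mul, abs_mul, abs_two]
        have := (abs_sub (p.dy x) (p.cy x)).trans (add_le_add h1 hγ)
        gcongr
      have e2 : |4 * p.R x * (p.cy x * p.dy x + 1 + p.Λ ^ 2)|
          ≤ 4 * 4 * ((X + D) * D + 1 + p.Λ ^ 2) := by
        rw [abs_mul, abs_of_nonneg (by positivity : 0 ≤ 4 * p.R x), add_assoc, add_assoc]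
        have : |p.cy x * p.dy x + (1 + p.Λ ^ 2)| ≤ (X + D) * D + (1 + p.Λ ^ 2) := by
          refine (abs_add_le _ _).trans ?_
          rw [abs_mul, abs_of_nonneg (by positivity : 0 ≤ 1 + p.Λ ^ 2)]
          gcongr
        gcongr
      have e3 : |2 * p.cy x ^ 2 * p.R x ^ 2| ≤ 2 * (X + D) ^ 2 * 4 ^ 2 := by
        rw [abs_mul, abs_mul, abs_two, abs_of_nonneg (sq_nonneg (p.R x)), abs_pow]
        gcongr
      have e4 : |-3 * (1 + p.Λ ^ 2)| = 3 * (1 + p.Λ ^ 2) := by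
        rw [abs_mul, abs_of_nonneg (by positivity : 0 ≤ 1 + p.Λ ^ 2)]; norm_num
      refine (abs_add_le _ _).trans (?_ : _ ≤ _)
      have e5 := abs_sub (-3 * (1 + p.Λ ^ 2) + 2 * p.dy x * (p.dy x - p.cy x))
        (4 * p.R x * (p.cy x * p.dy x + 1 + p.Λ ^ 2))
      have e6 := abs_add_le (-3 * (1 + p.Λ ^ 2)) (2 * p.dy x * (p.dy x - p.cy x))
      have e7 : X ≤ 1 + X ^ 2 := by nlinarith [sq_nonneg (X - 1)]
      have e8 : (X + D) ^ 2 ≤ 2 * (1 + D ^ 2) * (1 + X ^ 2) := by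
        nlinarith [sq_nonneg (X - D), mul_nonneg (sq_nonneg X) (sq_nonneg D)]
      have e9 : D * X ≤ D * (1 + X ^ 2) := mul_le_mul_of_nonneg_left e7 hD0
      have e10 : 0 ≤ (D ^ 2 + p.Λ ^ 2 + 1) * X ^ 2 := by positivity
      rw [hM]
      nlinarith
    rw [hp.W_eq, abs_mul, abs_mul, abs_of_pos hwx, abs_of_pos (by positivity :
      0 < p.b ^ 2 / ((x ^ 2 + p.b ^ 2) * p.w x) ^ 2)]
    have hX2 : 1 + X ^ 2 = (x ^ 2 + p.b ^ 2) / p.b ^ 2 := by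
      rw [hX, sq_abs]; field_simp; ring
    rw [hX2] at hU
    have hM0 : 0 ≤ M := by positivity
    calc _ ≤ p.w x * (p.b ^ 2 / ((x ^ 2 + p.b ^ 2) * p.w x) ^ 2 *
            (M * ((x ^ 2 + p.b ^ 2) / p.b ^ 2))) := by gcongr
      _ = M / p.w x / (x ^ 2 + p.b ^ 2) := by field_simp
      _ ≤ M / w₀ / (x ^ 2 + p.b ^ 2) := by have := (hw x).1; gcongr
      _ ≤ M / w₀ * (1 + 1 / p.b ^ 2) / (1 + x ^ 2) := by
        rw [div_le_div_iff₀ hS (by positivity), mul_assoc]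
        refine mul_le_mul_of_nonneg_left ?_ (by positivity)
        have : (1 + 1 / p.b ^ 2) * (x ^ 2 + p.b ^ 2) = 1 + x ^ 2 + (p.b ^ 2 + x ^ 2 / p.b ^ 2) := by
          field_simp; ring
        rw [this]
        have : 0 ≤ p.b ^ 2 + x ^ 2 / p.b ^ 2 := by positivity
        linarith
  · have hX : 1 + (2 + 4 * D) / p.Λ ^ 2 + (D + 36 * D + 38 * (1 + p.Λ ^ 2)) ≤ x / p.b := by
      rw [le_div_iff₀ hb]; linarith
    have h0 : 0 ≤ (2 + 4 * D) / p.Λ ^ 2 := by positivity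
    have h1 : 2 + 4 * D ≤ p.Λ ^ 2 * (x / p.b) := by
      have : (2 + 4 * D) / p.Λ ^ 2 ≤ x / p.b := by nlinarith [sq_nonneg p.Λ]
      rw [div_le_iff₀ (by positivity)] at this
      linarith
    have hR := hp.half_le_R (hD x) (by nlinarith [sq_nonneg p.Λ]) h1
    have hR4 := hp.R_le x
    obtain ⟨h2, h3⟩ := abs_le.1 (hD x)
    -- With 1/2 ≤ R ≤ 4 the bracket is at least c_y²/2 − 18 D c_y − 19 (1 + Λ²), nonnegative for c_y
    -- this large.
    have hγ : 36 * D + 38 * (1 + p.Λ ^ 2) + 1 ≤ p.cy x := by rw [hp.cy_eq]; linarith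
    rw [hp.W_eq]
    refine mul_nonneg (by positivity) ?_
    set r := p.R x
    set g := p.cy x
    set e := p.dy x
    have hg : 1 ≤ g := by linarith [sq_nonneg p.Λ]
    have hL : 1 ≤ 1 + p.Λ ^ 2 := by linarith [sq_nonneg p.Λ]
    set K := 1 + p.Λ ^ 2
    have k1 : 1 / 4 ≤ r ^ 2 := by nlinarith only [hR]
    have k2 : 1 / 4 * g ^ 2 ≤ g ^ 2 * r ^ 2 := by
      rw [mul_comm]; exact mul_le_mul_of_nonneg_left k1 (sq_nonneg g)
    have k4 : g * e ≤ g * D := mul_le_mul_of_nonneg_left h3 (by linarith)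
    have k3 : r * (g * e) ≤ 4 * (g * D) :=
      (mul_le_mul_of_nonneg_left k4 (by linarith)).trans
        (mul_le_mul_of_nonneg_right hR4 (mul_nonneg (by linarith) hD0))
    have k5 : r * K ≤ 4 * K := mul_le_mul_of_nonneg_right hR4 (by linarith)
    have k6 : 0 ≤ g * (g - (36 * D + 38 * K)) := by
      apply mul_nonneg <;> linarith
    have k7 : 0 ≤ (g - 1) * K := by
      apply mul_nonneg <;> linarith
    have e1 : -3 * K + 2 * e * (e - g) - 4 * r * (g * e + 1 + p.Λ ^ 2) + 2 * g ^ 2 * r ^ 2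
      = -3 * K + 2 * e ^ 2 - 2 * (g * e) - 4 * (r * (g * e)) - 4 * (r * K)
        + 2 * (g ^ 2 * r ^ 2) := by ring
    rw [e1]
    linarith [sq_nonneg e]

end IsSubcriticalWormhole
end Params

section

/-! ### The space `X` and the Schrödinger operator -/

section
variable {p : Params}

lemma IsSol.del_fst {V u v : ℝ → ℝ} (h : IsSol p.w V u v) : p.del u = v := by
  funext x
  rw [Params.del_eq, (h.fst x).deriv, smul_eq_mul, inv_mul_cancel_left₀ (p.w_pos x).ne']

lemma IsSol.del_snd {V u v : ℝ → ℝ} (h : IsSol p.w V u v) : p.del v = fun x => V x * u x := by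
  funext x
  rw [Params.del_eq, (h.snd x).deriv, smul_eq_mul, inv_mul_cancel_left₀ (p.w_pos x).ne']

lemma IsSol.schrodinger_eq {V u v : ℝ → ℝ} (h : IsSol p.w V u v) (x : ℝ) :
    p.schrodinger u x = (p.W x - V x) * u x := by
  rw [Params.schrodinger, h.del_fst, h.del_snd]
  ring

end

namespace Params.IsSubcriticalWormhole

variable {p : Params}

lemma measurable_weight (hp : p.IsSubcriticalWormhole) :
    Measurable fun x => ENNReal.ofReal (Real.exp (-2 * p.d x)) :=
  (hp.contDiff_w.continuous.measurable).ennreal_ofReal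

lemma integral_μ (hp : p.IsSubcriticalWormhole) (f : ℝ → ℂ) :
    ∫ x, f x ∂p.μ = ∫ x, p.w x • f x := by
  rw [Params.μ, integral_withDensity_eq_integral_toReal_smul hp.measurable_weight
    (Eventually.of_forall fun x => ENNReal.ofReal_lt_top)]
  refine integral_congr_ae (Eventually.of_forall fun x => ?_)
  simp only [ENNReal.toReal_ofReal (Real.exp_pos _).le]
  rfl

lemma exists_μ_le (hp : p.IsSubcriticalWormhole) :
    ∃ c : ENNReal, c ≠ ⊤ ∧ p.μ ≤ c • (volume : Measure ℝ) := by
  obtain ⟨w₀, w₁, h0, h⟩ := hp.exists_w_bounds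
  refine ⟨ENNReal.ofReal w₁, ENNReal.ofReal_ne_top, ?_⟩
  rw [← withDensity_const]
  exact withDensity_mono (Eventually.of_forall fun x => ENNReal.ofReal_le_ofReal (h x).2)

lemma exists_volume_le (hp : p.IsSubcriticalWormhole) :
    ∃ c : ENNReal, c ≠ ⊤ ∧ (volume : Measure ℝ) ≤ c • p.μ := by
  obtain ⟨w₀, w₁, h0, h⟩ := hp.exists_w_bounds
  have h1 : ENNReal.ofReal w₀ • (volume : Measure ℝ) ≤ p.μ := by
    rw [← withDensity_const]
    exact withDensity_mono (Eventually.of_forall fun x => ENNReal.ofReal_le_ofReal (h x).1)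
  have h2 : ENNReal.ofReal w₀ ≠ 0 := by simpa using h0
  refine ⟨(ENNReal.ofReal w₀)⁻¹, ENNReal.inv_ne_top.2 h2, ?_⟩
  calc (volume : Measure ℝ) = (ENNReal.ofReal w₀)⁻¹ • (ENNReal.ofReal w₀ • volume) := by
        rw [smul_smul, ENNReal.inv_mul_cancel h2 ENNReal.ofReal_ne_top, one_smul]
    _ ≤ _ := by gcongr

lemma memLp_μ_iff (hp : p.IsSubcriticalWormhole) {f : ℝ → ℂ} :
    MemLp f 2 p.μ ↔ MemLp f 2 volume := by
  obtain ⟨c, hc, h⟩ := hp.exists_μ_le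
  obtain ⟨c', hc', h'⟩ := hp.exists_volume_le
  exact ⟨fun hf => hf.of_measure_le_smul hc' h', fun hf => hf.of_measure_le_smul hc h⟩

lemma ae_μ (hp : p.IsSubcriticalWormhole) : ae p.μ = ae (volume : Measure ℝ) := by
  obtain ⟨c, hc, h⟩ := hp.exists_μ_le
  obtain ⟨c', hc', h'⟩ := hp.exists_volume_le
  exact le_antisymm (Measure.absolutelyContinuous_of_le_smul h).ae_le
    (Measure.absolutelyContinuous_of_le_smul h').ae_le

lemma w_mul_schrodinger (p : Params) (φ : ℝ → ℝ) (x : ℝ) :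
    p.w x * p.schrodinger φ x
      = -deriv (fun z => (p.w z)⁻¹ * deriv φ z) x + p.w x * (p.W x * φ x) := by
  have : p.del φ = fun z => (p.w z)⁻¹ * deriv φ z := funext fun z => del_eq φ z
  rw [schrodinger, this, del_eq, mul_add, mul_neg, mul_inv_cancel_left₀ (p.w_pos x).ne']

lemma contDiff_inv_w_mul_deriv (hp : p.IsSubcriticalWormhole) {φ : ℝ → ℝ}
    (hφ : ContDiff ℝ ∞ φ) : ContDiff ℝ ∞ fun z => (p.w z)⁻¹ * deriv φ z :=
  (hp.contDiff_w.inv fun x => (p.w_pos x).ne').mul (contDiff_infty_iff_deriv.1 hφ).2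

/-- Elements of the domain with `-∂²f + W f = E f` are classical solutions. -/
lemma exists_isSol (hp : p.IsSubcriticalWormhole) {E : ℂ} {f : ℝ → ℂ}
    (h : p.SchrodingerGraph f fun x => E * f x) :
    ∃ u v : ℝ → ℂ, IsSol p.w (fun x => (p.W x : ℂ) - E) u v ∧ f =ᵐ[volume] u := by
  obtain ⟨hf, -, heq⟩ := h
  have hfl : LocallyIntegrable f := (hp.memLp_μ_iff.1 hf).locallyIntegrable (by norm_num)
  have hw := hp.contDiff_w.continuous
  have hW := hp.contDiff_W.continuous
  refine exists_isSol_of_weak hp.contDiff_w p.w_pos (by fun_prop) hfl fun φ hφ hφ' => ?_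
  have h1 := heq φ hφ hφ'
  rw [hp.integral_μ, hp.integral_μ] at h1
  have hg := hp.contDiff_inv_w_mul_deriv hφ
  have hgc : HasCompactSupport (deriv fun z => (p.w z)⁻¹ * deriv φ z) :=
    (hφ'.deriv.mul_left).deriv
  have hφc := hφ.continuous
  have i1 : Integrable fun x => (deriv (fun z => (p.w z)⁻¹ * deriv φ z) x) • f x :=
    hfl.integrable_smul_left_of_hasCompactSupport (hg.continuous_deriv (by simp)) hgc
  have i2 : Integrable fun x => (p.w x * p.W x * φ x) • f x :=
    hfl.integrable_smul_left_of_hasCompactSupport (by fun_prop) hφ'.mul_left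
  have i3 : Integrable fun x => E * ((p.w x * φ x) • f x) :=
    (hfl.integrable_smul_left_of_hasCompactSupport (by fun_prop) hφ'.mul_left).const_mul E
  have e1 : ∀ x, p.w x • (f x * (p.schrodinger φ x : ℂ)) = (p.w x * p.W x * φ x) • f x
      - (deriv (fun z => (p.w z)⁻¹ * deriv φ z) x) • f x := fun x => by
    have := congrArg (fun r : ℝ => (r : ℂ)) (w_mul_schrodinger p φ x)
    simp only [Complex.real_smul]
    push_cast at this ⊢
    linear_combination (f x) * this
  have e2 : ∀ x, p.w x • (E * f x * (φ x : ℂ)) = E * ((p.w x * φ x) • f x) := fun x => by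
    simp only [Complex.real_smul]; push_cast; ring
  have e3 : ∀ x, φ x • (p.w x • (((p.W x : ℂ) - E) * f x))
      = (p.w x * p.W x * φ x) • f x - E * ((p.w x * φ x) • f x) := fun x => by
    simp only [Complex.real_smul]; push_cast; ring
  simp only [e1, e2] at h1
  rw [integral_sub i2 i1] at h1
  simp only [e3]
  rw [integral_sub i2 i3]
  linear_combination -h1

/-- Square integrable classical solutions of `-∂²u + W u = E u` lie in the domain. -/
lemma schrodingerGraph (hp : p.IsSubcriticalWormhole) {E : ℂ} {u v : ℝ → ℂ}
    (h : IsSol p.w (fun x => (p.W x : ℂ) - E) u v) (hu : MemLp u 2 volume) :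
    p.SchrodingerGraph u fun x => E * u x := by
  refine ⟨hp.memLp_μ_iff.2 hu, hp.memLp_μ_iff.2 (hu.const_mul E), fun φ hφ hφ' => ?_⟩
  rw [hp.integral_μ, hp.integral_μ]
  have hw := hp.contDiff_w.continuous
  have hW := hp.contDiff_W.continuous
  have hul := h.continuous_fst.locallyIntegrable (μ := (volume : Measure ℝ))
  have hvl := h.continuous_snd.locallyIntegrable (μ := (volume : Measure ℝ))
  have hg := hp.contDiff_inv_w_mul_deriv hφ
  have hgc : HasCompactSupport fun z => (p.w z)⁻¹ * deriv φ z := hφ'.deriv.mul_left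
  have hφc := hφ.continuous
  have i1 := hul.integrable_smul_left_of_hasCompactSupport (hg.continuous_deriv (by simp)) hgc.deriv
  have i2 : Integrable fun x => (p.w x * p.W x * φ x) • u x :=
    hul.integrable_smul_left_of_hasCompactSupport (by fun_prop) hφ'.mul_left
  have i3 : Integrable fun x => E * ((p.w x * φ x) • u x) :=
    (hul.integrable_smul_left_of_hasCompactSupport (by fun_prop) hφ'.mul_left).const_mul E
  have j1 := hul.integrable_smul_left_of_hasCompactSupport hg.continuous hgc
  have j2 := hvl.integrable_smul_left_of_hasCompactSupport hφc hφ'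
  -- Green's formula: this boundary expression has compact support, so the integral of its
  -- derivative is zero.
  have hder : ∀ x, HasDerivAt (fun x => ((p.w x)⁻¹ * deriv φ x) • u x - φ x • v x)
      ((deriv (fun z => (p.w z)⁻¹ * deriv φ z) x) • u x
        - ((p.w x * p.W x * φ x) • u x - E * ((p.w x * φ x) • u x))) x := fun x => by
    have d1 := ((hg.differentiable (by simp)) x).hasDerivAt
    have d2 := ((hφ.differentiable (by simp)) x).hasDerivAt
    refine ((d1.fun_smul (h.fst x)).fun_sub (d2.fun_smul (h.snd x))).congr_deriv ?_
    have hw0 : (p.w x : ℂ) ≠ 0 := by exact_mod_cast (p.w_pos x).ne'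
    simp only [Complex.real_smul]
    push_cast
    field_simp
    ring
  have key := integral_eq_zero_of_hasDerivAt_of_integrable hder (i1.sub (i2.sub i3)) (j1.sub j2)
  have i23 : Integrable fun x => (p.w x * p.W x * φ x) • u x - E * ((p.w x * φ x) • u x) :=
    i2.sub i3
  rw [integral_sub i1 i23, integral_sub i2 i3] at key
  have e1 : ∀ x, p.w x • (u x * (p.schrodinger φ x : ℂ)) = (p.w x * p.W x * φ x) • u x
      - (deriv (fun z => (p.w z)⁻¹ * deriv φ z) x) • u x := fun x => by
    have := congrArg (fun r : ℝ => (r : ℂ)) (w_mul_schrodinger p φ x)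
    simp only [Complex.real_smul]
    push_cast at this ⊢
    linear_combination (u x) * this
  have e2 : ∀ x, p.w x • (E * u x * (φ x : ℂ)) = E * ((p.w x * φ x) • u x) := fun x => by
    simp only [Complex.real_smul]; push_cast; ring
  simp only [e1, e2]
  rw [integral_sub i2 i1]
  linear_combination -key

lemma isEigenfunction (hp : p.IsSubcriticalWormhole) {E : ℂ} {u v : ℝ → ℂ}
    (h : IsSol p.w (fun x => (p.W x : ℂ) - E) u v) (hu : Integrable fun x => ‖u x‖ ^ 2)
    {x₀ : ℝ} (h0 : u x₀ ≠ 0) : p.IsEigenfunction E u := by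
  have hc := h.continuous_fst
  refine ⟨fun h' => h0 ?_, hp.schrodingerGraph h
    ((memLp_two_iff_integrable_sq_norm hc.aestronglyMeasurable).2 hu)⟩
  have h2 : u =ᵐ[volume] 0 := by
    have := h'
    rwa [Filter.EventuallyEq, hp.ae_μ] at this
  exact congrFun (hc.ae_eq_iff_eq volume continuous_zero |>.1 h2) x₀

/-! ### The zero mode -/

/-- `∂χ₀`. -/
def zeroModeDel (p : Params) (x : ℝ) : ℝ :=
  p.b * Real.exp (-p.c x) ^ 3 / p.F x
    * (1 + p.Λ ^ 2 + p.cy x * p.dy x - p.cy x ^ 2 * p.R x)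

lemma χ₀_eq (p : Params) (x : ℝ) : p.χ₀ x = Real.exp (-p.c x) / p.F x * p.cy x := by
  rw [χ₀, Real.exp_neg]
  have := (Real.exp_pos (p.c x)).ne'
  field_simp

lemma exp_neg_c_sq (hp : p.IsSubcriticalWormhole) (x : ℝ) :
    Real.exp (-p.c x) ^ 2 * ((x ^ 2 + p.b ^ 2) * p.w x) = 1 := by
  have hS := (hp.S_pos x).ne'
  have hw := (p.w_pos x).ne'
  have h : Real.exp (-p.c x) ^ 2 = Real.exp (-2 * p.c x) := by
    rw [← Real.exp_nat_mul]; push_cast; ring_nf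
  rw [h, hp.exp_neg_two_c]
  field_simp

lemma hasDerivAt_exp_neg_c (hp : p.IsSubcriticalWormhole) (x : ℝ) :
    HasDerivAt (fun x => Real.exp (-p.c x))
      (p.b / (x ^ 2 + p.b ^ 2) * (-p.cy x * Real.exp (-p.c x))) x :=
  (hp.hasDerivAt_c x).fun_neg.exp.congr_deriv (by ring)

/-- Since F_y / F = c_y R + d_y, the first derivative involves R but not T. The second brings in T
through R_y, and `R_mul_sub` turns the result into W χ₀. -/
lemma isSol_χ₀ (hp : p.IsSubcriticalWormhole) : IsSol p.w p.W p.χ₀ (zeroModeDel p) where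
  fst x := by
    have hF := (hp.F_pos x).ne'
    have hS := (hp.S_pos x).ne'
    rw [show p.χ₀ = _ from funext (χ₀_eq p)]
    refine (((hp.hasDerivAt_exp_neg_c x).fun_div (hp.hasDerivAt_F x) hF).fun_mul
      (hp.hasDerivAt_cy x)).congr_deriv ?_
    have hE := hp.exp_neg_c_sq x
    set E := Real.exp (-p.c x)
    rw [smul_eq_mul, zeroModeDel]
    have : p.b / (x ^ 2 + p.b ^ 2) = p.w x * p.b * E ^ 2 := by
      rw [div_eq_iff hS]; linear_combination -p.b * hE
    rw [this]
    field_simp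
    ring
  snd x := by
    have hF := (hp.F_pos x).ne'
    have hS := (hp.S_pos x).ne'
    have hw := (p.w_pos x).ne'
    have hb := hp.b_pos.ne'
    refine ((((hp.hasDerivAt_exp_neg_c x).fun_pow 3).const_mul p.b).fun_div (hp.hasDerivAt_F x)
      hF).fun_mul ((((hp.hasDerivAt_cy x).fun_mul (hp.hasDerivAt_dy x)).const_add
      (1 + p.Λ ^ 2)).fun_sub (((hp.hasDerivAt_cy x).fun_pow 2).fun_mul (hp.hasDerivAt_R x)))
      |>.congr_deriv ?_
    have hE := hp.exp_neg_c_sq x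
    have hT := hp.R_mul_sub x
    rw [hp.W_eq, χ₀_eq, smul_eq_mul]
    set E := Real.exp (-p.c x)
    have : p.b ^ 2 / ((x ^ 2 + p.b ^ 2) * p.w x) ^ 2 = p.b ^ 2 * E ^ 4 := by
      rw [div_eq_iff (by positivity)]
      linear_combination (-p.b ^ 2 * (E ^ 2 * ((x ^ 2 + p.b ^ 2) * p.w x) + 1)) * hE
    rw [this]
    have : p.b / (x ^ 2 + p.b ^ 2) = p.w x * p.b * E ^ 2 := by
      rw [div_eq_iff hS]; linear_combination -p.b * hE
    rw [this]
    field_simp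
    linear_combination (E ^ 5 * p.cy x) * hT

lemma hasDerivAt_w (hp : p.IsSubcriticalWormhole) (x : ℝ) :
    HasDerivAt p.w (p.b / (x ^ 2 + p.b ^ 2) * (-2 * p.dy x * p.w x)) x :=
  ((hp.hasDerivAt_d x).const_mul (-2)).exp.congr_deriv (by rw [w]; ring)

/-- The weight cancels the indefinite term 2 c_y d_y of c_yy, leaving w (1 + Λ² + c_y²). Hence c_y
changes sign exactly once, although it need not be monotone itself. -/
lemma strictMono_w_mul_cy (hp : p.IsSubcriticalWormhole) :
    StrictMono fun x => p.w x * p.cy x := by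
  have hd : ∀ x, HasDerivAt (fun x => p.w x * p.cy x)
      (p.b / (x ^ 2 + p.b ^ 2) * (p.w x * (1 + p.Λ ^ 2 + p.cy x ^ 2))) x := fun x =>
    ((hp.hasDerivAt_w x).fun_mul (hp.hasDerivAt_cy x)).congr_deriv (by ring)
  refine strictMono_of_deriv_pos fun x => ?_
  rw [(hd x).deriv]
  have := hp.S_pos x
  have := hp.b_pos
  have := p.w_pos x
  positivity

lemma exists_cy_sign (hp : p.IsSubcriticalWormhole) : ∃ x₀, p.cy x₀ = 0 ∧
    (∀ x, x₀ < x → 0 < p.cy x) ∧ ∀ x, x < x₀ → p.cy x < 0 := by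
  obtain ⟨D, hD0, hD⟩ := hp.exists_abs_dy_le
  have hb := hp.b_pos
  have h1 : 0 ≤ p.cy (p.b * D) := by
    rw [hp.cy_eq, mul_div_cancel_left₀ _ hb.ne']
    linarith [(abs_le.1 (hD (p.b * D))).2]
  have h2 : p.cy (-(p.b * D)) ≤ 0 := by
    rw [hp.cy_eq, neg_div, mul_div_cancel_left₀ _ hb.ne']
    linarith [(abs_le.1 (hD (-(p.b * D)))).1]
  have hle : -(p.b * D) ≤ p.b * D := by have := mul_nonneg hb.le hD0; linarith
  obtain ⟨x₀, -, h0⟩ := intermediate_value_Icc hle hp.contDiff_cy.continuous.continuousOn ⟨h2, h1⟩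
  have hm := hp.strictMono_w_mul_cy
  refine ⟨x₀, h0, fun x hx => ?_, fun x hx => ?_⟩
  · have := hm hx
    simp only [h0, mul_zero] at this
    exact (mul_pos_iff_of_pos_left (p.w_pos x)).1 this
  · have := hm hx
    simp only [h0, mul_zero] at this
    exact neg_of_mul_neg_right this (p.w_pos x).le

/-- χ₀² is (1 + Λ²)² (c_y/N)² e^{-2c}, where e^{-2c} decays like 1/x². Both c_y and N grow linearly,
and `le_N` bounds their quotient. -/
lemma integrable_χ₀_sq (hp : p.IsSubcriticalWormhole) : Integrable fun x => p.χ₀ x ^ 2 := by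
  obtain ⟨D, hD0, hD⟩ := hp.exists_abs_dy_le
  obtain ⟨w₀, w₁, hw0, hw⟩ := hp.exists_w_bounds
  have hb := hp.b_pos
  have hΛ := hp.subcritical
  set K := (1 + p.Λ ^ 2) ^ 2 * (4 * (2 + D) / p.Λ ^ 2) ^ 2 / w₀ with hK
  refine (integrable_div_one_add_sq (K * (1 + 1 / p.b ^ 2))).mono'
    (hp.contDiff_χ₀.continuous.pow 2).aestronglyMeasurable (Eventually.of_forall fun x => ?_)
  have hS := hp.S_pos x
  have hwx := p.w_pos x
  have hN := hp.N_pos x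
  have hF := hp.F_pos x
  have h1 : |p.cy x| / p.N x ≤ 4 * (2 + D) / p.Λ ^ 2 := by
    rw [div_le_div_iff₀ hN (by positivity)]
    have h2 : |p.cy x| ≤ (2 + D) * (1 + x / p.b * p.y x) := by
      rw [hp.cy_eq]
      have h3 := abs_le_two_mul_one_add_mul_arctan (x / p.b)
      have h4 := p.one_le_one_add_mul_y x
      have h5 := abs_sub (x / p.b) (p.dy x)
      have h6 := hD x
      have h7 : D ≤ D * (1 + x / p.b * p.y x) := le_mul_of_one_le_right hD0 h4
      have h8 : |x / p.b| ≤ 2 * (1 + x / p.b * p.y x) := h3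
      linarith
    have h3 := mul_le_mul_of_nonneg_right h2 (sq_nonneg p.Λ)
    have h4 := mul_le_mul_of_nonneg_left (hp.le_N x) (by positivity : 0 ≤ 4 * (2 + D))
    linarith
  have hE := hp.exp_neg_c_sq x
  have h2 : p.χ₀ x ^ 2 = (1 + p.Λ ^ 2) ^ 2 * (|p.cy x| / p.N x) ^ 2 / p.w x
      / (x ^ 2 + p.b ^ 2) := by
    rw [χ₀_eq, div_pow, sq_abs, hp.N_eq, mul_pow, div_pow]
    have : 1 + p.Λ ^ 2 ≠ 0 := by positivity
    field_simp
    linear_combination (p.cy x ^ 2) * hE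
  have h3 : (|p.cy x| / p.N x) ^ 2 ≤ (4 * (2 + D) / p.Λ ^ 2) ^ 2 := by
    have : 0 ≤ |p.cy x| / p.N x := by positivity
    gcongr
  rw [Real.norm_eq_abs, abs_of_nonneg (sq_nonneg _), h2]
  calc _ ≤ (1 + p.Λ ^ 2) ^ 2 * (4 * (2 + D) / p.Λ ^ 2) ^ 2 / w₀ / (x ^ 2 + p.b ^ 2) := by
        have := (hw x).1
        gcongr
    _ = K / (x ^ 2 + p.b ^ 2) := rfl
    _ ≤ _ := by
        rw [div_le_div_iff₀ hS (by positivity), mul_assoc]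
        refine mul_le_mul_of_nonneg_left ?_ (by positivity)
        have : (1 + 1 / p.b ^ 2) * (x ^ 2 + p.b ^ 2) = 1 + x ^ 2 + (p.b ^ 2 + x ^ 2 / p.b ^ 2) := by
          field_simp; ring
        rw [this]
        have : 0 ≤ p.b ^ 2 + x ^ 2 / p.b ^ 2 := by positivity
        linarith

end Params.IsSubcriticalWormhole

end

section

/-! ### Linearization of the field equations -/

lemma hasDerivAt_exp_linear_mul {E e q' : ℝ} {q : ℝ → ℝ} (hq : HasDerivAt q q' 0) :
    HasDerivAt (fun l => Real.exp (E + l * e) * q l) (Real.exp E * (e * q 0 + q')) 0 := by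
  have h1 : HasDerivAt (fun l : ℝ => E + l * e) e 0 := by
    simpa using ((hasDerivAt_id (0 : ℝ)).mul_const e).const_add E
  refine (h1.exp.fun_mul hq).congr_deriv ?_
  simp
  ring

/-- Linearization in `l` of `∂ (e^{E + l e} (g + l h))`. -/
lemma hasDerivAt_deriv_exp_linear_mul {E e g h : ℝ → ℝ} {E' e' g' h' z : ℝ}
    (hE : HasDerivAt E E' z) (he : HasDerivAt e e' z) (hg : HasDerivAt g g' z)
    (hh : HasDerivAt h h' z) :
    HasDerivAt (fun l => deriv (fun y => Real.exp (E y + l * e y) * (g y + l * h y)) z)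
      (Real.exp (E z) * (e z * (E' * g z + g') + (e' * g z + E' * h z + h'))) 0 := by
  have h1 : ∀ l : ℝ, deriv (fun y => Real.exp (E y + l * e y) * (g y + l * h y)) z
      = Real.exp (E z + l * e z) * ((E' + l * e') * (g z + l * h z) + (g' + l * h')) := fun l => by
    rw [((hE.fun_add (he.const_mul l)).exp.fun_mul (hg.fun_add (hh.const_mul l))).deriv]
    ring
  simp only [h1]
  have lin : ∀ a a' : ℝ, HasDerivAt (fun l : ℝ => a + l * a') a' 0 := fun a a' => by
    simpa using ((hasDerivAt_id (0 : ℝ)).mul_const a').const_add a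
  refine (hasDerivAt_exp_linear_mul
    (((lin E' e').fun_mul (lin (g z) (h z))).fun_add (lin g' h'))).congr_deriv ?_
  simp

section
variable {f : ℝ → ℝ → ℝ}

lemma contDiff_slice_snd (hf : ContDiff ℝ ∞ (Function.uncurry f)) (t : ℝ) :
    ContDiff ℝ ∞ (f t) :=
  hf.comp (contDiff_const.prodMk contDiff_id)

lemma contDiff_slice_fst (hf : ContDiff ℝ ∞ (Function.uncurry f)) (x : ℝ) :
    ContDiff ℝ ∞ fun s => f s x :=
  hf.comp (contDiff_id.prodMk contDiff_const)

lemma hasDerivAt_Dx (hf : ContDiff ℝ ∞ (Function.uncurry f)) (t x : ℝ) :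
    HasDerivAt (f t) (Dx f t x) x :=
  ((contDiff_slice_snd hf t).differentiable (by simp) x).hasDerivAt

lemma hasDerivAt_Dt (hf : ContDiff ℝ ∞ (Function.uncurry f)) (t x : ℝ) :
    HasDerivAt (fun s => f s x) (Dt f t x) t :=
  ((contDiff_slice_fst hf x).differentiable (by simp) t).hasDerivAt

lemma hasDerivAt_Dx_Dx (hf : ContDiff ℝ ∞ (Function.uncurry f)) (t x : ℝ) :
    HasDerivAt (Dx f t) (Dx (Dx f) t x) x :=
  ((contDiff_infty_iff_deriv.1 (contDiff_slice_snd hf t)).2.differentiable (by simp) x).hasDerivAt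

lemma hasDerivAt_Dt_Dt (hf : ContDiff ℝ ∞ (Function.uncurry f)) (t x : ℝ) :
    HasDerivAt (fun s => Dt f s x) (Dt (Dt f) t x) t :=
  ((contDiff_infty_iff_deriv.1 (contDiff_slice_fst hf x)).2.differentiable (by simp) t).hasDerivAt

end

lemma Dt_add_mul (g : ℝ → ℝ) (f : ℝ → ℝ → ℝ) (l t x : ℝ) :
    Dt (fun t x => g x + l * f t x) t x = l * Dt f t x := by
  simp [Dt]

lemma Dx_add_mul {g : ℝ → ℝ} {f : ℝ → ℝ → ℝ} (hg : ContDiff ℝ ∞ g)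
    (hf : ContDiff ℝ ∞ (Function.uncurry f)) (l t x : ℝ) :
    Dx (fun t x => g x + l * f t x) t x = deriv g x + l * Dx f t x :=
  ((hg.differentiable (by simp) x).hasDerivAt.fun_add ((hasDerivAt_Dx hf t x).const_mul l)).deriv

lemma contDiff_hasDerivAt {g : ℝ → ℝ} (hg : ContDiff ℝ ∞ g) (x : ℝ) : HasDerivAt g (deriv g x) x :=
  (hg.differentiable (by simp) x).hasDerivAt

lemma contDiff_hasDerivAt_deriv {g : ℝ → ℝ} (hg : ContDiff ℝ ∞ g) (x : ℝ) :
    HasDerivAt (deriv g) (deriv (deriv g) x) x :=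
  contDiff_hasDerivAt (contDiff_infty_iff_deriv.1 hg).2 x

lemma hasDerivAt_add_mul (a a' : ℝ) : HasDerivAt (fun l : ℝ => a + l * a') a' 0 := by
  simpa using ((hasDerivAt_id (0 : ℝ)).mul_const a').const_add a

namespace Params.IsSubcriticalWormhole

variable {p : Params}

lemma contDiff_Φ (p : Params) : ContDiff ℝ ∞ p.Φ := contDiff_const.mul contDiff_y

variable {δ : Fields}

lemma hasDerivAt_momentum (hp : p.IsSubcriticalWormhole) (hδ : δ.Smooth) (t x : ℝ) :
    HasDerivAt (fun l => p.momentum (p.background.perturb δ l) t x)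
      (2 * Dt (Dx δ.c) t x + 2 * deriv p.c x * Dt δ.c t x - 2 * deriv p.d x * Dt δ.c t x
        - 2 * deriv p.c x * Dt δ.a t x + p.κ * deriv p.Φ x * Dt δ.Φ t x) 0 := by
  obtain ⟨hd, -, hc, hΦ⟩ := hδ
  have e : ∀ l, p.momentum (p.background.perturb δ l) t x
      = 2 * (0 + l * Dt (Dx δ.c) t x) + 2 * (0 + l * Dt δ.c t x) * (deriv p.c x + l * Dx δ.c t x)
        - 2 * (deriv p.d x + l * Dx δ.d t x) * (0 + l * Dt δ.c t x)
        - 2 * (0 + l * Dt δ.a t x) * (deriv p.c x + l * Dx δ.c t x)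
        + p.κ * ((0 + l * Dt δ.Φ t x) * (deriv p.Φ x + l * Dx δ.Φ t x)) := fun l => by
    have h1 : Dx (fun t x => p.c x + l * δ.c t x) = fun t x => deriv p.c x + l * Dx δ.c t x :=
      funext₂ (Dx_add_mul hp.contDiff_c hc l)
    simp only [momentum, Fields.perturb, background, Dt_add_mul, h1,
      Dx_add_mul hp.contDiff_d hd, Dx_add_mul (contDiff_Φ p) hΦ]
    ring
  simp only [e]
  have L := hasDerivAt_add_mul
  refine (((((L _ _).const_mul 2).fun_add (((L _ _).const_mul 2).fun_mul (L _ _))).fun_sub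
    (((L _ _).const_mul 2).fun_mul (L _ _))).fun_sub
    (((L _ _).const_mul 2).fun_mul (L _ _))).fun_add
    (((L _ _).fun_mul (L _ _)).const_mul _) |>.congr_deriv ?_
  simp
  ring

lemma hasDerivAt_evolutionΦ (hp : p.IsSubcriticalWormhole) (hδ : δ.Smooth) (t x : ℝ) :
    HasDerivAt (fun l => evolutionΦ (p.background.perturb δ l) t x)
      (Real.exp (2 * p.c x - 2 * p.d x) * Dt (Dt δ.Φ) t x
        - Real.exp (2 * p.c x + 2 * p.d x) *
          ((δ.d t x - δ.a t x + 2 * δ.c t x)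
              * (2 * (deriv p.c x + deriv p.d x) * deriv p.Φ x + deriv (deriv p.Φ) x)
            + ((Dx δ.d t x - Dx δ.a t x + 2 * Dx δ.c t x) * deriv p.Φ x
              + 2 * (deriv p.c x + deriv p.d x) * Dx δ.Φ t x + Dx (Dx δ.Φ) t x))) 0 := by
  obtain ⟨hd, ha, hc, hΦ⟩ := hδ
  have k1 := hasDerivAt_deriv_exp_linear_mul
    (hasDerivAt_const t (2 * p.c x - 2 * p.d x))
    (((hasDerivAt_Dt ha t x).fun_sub (hasDerivAt_Dt hd t x)).fun_add
      ((hasDerivAt_Dt hc t x).const_mul 2))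
    (hasDerivAt_const t (0 : ℝ)) (hasDerivAt_Dt_Dt hΦ t x)
  have k2 := hasDerivAt_deriv_exp_linear_mul
    (((contDiff_hasDerivAt hp.contDiff_c x).const_mul 2).fun_add
      ((contDiff_hasDerivAt hp.contDiff_d x).const_mul 2))
    (((hasDerivAt_Dx hd t x).fun_sub (hasDerivAt_Dx ha t x)).fun_add
      ((hasDerivAt_Dx hc t x).const_mul 2))
    (contDiff_hasDerivAt_deriv (contDiff_Φ p) x) (hasDerivAt_Dx_Dx hΦ t x)
  refine ((k1.fun_sub k2).congr_of_eventuallyEq (Eventually.of_forall fun l => ?_)).congr_deriv ?_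
  · simp only [evolutionΦ, Fields.perturb, background, Dt_add_mul, Dx_add_mul (contDiff_Φ p) hΦ]
    simp only [Dt, Dx, a]
    congr 3 <;> funext y <;> congr 2 <;> ring
  · ring

lemma hasDerivAt_evolutionC (hp : p.IsSubcriticalWormhole) (hδ : δ.Smooth) (t x : ℝ) :
    HasDerivAt (fun l => p.evolutionC (p.background.perturb δ l) t x)
      (Real.exp (2 * p.c x - 2 * p.d x) * Dt (Dt δ.c) t x
        - Real.exp (2 * p.c x + 2 * p.d x) *
          ((δ.d t x - δ.a t x + 2 * δ.c t x)
              * (2 * (deriv p.c x + deriv p.d x) * deriv p.c x + deriv (deriv p.c) x)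
            + ((Dx δ.d t x - Dx δ.a t x + 2 * Dx δ.c t x) * deriv p.c x
              + 2 * (deriv p.c x + deriv p.d x) * Dx δ.c t x + Dx (Dx δ.c) t x))
        + (δ.a t x + δ.d t x) - p.κ₀ / 2 * p.Qsq * Real.exp (-2 * p.c x)
          * (δ.a t x + δ.d t x - 2 * δ.c t x)) 0 := by
  obtain ⟨hd, ha, hc, hΦ⟩ := hδ
  have k1 := hasDerivAt_deriv_exp_linear_mul
    (hasDerivAt_const t (2 * p.c x - 2 * p.d x))
    (((hasDerivAt_Dt ha t x).fun_sub (hasDerivAt_Dt hd t x)).fun_add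
      ((hasDerivAt_Dt hc t x).const_mul 2))
    (hasDerivAt_const t (0 : ℝ)) (hasDerivAt_Dt_Dt hc t x)
  have k2 := hasDerivAt_deriv_exp_linear_mul
    (((contDiff_hasDerivAt hp.contDiff_c x).const_mul 2).fun_add
      ((contDiff_hasDerivAt hp.contDiff_d x).const_mul 2))
    (((hasDerivAt_Dx hd t x).fun_sub (hasDerivAt_Dx ha t x)).fun_add
      ((hasDerivAt_Dx hc t x).const_mul 2))
    (contDiff_hasDerivAt_deriv hp.contDiff_c x) (hasDerivAt_Dx_Dx hc t x)
  have k3 := hasDerivAt_exp_linear_mul (E := 0) (e := δ.a t x + δ.d t x)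
    (hasDerivAt_const (0 : ℝ) (1 : ℝ))
  have k4 := hasDerivAt_exp_linear_mul (E := -2 * p.c x) (e := δ.a t x + δ.d t x - 2 * δ.c t x)
    (hasDerivAt_const (0 : ℝ) (p.κ₀ / 2 * p.Qsq))
  refine ((((k1.fun_sub k2).fun_add k3).fun_sub k4).congr_of_eventuallyEq
    (Eventually.of_forall fun l => ?_)).congr_deriv ?_
  · simp only [evolutionC, Fields.perturb, background, Dt_add_mul, Dx_add_mul hp.contDiff_c hc]
    simp only [Dt, Dx, a, mul_one]
    rw [mul_comm (p.κ₀ / 2 * p.Qsq)]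
    congr 1
    · congr 1
      · congr 3 <;> funext y <;> congr 2 <;> ring
      · congr 1; ring
    · congr 2; ring
  · simp only [Real.exp_zero]; ring

lemma hasDerivAt_hamiltonian (hp : p.IsSubcriticalWormhole) (hδ : δ.Smooth) (t x : ℝ) :
    HasDerivAt (fun l => p.hamiltonian (p.background.perturb δ l) t x)
      (Real.exp (2 * p.d x) * ((δ.d t x - δ.a t x)
          * (2 * deriv (deriv p.c) x + (3 * deriv p.c x + 2 * deriv p.d x) * deriv p.c x)
          + (2 * Dx (Dx δ.c) t x + (3 * Dx δ.c t x - 2 * Dx δ.a t x) * deriv p.c x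
            + (3 * deriv p.c x + 2 * deriv p.d x) * Dx δ.c t x))
        - Real.exp (-2 * p.c x) * (δ.a t x + δ.d t x - 2 * δ.c t x)
        + p.κ₀ / 2 * p.Qsq * Real.exp (-4 * p.c x) * (δ.a t x + δ.d t x - 4 * δ.c t x)
        + p.κ / 2 * (Real.exp (2 * p.d x) * ((δ.d t x - δ.a t x) * deriv p.Φ x ^ 2
          + 2 * deriv p.Φ x * Dx δ.Φ t x))) 0 := by
  obtain ⟨hd, ha, hc, hΦ⟩ := hδ
  have L := hasDerivAt_add_mul
  have k1 := hasDerivAt_exp_linear_mul (E := 2 * p.d x) (e := δ.d t x - δ.a t x)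
    (((L (deriv (deriv p.c) x) (Dx (Dx δ.c) t x)).const_mul 2).fun_add
      ((((L (deriv p.c x) (Dx δ.c t x)).const_mul 3).fun_sub
        ((L (-deriv p.d x) (Dx δ.a t x)).const_mul 2)).fun_mul (L (deriv p.c x) (Dx δ.c t x))))
  have k2 := hasDerivAt_exp_linear_mul (E := -(2 * p.d x)) (e := δ.a t x - δ.d t x)
    ((L 0 (Dt δ.c t x)).fun_mul (((L 0 (Dt δ.a t x)).const_mul 2).fun_add (L 0 (Dt δ.c t x))))
  have k3 := hasDerivAt_exp_linear_mul (E := -2 * p.c x) (e := δ.a t x + δ.d t x - 2 * δ.c t x)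
    (hasDerivAt_const (0 : ℝ) (1 : ℝ))
  have k4 := hasDerivAt_exp_linear_mul (E := -4 * p.c x) (e := δ.a t x + δ.d t x - 4 * δ.c t x)
    (hasDerivAt_const (0 : ℝ) (p.κ₀ / 2 * p.Qsq))
  have k5 := hasDerivAt_exp_linear_mul (E := -(2 * p.d x)) (e := δ.a t x - δ.d t x)
    ((L 0 (Dt δ.Φ t x)).fun_pow 2)
  have k6 := hasDerivAt_exp_linear_mul (E := 2 * p.d x) (e := δ.d t x - δ.a t x)
    ((L (deriv p.Φ x) (Dx δ.Φ t x)).fun_pow 2)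
  refine (((((k1.fun_sub k2).fun_sub k3).fun_add k4).fun_add
    ((k5.fun_add k6).const_mul (p.κ / 2))).congr_of_eventuallyEq
    (Eventually.of_forall fun l => ?_)).congr_deriv ?_
  · have h1 : Dx (fun t x => p.c x + l * δ.c t x) = fun t x => deriv p.c x + l * Dx δ.c t x :=
      funext₂ (Dx_add_mul hp.contDiff_c hc l)
    have h2 : Dx (fun t x => deriv p.c x + l * Dx δ.c t x) t x
        = deriv (deriv p.c) x + l * Dx (Dx δ.c) t x :=
      ((contDiff_hasDerivAt_deriv hp.contDiff_c x).fun_add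
        ((hasDerivAt_Dx_Dx hc t x).const_mul l)).deriv
    have h3 : deriv p.a x = -deriv p.d x := (contDiff_hasDerivAt hp.contDiff_d x).fun_neg.deriv
    have hpa : ContDiff ℝ ∞ p.a := hp.contDiff_d.neg
    simp only [hamiltonian, Fields.perturb, background, Dt_add_mul, h1, h2,
      Dx_add_mul hpa ha, Dx_add_mul (contDiff_Φ p) hΦ, h3]
    have e1 : p.d x + l * δ.d t x - (p.a x + l * δ.a t x)
      = 2 * p.d x + l * (δ.d t x - δ.a t x) := by rw [a]; ring
    have e2 : p.a x + l * δ.a t x - (p.d x + l * δ.d t x)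
      = -(2 * p.d x) + l * (δ.a t x - δ.d t x) := by rw [a]; ring
    have e3 : p.a x + l * δ.a t x + (p.d x + l * δ.d t x) - 2 * (p.c x + l * δ.c t x)
      = -2 * p.c x + l * (δ.a t x + δ.d t x - 2 * δ.c t x) := by rw [a]; ring
    have e4 : p.a x + l * δ.a t x + (p.d x + l * δ.d t x) - 4 * (p.c x + l * δ.c t x)
      = -4 * p.c x + l * (δ.a t x + δ.d t x - 4 * δ.c t x) := by rw [a]; ring
    rw [e1, e2, e3, e4]
    ring
  · simp
    ring

lemma hasDerivAt_evolutionA (hp : p.IsSubcriticalWormhole) (hδ : δ.Smooth) (t x : ℝ) :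
    HasDerivAt (fun l => p.evolutionA (p.background.perturb δ l) t x)
      (Real.exp (-(2 * p.d x)) * Dt (Dt δ.a) t x
        - Real.exp (2 * p.d x) * ((δ.d t x - δ.a t x)
            * (2 * deriv p.d x * deriv p.d x + deriv (deriv p.d) x)
          + ((Dx δ.d t x - Dx δ.a t x) * deriv p.d x + 2 * deriv p.d x * Dx δ.d t x
            + Dx (Dx δ.d) t x))
        + Real.exp (2 * p.d x) * ((δ.d t x - δ.a t x) * deriv p.c x ^ 2
          + 2 * deriv p.c x * Dx δ.c t x)
        - Real.exp (-2 * p.c x) * (δ.a t x + δ.d t x - 2 * δ.c t x)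
        + p.κ₀ * p.Qsq * Real.exp (-4 * p.c x) * (δ.a t x + δ.d t x - 4 * δ.c t x)
        - p.κ / 2 * (Real.exp (2 * p.d x) * ((δ.d t x - δ.a t x) * deriv p.Φ x ^ 2
          + 2 * deriv p.Φ x * Dx δ.Φ t x))) 0 := by
  obtain ⟨hd, ha, hc, hΦ⟩ := hδ
  have L := hasDerivAt_add_mul
  have k1 := hasDerivAt_deriv_exp_linear_mul
    (hasDerivAt_const t (-(2 * p.d x)))
    ((hasDerivAt_Dt ha t x).fun_sub (hasDerivAt_Dt hd t x))
    (hasDerivAt_const t (0 : ℝ)) (hasDerivAt_Dt_Dt ha t x)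
  have k2 := hasDerivAt_deriv_exp_linear_mul
    ((contDiff_hasDerivAt hp.contDiff_d x).const_mul 2)
    ((hasDerivAt_Dx hd t x).fun_sub (hasDerivAt_Dx ha t x))
    (contDiff_hasDerivAt_deriv hp.contDiff_d x) (hasDerivAt_Dx_Dx hd t x)
  have k3 := hasDerivAt_exp_linear_mul (E := -(2 * p.d x)) (e := δ.a t x - δ.d t x)
    ((L 0 (Dt δ.c t x)).fun_pow 2)
  have k4 := hasDerivAt_exp_linear_mul (E := 2 * p.d x) (e := δ.d t x - δ.a t x)
    ((L (deriv p.c x) (Dx δ.c t x)).fun_pow 2)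
  have k5 := hasDerivAt_exp_linear_mul (E := -2 * p.c x) (e := δ.a t x + δ.d t x - 2 * δ.c t x)
    (hasDerivAt_const (0 : ℝ) (1 : ℝ))
  have k6 := hasDerivAt_exp_linear_mul (E := -4 * p.c x) (e := δ.a t x + δ.d t x - 4 * δ.c t x)
    (hasDerivAt_const (0 : ℝ) (p.κ₀ * p.Qsq))
  have k7 := hasDerivAt_exp_linear_mul (E := -(2 * p.d x)) (e := δ.a t x - δ.d t x)
    ((L 0 (Dt δ.Φ t x)).fun_pow 2)
  have k8 := hasDerivAt_exp_linear_mul (E := 2 * p.d x) (e := δ.d t x - δ.a t x)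
    ((L (deriv p.Φ x) (Dx δ.Φ t x)).fun_pow 2)
  refine (((((((k1.fun_sub k2).fun_sub k3).fun_add k4).fun_sub k5).fun_add k6).fun_add
    ((k7.fun_sub k8).const_mul (p.κ / 2))).congr_of_eventuallyEq
    (Eventually.of_forall fun l => ?_)).congr_deriv ?_
  · have e1 : ∀ t x, p.d x + l * δ.d t x - (p.a x + l * δ.a t x)
      = 2 * p.d x + l * (δ.d t x - δ.a t x) := fun t x => by rw [a]; ring
    have e2 : ∀ t x, p.a x + l * δ.a t x - (p.d x + l * δ.d t x)
      = -(2 * p.d x) + l * (δ.a t x - δ.d t x) := fun t x => by rw [a]; ring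
    have e3 : p.a x + l * δ.a t x + (p.d x + l * δ.d t x) - 2 * (p.c x + l * δ.c t x)
      = -2 * p.c x + l * (δ.a t x + δ.d t x - 2 * δ.c t x) := by rw [a]; ring
    have e4 : p.a x + l * δ.a t x + (p.d x + l * δ.d t x) - 4 * (p.c x + l * δ.c t x)
      = -4 * p.c x + l * (δ.a t x + δ.d t x - 4 * δ.c t x) := by rw [a]; ring
    simp only [evolutionA, Fields.perturb, background, Dt_add_mul, Dx_add_mul hp.contDiff_c hc,
      Dx_add_mul hp.contDiff_d hd, Dx_add_mul (contDiff_Φ p) hΦ, e1, e2, e3, e4, zero_add]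
    simp only [Dt, Dx]
    ring
  · simp
    ring

end Params.IsSubcriticalWormhole

end

/-! ### Reconstruction of the perturbation from the master variable -/

namespace Params

/-- The bracket in the potential `W = b² e^{-4c} U`. -/
def U (p : Params) (x : ℝ) : ℝ :=
  -3 * (1 + p.Λ ^ 2) + 2 * p.dy x * (p.dy x - p.cy x)
    - 4 * p.R x * (p.cy x * p.dy x + 1 + p.Λ ^ 2) + 2 * p.cy x ^ 2 * p.R x ^ 2

/-- The coefficient of `χ` in the first-order system. -/
def B (p : Params) (x : ℝ) : ℝ := p.R x * p.cy x ^ 2 - p.cy x * p.dy x - 1 - p.Λ ^ 2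

/-- The function `e^{4c} / b²`. -/
def ρ (p : Params) (x : ℝ) : ℝ := ((x ^ 2 + p.b ^ 2) * p.w x / p.b) ^ 2

namespace IsSubcriticalWormhole

variable {p : Params}

lemma ρ_pos (hp : p.IsSubcriticalWormhole) (x : ℝ) : 0 < p.ρ x := by
  have := hp.S_pos x
  have := hp.b_pos
  have := p.w_pos x
  unfold ρ
  positivity

lemma W_mul_ρ (hp : p.IsSubcriticalWormhole) (x : ℝ) : p.W x * p.ρ x = p.U x := by
  have := (hp.S_pos x).ne'
  have := hp.b_pos.ne'
  have := (p.w_pos x).ne'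
  rw [hp.W_eq, ρ, U]
  field_simp

lemma hasDerivAt_S_mul_w (hp : p.IsSubcriticalWormhole) (x : ℝ) :
    HasDerivAt (fun x => (x ^ 2 + p.b ^ 2) * p.w x / p.b)
      (p.b / (x ^ 2 + p.b ^ 2) * (2 * p.cy x * ((x ^ 2 + p.b ^ 2) * p.w x / p.b))) x := by
  have hS := (hp.S_pos x).ne'
  have hb := hp.b_pos.ne'
  refine ((((hasDerivAt_pow 2 x).add_const (p.b ^ 2)).fun_mul (hp.hasDerivAt_w x)).div_const
    p.b).congr_deriv ?_
  rw [hp.cy_eq]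
  field_simp
  ring

lemma hasDerivAt_ρ (hp : p.IsSubcriticalWormhole) (x : ℝ) :
    HasDerivAt p.ρ (p.b / (x ^ 2 + p.b ^ 2) * (4 * p.cy x * p.ρ x)) x :=
  ((hp.hasDerivAt_S_mul_w x).fun_pow 2).congr_deriv (by rw [ρ]; ring)

/-- The term −c_y U cancels the potential produced by ∂²ψ when c_y ψ_y + B ψ is differentiated; the
other terms make that derivative a multiple of the expression itself plus β² ρ c_y ψ. -/
lemma hasDerivAt_B (hp : p.IsSubcriticalWormhole) (x : ℝ) :
    HasDerivAt p.B (p.b / (x ^ 2 + p.b ^ 2) *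
      ((3 * p.cy x + p.cy x * p.R x + p.dy x) * p.B x - p.cy x * p.U x)) x := by
  have hT := hp.R_mul_sub x
  refine ((((hp.hasDerivAt_R x).fun_mul ((hp.hasDerivAt_cy x).fun_pow 2)).fun_sub
    ((hp.hasDerivAt_cy x).fun_mul (hp.hasDerivAt_dy x))).sub_const 1).sub_const
    (p.Λ ^ 2) |>.congr_deriv ?_
  rw [B, U]
  linear_combination (-p.b / (x ^ 2 + p.b ^ 2) * p.cy x) * hT

lemma hasDerivAt_weight (hp : p.IsSubcriticalWormhole) (x : ℝ) :
    HasDerivAt (fun x => p.b / (x ^ 2 + p.b ^ 2))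
      (-(p.b / (x ^ 2 + p.b ^ 2)) ^ 2 * (2 * (x / p.b))) x := by
  have hS := (hp.S_pos x).ne'
  have hb := hp.b_pos.ne'
  refine ((hasDerivAt_const x p.b).fun_div ((hasDerivAt_pow 2 x).add_const (p.b ^ 2)) hS)
    |>.congr_deriv ?_
  field_simp
  ring

lemma deriv_deriv_eq (hp : p.IsSubcriticalWormhole) {E : Type*} [NormedAddCommGroup E]
    [NormedSpace ℝ E] {f f₁ : ℝ → E} {f₂ : E} {x : ℝ}
    (h : ∀ x, HasDerivAt f ((p.b / (x ^ 2 + p.b ^ 2)) • f₁ x) x)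
    (h₁ : HasDerivAt f₁ ((p.b / (x ^ 2 + p.b ^ 2)) • f₂) x) :
    deriv (deriv f) x
      = (p.b / (x ^ 2 + p.b ^ 2)) ^ 2 • (f₂ - (2 * (x / p.b)) • f₁ x) := by
  rw [show deriv f = _ from funext fun x => (h x).deriv, ((hp.hasDerivAt_weight x).fun_smul h₁).deriv]
  module

lemma deriv_c (hp : p.IsSubcriticalWormhole) (x : ℝ) :
    deriv p.c x = p.b / (x ^ 2 + p.b ^ 2) * p.cy x := (hp.hasDerivAt_c x).deriv

lemma deriv_d (hp : p.IsSubcriticalWormhole) (x : ℝ) :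
    deriv p.d x = p.b / (x ^ 2 + p.b ^ 2) * p.dy x := (hp.hasDerivAt_d x).deriv

lemma hasDerivAt_Φ (hp : p.IsSubcriticalWormhole) (x : ℝ) :
    HasDerivAt p.Φ (p.b / (x ^ 2 + p.b ^ 2) * p.Φ₁) x :=
  ((hp.hasDerivAt_y x).const_mul p.Φ₁).congr_deriv (by ring)

lemma deriv_Φ (hp : p.IsSubcriticalWormhole) (x : ℝ) :
    deriv p.Φ x = p.b / (x ^ 2 + p.b ^ 2) * p.Φ₁ := (hp.hasDerivAt_Φ x).deriv

lemma deriv_deriv_c (hp : p.IsSubcriticalWormhole) (x : ℝ) : deriv (deriv p.c) x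
    = (p.b / (x ^ 2 + p.b ^ 2)) ^ 2 * (1 + p.Λ ^ 2 - p.cy x ^ 2) := by
  rw [hp.deriv_deriv_eq hp.hasDerivAt_c (hp.hasDerivAt_cy x), smul_eq_mul, smul_eq_mul, hp.cy_eq]
  ring

lemma deriv_deriv_d (hp : p.IsSubcriticalWormhole) (x : ℝ) : deriv (deriv p.d) x
    = (p.b / (x ^ 2 + p.b ^ 2)) ^ 2 * (p.dy x ^ 2 - p.Λ ^ 2 - 2 * (x / p.b) * p.dy x) := by
  rw [hp.deriv_deriv_eq hp.hasDerivAt_d (hp.hasDerivAt_dy x), smul_eq_mul, smul_eq_mul]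

lemma deriv_deriv_Φ (hp : p.IsSubcriticalWormhole) (x : ℝ) : deriv (deriv p.Φ) x
    = (p.b / (x ^ 2 + p.b ^ 2)) ^ 2 * (-(2 * (x / p.b) * p.Φ₁)) := by
  rw [hp.deriv_deriv_eq (f₁ := fun _ => p.Φ₁) (f₂ := 0) hp.hasDerivAt_Φ
    ((hasDerivAt_const x p.Φ₁).congr_deriv (by simp)), smul_eq_mul, smul_eq_mul]
  ring

lemma hasDerivAt_exp_c (hp : p.IsSubcriticalWormhole) (x : ℝ) :
    HasDerivAt (fun x => Real.exp (p.c x))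
      (p.b / (x ^ 2 + p.b ^ 2) * (p.cy x * Real.exp (p.c x))) x :=
  (hp.hasDerivAt_c x).exp.congr_deriv (by ring)

end IsSubcriticalWormhole

/-- The amplitude `u₂` reconstructed from a solution `ψ` of the master equation, `π = ∂ψ`. -/
def ampU₂ (p : Params) (β : ℝ) (ψ π : ℝ → ℝ) (x : ℝ) : ℝ :=
  (p.cy x * ((x ^ 2 + p.b ^ 2) * p.w x / p.b * π x) + p.B x * ψ x) / (β ^ 2 * p.ρ x)

/-- The amplitude `C` reconstructed from a solution of the master equation. -/
def ampC (p : Params) (β : ℝ) (ψ π : ℝ → ℝ) (x : ℝ) : ℝ := Real.exp (p.c x) * p.ampU₂ β ψ π x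

/-- The amplitude `A - C` reconstructed from a solution of the master equation. -/
def ampAC (p : Params) (β : ℝ) (ψ π : ℝ → ℝ) (x : ℝ) : ℝ :=
  Real.exp (p.c x) * (ψ x + p.R x * p.ampU₂ β ψ π x)

/-- The `y`-derivative of `A - C`. -/
def ampACy (p : Params) (β : ℝ) (ψ π : ℝ → ℝ) (x : ℝ) : ℝ :=
  Real.exp (p.c x) * ((x ^ 2 + p.b ^ 2) * p.w x / p.b * π x + p.cy x * (1 + p.R x) * ψ x
    + (p.cy x * p.R x + p.T x + p.R x * p.dy x) * p.ampU₂ β ψ π x)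

lemma IsSubcriticalWormhole.mul_ampU₂ {p : Params} (hp : p.IsSubcriticalWormhole) {β : ℝ}
    (hβ : 0 < β) (ψ π : ℝ → ℝ) (x : ℝ) : β ^ 2 * p.ρ x * p.ampU₂ β ψ π x
    = p.cy x * ((x ^ 2 + p.b ^ 2) * p.w x / p.b * π x) + p.B x * ψ x := by
  have := hp.ρ_pos x
  rw [ampU₂, mul_div_cancel₀ _ (by positivity)]

end Params

section Reconstruction

variable {p : Params} {β : ℝ} {ψ π : ℝ → ℝ}

lemma IsSol.hasDerivAt_fst_y (hp : p.IsSubcriticalWormhole)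
    (h : IsSol p.w (fun x => p.W x + β ^ 2) ψ π) (x : ℝ) : HasDerivAt ψ
    (p.b / (x ^ 2 + p.b ^ 2) * ((x ^ 2 + p.b ^ 2) * p.w x / p.b * π x)) x := by
  have hS := (hp.S_pos x).ne'
  have hb := hp.b_pos.ne'
  refine (h.fst x).congr_deriv ?_
  rw [smul_eq_mul]
  field_simp

lemma IsSol.hasDerivAt_snd_y (hp : p.IsSubcriticalWormhole)
    (h : IsSol p.w (fun x => p.W x + β ^ 2) ψ π) (x : ℝ) :
    HasDerivAt (fun x => (x ^ 2 + p.b ^ 2) * p.w x / p.b * π x)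
      (p.b / (x ^ 2 + p.b ^ 2) * ((p.U x + β ^ 2 * p.ρ x) * ψ x
        + 2 * p.cy x * ((x ^ 2 + p.b ^ 2) * p.w x / p.b * π x))) x := by
  have hS := (hp.S_pos x).ne'
  have hb := hp.b_pos.ne'
  refine ((hp.hasDerivAt_S_mul_w x).fun_mul (h.snd x)).congr_deriv ?_
  rw [← hp.W_mul_ρ, smul_eq_mul, Params.ρ]
  field_simp
  ring

lemma IsSol.hasDerivAt_ampU₂ (hp : p.IsSubcriticalWormhole)
    (h : IsSol p.w (fun x => p.W x + β ^ 2) ψ π) (hβ : 0 < β) (x : ℝ) : HasDerivAt (p.ampU₂ β ψ π)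
    (p.b / (x ^ 2 + p.b ^ 2) * (p.cy x * ψ x
      + (p.cy x * p.R x - p.cy x + p.dy x) * p.ampU₂ β ψ π x)) x := by
  have hρ := (hp.ρ_pos x).ne'
  refine (((hp.hasDerivAt_cy x).fun_mul (h.hasDerivAt_snd_y hp x)).fun_add
    ((hp.hasDerivAt_B x).fun_mul (h.hasDerivAt_fst_y hp x))).fun_div
    ((hp.hasDerivAt_ρ x).const_mul (β ^ 2)) (by positivity) |>.congr_deriv ?_
  have h1 := hp.mul_ampU₂ hβ ψ π x
  rw [div_eq_iff (by positivity)]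
  have hB : p.B x = p.R x * p.cy x ^ 2 - p.cy x * p.dy x - 1 - p.Λ ^ 2 := rfl
  linear_combination (-(p.b / (x ^ 2 + p.b ^ 2)) * (β ^ 2 * p.ρ x)
    * (p.cy x * p.R x - p.cy x + p.dy x)) * h1 + (p.b / (x ^ 2 + p.b ^ 2) * (β ^ 2 * p.ρ x)
    * ((x ^ 2 + p.b ^ 2) * p.w x / p.b * π x)) * hB

/-- This is the linearized momentum constraint at δΦ = 0 after division by β. It holds because ψ + R
u₂ is u₁ and the factor e^c absorbs the term −c_y u₂. -/
lemma IsSol.hasDerivAt_ampC (hp : p.IsSubcriticalWormhole)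
    (h : IsSol p.w (fun x => p.W x + β ^ 2) ψ π) (hβ : 0 < β) (x : ℝ) : HasDerivAt (p.ampC β ψ π)
    (p.b / (x ^ 2 + p.b ^ 2) * (p.cy x * p.ampAC β ψ π x + p.dy x * p.ampC β ψ π x)) x := by
  refine ((hp.hasDerivAt_exp_c x).fun_mul (h.hasDerivAt_ampU₂ hp hβ x)).congr_deriv ?_
  rw [Params.ampC, Params.ampAC]
  ring

lemma IsSol.hasDerivAt_ampAC (hp : p.IsSubcriticalWormhole)
    (h : IsSol p.w (fun x => p.W x + β ^ 2) ψ π) (hβ : 0 < β) (x : ℝ) : HasDerivAt (p.ampAC β ψ π)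
    (p.b / (x ^ 2 + p.b ^ 2) * p.ampACy β ψ π x) x := by
  refine ((hp.hasDerivAt_exp_c x).fun_mul ((h.hasDerivAt_fst_y hp x).fun_add
    ((hp.hasDerivAt_R x).fun_mul (h.hasDerivAt_ampU₂ hp hβ x)))).congr_deriv ?_
  rw [Params.ampACy]
  ring

lemma IsSol.hasDerivAt_ampACy (hp : p.IsSubcriticalWormhole)
    (h : IsSol p.w (fun x => p.W x + β ^ 2) ψ π) (hβ : 0 < β) (x : ℝ) : HasDerivAt (p.ampACy β ψ π)
    (p.b / (x ^ 2 + p.b ^ 2) * (p.cy x * p.ampACy β ψ π x + Real.exp (p.c x) *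
      ((p.U x + β ^ 2 * p.ρ x) * ψ x
        + p.cy x * (3 + p.R x) * ((x ^ 2 + p.b ^ 2) * p.w x / p.b * π x)
        + ((1 + p.Λ ^ 2 + p.cy x ^ 2 + 2 * p.cy x * p.dy x) * (1 + p.R x)
          + p.cy x * (-p.cy x * p.R x ^ 2 + p.cy x * p.R x + p.T x)) * ψ x
        + ((1 + p.Λ ^ 2 + p.cy x ^ 2 + 2 * p.cy x * p.dy x) * p.R x
          + (p.cy x + p.dy x) * (-p.cy x * p.R x ^ 2 + p.cy x * p.R x + p.T x)
          + ((1 + p.Λ ^ 2) * p.R x * (1 - p.R x) - p.cy x * p.T x - 2 * p.dy x * p.T x)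
          + p.R x * (p.dy x ^ 2 - p.Λ ^ 2)) * p.ampU₂ β ψ π x
        + (p.cy x * p.R x + p.T x + p.R x * p.dy x) * (p.cy x * ψ x
          + (p.cy x * p.R x - p.cy x + p.dy x) * p.ampU₂ β ψ π x)))) x := by
  refine ((hp.hasDerivAt_exp_c x).fun_mul (((h.hasDerivAt_snd_y hp x).fun_add
    (((hp.hasDerivAt_cy x).fun_mul ((hp.hasDerivAt_R x).const_add 1)).fun_mul
      (h.hasDerivAt_fst_y hp x))).fun_add
    ((((hp.hasDerivAt_cy x).fun_mul (hp.hasDerivAt_R x)).fun_add (hp.hasDerivAt_T x)).fun_add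
      ((hp.hasDerivAt_R x).fun_mul (hp.hasDerivAt_dy x)) |>.fun_mul
      (h.hasDerivAt_ampU₂ hp hβ x)))).congr_deriv ?_
  rw [Params.ampACy]
  ring

lemma IsSol.contDiff_amplitudes (hp : p.IsSubcriticalWormhole)
    (h : IsSol p.w (fun x => p.W x + β ^ 2) ψ π) (hβ : 0 < β) :
    ContDiff ℝ ∞ (p.ampC β ψ π) ∧ ContDiff ℝ ∞ (p.ampAC β ψ π) := by
  have hw := hp.contDiff_w
  have hW := hp.contDiff_W
  have hc := hp.contDiff_c
  have hR := hp.contDiff_R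
  have hγ := hp.contDiff_cy
  have hδ := hp.contDiff_dy
  obtain ⟨h1, h2⟩ := h.contDiff hw (by fun_prop)
  have hB : ContDiff ℝ ∞ p.B := by unfold Params.B; fun_prop
  have hρ : ContDiff ℝ ∞ p.ρ := by unfold Params.ρ; fun_prop
  have hu : ContDiff ℝ ∞ (p.ampU₂ β ψ π) := by
    refine ContDiff.div (by fun_prop) (by fun_prop) fun x => ?_
    have := hp.ρ_pos x
    positivity
  have he : ContDiff ℝ ∞ fun x => Real.exp (p.c x) := hc.exp
  exact ⟨he.mul hu, he.mul (h1.add (hR.mul hu))⟩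

end Reconstruction

section

/-! ### The growing mode of the linearized field equations -/

section ExponentialGrowth

variable {β : ℝ} {g : ℝ → ℝ}

lemma Dt_exp_mul (β : ℝ) (g : ℝ → ℝ) :
    Dt (fun t x => Real.exp (β * t) * g x) = fun t x => Real.exp (β * t) * (β * g x) := by
  funext t x
  have h1 : HasDerivAt (fun t : ℝ => β * t) β t := by
    simpa using (hasDerivAt_id t).const_mul β
  rw [Dt, (h1.exp.mul_const (g x)).deriv]
  ring

lemma Dx_exp_mul (β : ℝ) (g : ℝ → ℝ) :
    Dx (fun t x => Real.exp (β * t) * g x) = fun t x => Real.exp (β * t) * deriv g x := by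
  funext t x
  simp [Dx]

lemma contDiff_exp_mul (hg : ContDiff ℝ ∞ g) :
    ContDiff ℝ ∞ (Function.uncurry fun t x => Real.exp (β * t) * g x) := by
  have : ContDiff ℝ ∞ fun z : ℝ × ℝ => Real.exp (β * z.1) * g z.2 :=
    (contDiff_const.mul contDiff_fst).exp.mul (hg.comp contDiff_snd)
  exact this

end ExponentialGrowth

variable {p : Params}

lemma IsSol.isLinearizedSolution (hp : p.IsSubcriticalWormhole) {β : ℝ} (hβ : 0 < β) {ψ π : ℝ → ℝ}
    (h : IsSol p.w (fun x => p.W x + β ^ 2) ψ π) :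
    p.IsLinearizedSolution
      { d := fun t x => Real.exp (β * t) * (p.ampC β ψ π x + p.ampAC β ψ π x - 2 * p.ampC β ψ π x)
        a := fun t x => Real.exp (β * t) * (p.ampC β ψ π x + p.ampAC β ψ π x)
        c := fun t x => Real.exp (β * t) * p.ampC β ψ π x
        Φ := fun _ _ => 0 } := by
  obtain ⟨sC, sAC⟩ := h.contDiff_amplitudes hp hβ
  have hsm : Fields.Smooth
      { d := fun t x => Real.exp (β * t) * (p.ampC β ψ π x + p.ampAC β ψ π x - 2 * p.ampC β ψ π x)
        a := fun t x => Real.exp (β * t) * (p.ampC β ψ π x + p.ampAC β ψ π x)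
        c := fun t x => Real.exp (β * t) * p.ampC β ψ π x
        Φ := fun _ _ => 0 } :=
    ⟨contDiff_exp_mul (by fun_prop), contDiff_exp_mul (by fun_prop), contDiff_exp_mul sC,
      contDiff_const⟩
  refine ⟨hsm, fun t x => ?_⟩
  have dC := h.hasDerivAt_ampC hp hβ
  have dV := h.hasDerivAt_ampAC hp hβ
  have dV1 := h.hasDerivAt_ampACy hp hβ x
  have dC1 : HasDerivAt (fun x => p.cy x * p.ampAC β ψ π x + p.dy x * p.ampC β ψ π x)
      (p.b / (x ^ 2 + p.b ^ 2) *
        ((1 + p.Λ ^ 2 + p.cy x ^ 2 + 2 * p.cy x * p.dy x) * p.ampAC β ψ π x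
          + p.cy x * p.ampACy β ψ π x + (p.dy x ^ 2 - p.Λ ^ 2) * p.ampC β ψ π x
          + p.dy x * (p.cy x * p.ampAC β ψ π x + p.dy x * p.ampC β ψ π x))) x :=
    (((hp.hasDerivAt_cy x).fun_mul (dV x)).fun_add
      ((hp.hasDerivAt_dy x).fun_mul (dC x))).congr_deriv (by ring)
  have xC := (dC x).deriv
  have xA := ((dC x).fun_add (dV x)).deriv
  have xD := (((dC x).fun_add (dV x)).fun_sub ((dC x).const_mul 2)).deriv
  have xxC := hp.deriv_deriv_eq dC dC1
  have xxV := hp.deriv_deriv_eq dV dV1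
  have xxD : deriv (deriv fun x => p.ampC β ψ π x + p.ampAC β ψ π x - 2 * p.ampC β ψ π x) x
      = deriv (deriv (p.ampAC β ψ π)) x - deriv (deriv (p.ampC β ψ π)) x := by
    have e1 : (deriv fun x => p.ampC β ψ π x + p.ampAC β ψ π x - 2 * p.ampC β ψ π x)
        = fun x => deriv (p.ampAC β ψ π) x - deriv (p.ampC β ψ π) x := by
      funext x
      rw [(((dC x).fun_add (dV x)).fun_sub ((dC x).const_mul 2)).deriv, (dC x).deriv,
        (dV x).deriv]
      ring
    rw [e1]
    exact ((contDiff_hasDerivAt_deriv sAC x).fun_sub (contDiff_hasDerivAt_deriv sC x)).deriv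
  rw [xxV, xxC] at xxD
  have hu := hp.mul_ampU₂ hβ ψ π x
  have hT := hp.R_mul_sub x
  have hκ : p.κ * p.Φ₁ ^ 2 = -(2 * (1 + p.Λ ^ 2)) := by linarith [hp.scalar]
  have hQ := hp.κ₀_mul_Qsq x
  have hX : x / p.b = p.cy x + p.dy x := by rw [hp.cy_eq]; ring
  have hb := hp.b_pos.ne'
  have hw := (p.w_pos x).ne'
  have hS : x ^ 2 + p.b ^ 2 = p.b ^ 2 * (1 + (p.cy x + p.dy x) ^ 2) := by
    rw [← hX]; field_simp
    ring
  have hX2 : 1 + (p.cy x + p.dy x) ^ 2 ≠ 0 := by positivity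
  have ew : Real.exp (2 * p.d x) = 1 / p.w x := by
    rw [Params.w, one_div, ← Real.exp_neg]; ring_nf
  have ew' : Real.exp (-(2 * p.d x)) = p.w x := by rw [Params.w]; ring_nf
  have ecd : Real.exp (2 * p.c x + 2 * p.d x) = x ^ 2 + p.b ^ 2 := by
    rw [Real.exp_add, hp.exp_two_c, ew, ← Params.w]; field_simp
  have ecd' : Real.exp (2 * p.c x - 2 * p.d x) = (x ^ 2 + p.b ^ 2) * p.w x ^ 2 := by
    rw [sub_eq_add_neg, Real.exp_add, hp.exp_two_c, ew', ← Params.w]; ring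
  have hC : p.ampC β ψ π x = Real.exp (p.c x) * p.ampU₂ β ψ π x := rfl
  have hV : p.ampAC β ψ π x = Real.exp (p.c x) * (ψ x + p.R x * p.ampU₂ β ψ π x) := rfl
  have hV1 : p.ampACy β ψ π x = Real.exp (p.c x) * ((x ^ 2 + p.b ^ 2) * p.w x / p.b * π x
    + p.cy x * (1 + p.R x) * ψ x
    + (p.cy x * p.R x + p.T x + p.R x * p.dy x) * p.ampU₂ β ψ π x) := rfl
  clear dC1 dV1 xxV
  set ψ₁ := (x ^ 2 + p.b ^ 2) * p.w x / p.b * π x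
  have hρ : p.ρ x = (p.b * (1 + (p.cy x + p.dy x) ^ 2) * p.w x) ^ 2 := by
    rw [Params.ρ, hS]; field_simp
  rw [hρ, Params.B] at hu
  rw [Params.U, hρ] at xxD
  have hQ' : p.κ₀ / 2 * p.Qsq = p.b ^ 2 * (p.dy x ^ 2 - p.Λ ^ 2) * p.w x := by linarith
  -- The charge is expressed through d_y² − Λ². What remains is algebra modulo the definition of u₂
  -- (`hu`), the relation `hT` and the scalar condition `hκ`.
  refine ⟨(hp.hasDerivAt_evolutionA hsm t x).congr_deriv ?_,
    (hp.hasDerivAt_evolutionC hsm t x).congr_deriv ?_,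
    (hp.hasDerivAt_evolutionΦ hsm t x).congr_deriv ?_,
    (hp.hasDerivAt_hamiltonian hsm t x).congr_deriv ?_,
    (hp.hasDerivAt_momentum hsm t x).congr_deriv ?_⟩
  clear_value ψ₁
  · clear dC dV sC sAC xxC
    simp only [Dt_exp_mul, Dx_exp_mul, xC, xA, xD, xxD, hp.deriv_c, hp.deriv_d, hp.deriv_Φ,
      hp.deriv_deriv_d, hp.exp_neg_two_c, hp.exp_neg_four_c, ew, ew', smul_eq_mul, hQ]
    simp only [Dx, deriv_const, mul_zero, add_zero, hV1, hC, hV, hX, hS]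
    generalize ψ x = u at *
    generalize p.ampU₂ β ψ π x = u₂ at *
    generalize p.cy x = γ at *
    generalize p.dy x = δ at *
    generalize p.R x = R at *
    generalize p.T x = T at *
    generalize p.w x = w at *
    field_simp
    linear_combination (Real.exp (β * t) * Real.exp (p.c x)) * (2 * (1 + R) * hu + (4 * u + (2 * R - 6) * u₂) * hT + 2 * u₂ * hκ)
  · simp only [Dt_exp_mul, Dx_exp_mul, xC, xA, xD, xxC, hp.deriv_c, hp.deriv_d,
      hp.deriv_deriv_c, hp.exp_neg_two_c, ecd, ecd', smul_eq_mul, hQ']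
    simp only [hV1, hC, hV, hX, hS]
    generalize ψ x = u at *
    generalize p.ampU₂ β ψ π x = u₂ at *
    generalize p.cy x = γ at *
    generalize p.dy x = δ at *
    generalize p.R x = R at *
    generalize p.T x = T at *
    generalize p.w x = w at *
    field_simp
    linear_combination (Real.exp (β * t) * Real.exp (p.c x)) * (hu + u₂ * hT)
  -- The choice δd = δa − 2δc, with δΦ = 0, makes every term of the linearized wave equation vanish.
  · simp only [Dx_exp_mul, xC, xA, xD]
    have h0 : Dx (fun _ _ => (0 : ℝ)) = fun _ _ => 0 := by funext t x; simp [Dx]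
    simp only [h0]
    simp only [Dt, deriv_const]
    ring
  · simp only [Dx_exp_mul, xC, xA, xxC, hp.deriv_c, hp.deriv_d, hp.deriv_Φ,
      hp.deriv_deriv_c, hp.exp_neg_two_c, hp.exp_neg_four_c, ew, smul_eq_mul, hQ']
    simp only [Dx, deriv_const, mul_zero, add_zero, hV1, hC, hV, hX, hS]
    generalize ψ x = u at *
    generalize p.ampU₂ β ψ π x = u₂ at *
    generalize p.cy x = γ at *
    generalize p.dy x = δ at *
    generalize p.R x = R at *
    generalize p.T x = T at *
    generalize p.w x = w at *
    field_simp
    linear_combination (-2 * (Real.exp (β * t) * Real.exp (p.c x)) * u₂) * hκ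
  · simp only [Dt_exp_mul, Dx_exp_mul, xC]
    rw [hp.deriv_c, hp.deriv_d]
    simp only [Dt, deriv_const]
    ring

end

section

/-! ### Complex modes -/

lemma HasDerivAt.complex_re {g : ℝ → ℂ} {g' : ℂ} {x : ℝ} (h : HasDerivAt g g' x) :
    HasDerivAt (fun x => (g x).re) g'.re x :=
  Complex.reCLM.hasFDerivAt.comp_hasDerivAt x h

lemma Dt_mode (s z : ℂ) (g : ℝ → ℂ) :
    Dt (fun t x : ℝ => (z * Complex.exp (s * t) * g x).re)
      = fun t x : ℝ => (z * s * Complex.exp (s * t) * g x).re := by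
  funext t x
  have h1 : HasDerivAt (fun t : ℝ => s * (t : ℂ)) s t := by
    simpa using (Complex.ofRealCLM.hasDerivAt (x := t)).const_mul s
  refine (HasDerivAt.complex_re (((h1.cexp.const_mul z).mul_const (g x)))).deriv.trans ?_
  ring_nf

lemma Dx_mode (s z : ℂ) {g : ℝ → ℂ} (hg : ContDiff ℝ ∞ g) :
    Dx (fun t x : ℝ => (z * Complex.exp (s * t) * g x).re)
      = fun t x : ℝ => (z * Complex.exp (s * t) * deriv g x).re := by
  funext t x
  exact (HasDerivAt.complex_re
    (((hg.differentiable (by simp)) x).hasDerivAt.const_mul (z * Complex.exp (s * t)))).deriv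

lemma contDiff_of_contDiff_mode {s : ℂ} {g : ℝ → ℂ} (h : ∀ z : ℂ, ContDiff ℝ ∞
    (Function.uncurry fun t x : ℝ => (z * Complex.exp (s * t) * g x).re)) : ContDiff ℝ ∞ g := by
  have h1 := contDiff_slice_snd (h 1) 0
  have h2 := contDiff_slice_snd (h (-Complex.I)) 0
  simp only [Complex.ofReal_zero, mul_zero, Complex.exp_zero, mul_one, one_mul] at h1 h2
  have h3 : g = fun x => ((g x).re : ℂ) + ((-Complex.I * g x).re : ℂ) * Complex.I := by
    funext x
    simp [Complex.re_add_im]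
  rw [h3]
  exact (Complex.ofRealCLM.contDiff.comp h1).add
    ((Complex.ofRealCLM.contDiff.comp h2).mul contDiff_const)

/-- The phases z = 1 and z = −i recover one complex equation from the real equations satisfied by
all Re (z e^{st} P). -/
lemma eq_zero_of_forall_re {w : ℂ} (h : ∀ z : ℂ, (z * w).re = 0) : w = 0 := by
  have h1 := h 1
  have h2 := h (-Complex.I)
  simp at h1 h2
  exact Complex.ext h1 h2

lemma contDiff_hasDerivAt_complex {g : ℝ → ℂ} (hg : ContDiff ℝ ∞ g) (x : ℝ) :
    HasDerivAt g (deriv g x) x := (hg.differentiable (by simp) x).hasDerivAt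

namespace Params

variable {p : Params}

namespace IsMode

variable {s : ℂ} {P : Profile}

lemma contDiff (h : p.IsMode s P) : ContDiff ℝ ∞ P.d ∧ ContDiff ℝ ∞ P.a ∧ ContDiff ℝ ∞ P.c ∧
    ContDiff ℝ ∞ P.Φ :=
  ⟨contDiff_of_contDiff_mode fun z => (h z).1.1, contDiff_of_contDiff_mode fun z => (h z).1.2.1,
    contDiff_of_contDiff_mode fun z => (h z).1.2.2.1,
    contDiff_of_contDiff_mode fun z => (h z).1.2.2.2⟩

lemma momentum_eq (h : p.IsMode s P) (hp : p.IsSubcriticalWormhole) (x : ℝ) :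
    s * (2 * deriv P.c x + 2 * (deriv p.c x : ℝ) * P.c x - 2 * (deriv p.d x : ℝ) * P.c x
      - 2 * (deriv p.c x : ℝ) * P.a x + (p.κ * deriv p.Φ x : ℝ) * P.Φ x) = 0 := by
  obtain ⟨-, -, sc, -⟩ := h.contDiff
  refine eq_zero_of_forall_re fun z => ?_
  have h1 := (hp.hasDerivAt_momentum (h z).1 0 x).unique ((h z).2 0 x).2.2.2.2
  simp only [Profile.mode, Dx_mode s _ sc, Dt_mode, Complex.ofReal_zero, mul_zero,
    Complex.exp_zero, mul_one] at h1
  simp only [Complex.mul_re, Complex.mul_im, Complex.add_re, Complex.sub_re, Complex.add_im,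
    Complex.sub_im, Complex.ofReal_re, Complex.ofReal_im, Complex.re_ofNat, Complex.im_ofNat] at h1 ⊢
  linear_combination h1

lemma evolutionΦ_eq (h : p.IsMode s P) (hp : p.IsSubcriticalWormhole) (x : ℝ) :
    (Real.exp (2 * p.c x - 2 * p.d x) : ℝ) * (s ^ 2 * P.Φ x)
      - (Real.exp (2 * p.c x + 2 * p.d x) : ℝ) *
          ((2 * (deriv p.c x + deriv p.d x) * deriv p.Φ x + deriv (deriv p.Φ) x : ℝ)
              * (P.d x - P.a x + 2 * P.c x)
            + ((deriv p.Φ x : ℝ) * (deriv P.d x - deriv P.a x + 2 * deriv P.c x)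
              + (2 * (deriv p.c x + deriv p.d x) : ℝ) * deriv P.Φ x + deriv (deriv P.Φ) x)) = 0 := by
  obtain ⟨sd, sa, sc, sΦ⟩ := h.contDiff
  refine eq_zero_of_forall_re fun z => ?_
  have h1 := (hp.hasDerivAt_evolutionΦ (h z).1 0 x).unique ((h z).2 0 x).2.2.1
  simp only [Profile.mode, Dx_mode s _ sd, Dx_mode s _ sa, Dx_mode s _ sc, Dx_mode s _ sΦ,
    Dx_mode s _ (contDiff_infty_iff_deriv.1 sΦ).2, Dt_mode, Complex.ofReal_zero, mul_zero,
    Complex.exp_zero, mul_one] at h1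
  simp only [sq, Complex.mul_re, Complex.mul_im, Complex.add_re, Complex.sub_re, Complex.add_im,
    Complex.sub_im, Complex.ofReal_re, Complex.ofReal_im, Complex.re_ofNat, Complex.im_ofNat] at h1 ⊢
  linear_combination h1

lemma evolutionC_eq (h : p.IsMode s P) (hp : p.IsSubcriticalWormhole) (x : ℝ) :
    (Real.exp (2 * p.c x - 2 * p.d x) : ℝ) * (s ^ 2 * P.c x)
      - (Real.exp (2 * p.c x + 2 * p.d x) : ℝ) *
          ((2 * (deriv p.c x + deriv p.d x) * deriv p.c x + deriv (deriv p.c) x : ℝ)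
              * (P.d x - P.a x + 2 * P.c x)
            + ((deriv p.c x : ℝ) * (deriv P.d x - deriv P.a x + 2 * deriv P.c x)
              + (2 * (deriv p.c x + deriv p.d x) : ℝ) * deriv P.c x + deriv (deriv P.c) x))
      + (P.a x + P.d x) - (p.κ₀ / 2 * p.Qsq * Real.exp (-2 * p.c x) : ℝ)
          * (P.a x + P.d x - 2 * P.c x) = 0 := by
  obtain ⟨sd, sa, sc, sΦ⟩ := h.contDiff
  refine eq_zero_of_forall_re fun z => ?_
  have h1 := (hp.hasDerivAt_evolutionC (h z).1 0 x).unique ((h z).2 0 x).2.1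
  simp only [Profile.mode, Dx_mode s _ sd, Dx_mode s _ sa, Dx_mode s _ sc,
    Dx_mode s _ (contDiff_infty_iff_deriv.1 sc).2, Dt_mode, Complex.ofReal_zero, mul_zero,
    Complex.exp_zero, mul_one] at h1
  simp only [sq, Complex.mul_re, Complex.mul_im, Complex.add_re, Complex.sub_re, Complex.add_im,
    Complex.sub_im, Complex.ofReal_re, Complex.ofReal_im, Complex.re_ofNat, Complex.im_ofNat] at h1 ⊢
  linear_combination h1

end IsMode

end Params

end

/-! ### Gauge-invariant amplitudes of a mode -/

namespace Params

variable {p : Params}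

/-- The weight `b / (x² + b²)` in `∂_x = b / (x² + b²) ∂_y`. -/
def σ (p : Params) (x : ℝ) : ℝ := p.b / (x ^ 2 + p.b ^ 2)

/-- The displacement `δΦ / Φ_x`. -/
def shift (p : Params) (P : Profile) (x : ℝ) : ℂ := P.Φ x / ((p.σ x * p.Φ₁ : ℝ) : ℂ)

namespace IsSubcriticalWormhole

lemma σ_pos (hp : p.IsSubcriticalWormhole) (x : ℝ) : 0 < p.σ x := div_pos hp.b_pos (hp.S_pos x)

lemma Φ₁_ne_zero (hp : p.IsSubcriticalWormhole) : p.Φ₁ ≠ 0 := fun h => by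
  have h1 := hp.scalar
  rw [h] at h1
  nlinarith [sq_nonneg p.Λ]

lemma contDiff_σ (hp : p.IsSubcriticalWormhole) : ContDiff ℝ ∞ p.σ :=
  ContDiff.div (by fun_prop) (by fun_prop) fun x => (hp.S_pos x).ne'

lemma hasDerivAt_σ (hp : p.IsSubcriticalWormhole) (x : ℝ) :
    HasDerivAt p.σ (-p.σ x ^ 2 * (2 * (x / p.b))) x := hp.hasDerivAt_weight x

lemma contDiff_shift (hp : p.IsSubcriticalWormhole) {P : Profile} (hP : ContDiff ℝ ∞ P.Φ) :
    ContDiff ℝ ∞ (p.shift P) := by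
  have h : ContDiff ℝ ∞ fun x => (((p.σ x * p.Φ₁)⁻¹ : ℝ) : ℂ) :=
    Complex.ofRealCLM.contDiff.comp ((hp.contDiff_σ.mul contDiff_const).inv
      fun x => mul_ne_zero (hp.σ_pos x).ne' hp.Φ₁_ne_zero)
  have e : p.shift P = fun x => P.Φ x * (((p.σ x * p.Φ₁)⁻¹ : ℝ) : ℂ) := funext fun x => by
    rw [shift, Complex.ofReal_inv, div_eq_mul_inv]
  rw [e]
  exact hP.mul h

lemma Φ_eq_shift (hp : p.IsSubcriticalWormhole) (P : Profile) (x : ℝ) :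
    P.Φ x = p.Φ₁ * (p.σ x * p.shift P x) := by
  have h1 : (p.σ x : ℂ) ≠ 0 := by exact_mod_cast (hp.σ_pos x).ne'
  have h2 : (p.Φ₁ : ℂ) ≠ 0 := by exact_mod_cast hp.Φ₁_ne_zero
  rw [shift]
  push_cast
  field_simp

lemma deriv_profileΦ (hp : p.IsSubcriticalWormhole) {P : Profile} (hP : ContDiff ℝ ∞ P.Φ) (x : ℝ) :
    deriv P.Φ x = p.Φ₁ * (p.σ x * deriv (p.shift P) x
      - 2 * (x / p.b) * p.σ x ^ 2 * p.shift P x) := by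
  have hξ := hp.contDiff_shift hP
  rw [show P.Φ = _ from funext (hp.Φ_eq_shift P)]
  rw [(((hp.hasDerivAt_σ x).ofReal_comp.fun_mul (contDiff_hasDerivAt_complex hξ x)).const_mul
    (p.Φ₁ : ℂ)).deriv]
  push_cast
  ring

lemma deriv_deriv_profileΦ (hp : p.IsSubcriticalWormhole) {P : Profile} (hP : ContDiff ℝ ∞ P.Φ)
    (x : ℝ) : deriv (deriv P.Φ) x = p.Φ₁ * (p.σ x * deriv (deriv (p.shift P)) x
      - 4 * (x / p.b) * p.σ x ^ 2 * deriv (p.shift P) x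
      + (8 * (x / p.b) ^ 2 * p.σ x ^ 3 - 2 / p.b * p.σ x ^ 2) * p.shift P x) := by
  have hξ := hp.contDiff_shift hP
  have hσ := (hp.hasDerivAt_σ x).ofReal_comp
  have hX : HasDerivAt (fun x : ℝ => (x : ℂ) / (p.b : ℂ)) (1 / p.b) x :=
    (Complex.ofRealCLM.hasDerivAt (x := x)).div_const _
  rw [show deriv P.Φ = _ from funext (hp.deriv_profileΦ hP)]
  rw [(((hσ.fun_mul (contDiff_hasDerivAt_complex (contDiff_infty_iff_deriv.1 hξ).2 x)).fun_sub
    (((hX.const_mul 2).fun_mul (hσ.fun_pow 2)).fun_mul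
      (contDiff_hasDerivAt_complex hξ x))).const_mul (p.Φ₁ : ℂ)).deriv]
  push_cast
  ring

lemma gaugeC_eq (hp : p.IsSubcriticalWormhole) (P : Profile) (x : ℝ) :
    p.gaugeC P x = P.c x - p.σ x * p.cy x * p.shift P x := by
  rw [gaugeC, hp.deriv_c, hp.deriv_Φ, shift, σ, mul_div_assoc]
  push_cast
  ring

lemma gaugeA_eq (hp : p.IsSubcriticalWormhole) {P : Profile} (hP : ContDiff ℝ ∞ P.Φ) (x : ℝ) :
    p.gaugeA P x = P.a x - deriv (p.shift P) x + p.σ x * p.dy x * p.shift P x := by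
  have hξ := hp.contDiff_shift hP
  have e : (fun z : ℝ => (Real.exp (p.a z) : ℂ) * P.Φ z / ((deriv p.Φ z : ℝ) : ℂ))
      = fun z => (Real.exp (p.a z) : ℂ) * p.shift P z := by
    funext z
    rw [hp.deriv_Φ, shift, mul_div_assoc]
    rfl
  have ha : HasDerivAt p.a (-(p.σ x * p.dy x)) x := (hp.hasDerivAt_d x).fun_neg
  rw [gaugeA, e, (ha.exp.ofReal_comp.fun_mul (contDiff_hasDerivAt_complex hξ x)).deriv]
  have h1 : (Real.exp (-p.a x) : ℂ) * (Real.exp (p.a x) : ℂ) = 1 := by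
    rw [← Complex.ofReal_mul, ← Real.exp_add]; simp
  push_cast at h1 ⊢
  linear_combination (p.σ x * p.dy x * p.shift P x - deriv (p.shift P) x) * h1

end IsSubcriticalWormhole

namespace IsMode

variable {s : ℂ} {P : Profile}

/-- Each term of the momentum constraint carries one time derivative, so on a mode it is s times a
spatial equation and s ≠ 0 can be divided out. The scalar condition evaluates κ Φ₁². -/
lemma deriv_c_eq (h : p.IsMode s P) (hp : p.IsSubcriticalWormhole) (hs : s ≠ 0) (x : ℝ) :
    deriv P.c x = p.σ x * p.cy x * (P.a x - P.c x) + p.σ x * p.dy x * P.c x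
      + (1 + p.Λ ^ 2) * p.σ x ^ 2 * p.shift P x := by
  have h1 := (mul_eq_zero.1 (h.momentum_eq hp x)).resolve_left hs
  have hκ : (p.κ * p.Φ₁ ^ 2 : ℂ) = -(2 * (1 + p.Λ ^ 2)) := by
    have : p.κ * p.Φ₁ ^ 2 = -(2 * (1 + p.Λ ^ 2)) := by linarith [hp.scalar]
    exact_mod_cast this
  rw [hp.deriv_c, hp.deriv_d, hp.deriv_Φ, ← σ, hp.Φ_eq_shift] at h1
  push_cast at h1
  linear_combination (1 / 2 : ℂ) * h1 - (1 / 2 : ℂ) * p.σ x ^ 2 * p.shift P x * hκ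

lemma deriv_deriv_c_eq (h : p.IsMode s P) (hp : p.IsSubcriticalWormhole) (hs : s ≠ 0) (x : ℝ) :
    deriv (deriv P.c) x = p.σ x ^ 2 * (1 + p.Λ ^ 2 - p.cy x ^ 2) * (P.a x - P.c x)
      + p.σ x * p.cy x * (deriv P.a x - deriv P.c x)
      + p.σ x ^ 2 * (p.dy x ^ 2 - p.Λ ^ 2 - 2 * (p.cy x + p.dy x) * p.dy x) * P.c x
      + p.σ x * p.dy x * deriv P.c x
      + (1 + p.Λ ^ 2) * (p.σ x ^ 2 * deriv (p.shift P) x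
        - 4 * (p.cy x + p.dy x) * p.σ x ^ 3 * p.shift P x) := by
  obtain ⟨-, sa, sc, sΦ⟩ := h.contDiff
  have hσ := (hp.hasDerivAt_σ x).ofReal_comp
  have hγ := (hp.hasDerivAt_cy x).ofReal_comp
  have hδ := (hp.hasDerivAt_dy x).ofReal_comp
  rw [← σ] at hγ hδ
  have ha := contDiff_hasDerivAt_complex sa x
  have hc := contDiff_hasDerivAt_complex sc x
  have hξ := contDiff_hasDerivAt_complex (hp.contDiff_shift sΦ) x
  have hX : (x / p.b : ℂ) = p.cy x + p.dy x := by
    have : x / p.b = p.cy x + p.dy x := by rw [hp.cy_eq]; ring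
    exact_mod_cast this
  have key := ((((hσ.fun_mul hγ).fun_mul (ha.fun_sub hc)).fun_add ((hσ.fun_mul hδ).fun_mul hc)).fun_add
    (((hσ.fun_pow 2).const_mul (1 + (p.Λ : ℂ) ^ 2)).fun_mul hξ)).deriv
  rw [(congrArg (deriv · x) (funext (h.deriv_c_eq hp hs))).trans key]
  push_cast
  rw [hX]
  ring

lemma cast_facts (hp : p.IsSubcriticalWormhole) (x : ℝ) :
    (x / p.b : ℂ) = p.cy x + p.dy x ∧
      (p.b : ℂ) * p.σ x * (1 + ((p.cy x : ℂ) + p.dy x) ^ 2) = 1 ∧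
      Real.exp (2 * p.c x - 2 * p.d x) = p.b / p.σ x * p.w x ^ 2 ∧
      Real.exp (2 * p.c x + 2 * p.d x) = p.b / p.σ x ∧
      p.κ₀ / 2 * p.Qsq * Real.exp (-2 * p.c x)
        = p.b * p.σ x * (p.dy x ^ 2 - p.Λ ^ 2) := by
  have hX : x / p.b = p.cy x + p.dy x := by rw [hp.cy_eq]; ring
  have hb := hp.b_pos.ne'
  have hw := (p.w_pos x).ne'
  have hS := (hp.S_pos x).ne'
  have ew : Real.exp (2 * p.d x) = 1 / p.w x := by
    rw [w, one_div, ← Real.exp_neg]; ring_nf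
  have ew' : Real.exp (-(2 * p.d x)) = p.w x := by rw [w]; ring_nf
  refine ⟨by exact_mod_cast hX, ?_, ?_, ?_, ?_⟩
  · have : p.b * p.σ x * (1 + (p.cy x + p.dy x) ^ 2) = 1 := by
      rw [← hX, σ]; field_simp; ring
    exact_mod_cast this
  · rw [sub_eq_add_neg, Real.exp_add, hp.exp_two_c, ew', ← w, σ]; field_simp
  · rw [Real.exp_add, hp.exp_two_c, ew, ← w, σ]; field_simp
  · rw [div_mul_eq_mul_div, hp.κ₀_mul_Qsq x, hp.exp_neg_two_c, σ]; field_simp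

lemma shift_eq (h : p.IsMode s P) (hp : p.IsSubcriticalWormhole) (x : ℝ) :
    (p.w x : ℂ) ^ 2 * s ^ 2 * p.shift P x = deriv P.d x - deriv P.a x + 2 * deriv P.c x
      + deriv (deriv (p.shift P)) x - 2 * (p.cy x + p.dy x) * p.σ x * deriv (p.shift P) x
      + p.σ x ^ 2 * (2 * (p.cy x + p.dy x) ^ 2 - 2) * p.shift P x := by
  have hP := h.contDiff.2.2.2
  have h1 := h.evolutionΦ_eq hp x
  obtain ⟨hX, hY, e1, e2, -⟩ := cast_facts hp x
  rw [e1, e2, hp.deriv_deriv_profileΦ hP, hp.deriv_profileΦ hP, hp.Φ_eq_shift P x, hp.deriv_c,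
    hp.deriv_d, hp.deriv_deriv_Φ, hp.deriv_Φ, ← σ] at h1
  have hb : (p.b : ℂ) ≠ 0 := by exact_mod_cast hp.b_pos.ne'
  have hσ : (p.σ x : ℂ) ≠ 0 := by exact_mod_cast (hp.σ_pos x).ne'
  have hΦ : (p.Φ₁ : ℂ) ≠ 0 := by exact_mod_cast hp.Φ₁_ne_zero
  push_cast at h1
  rw [hX] at h1
  have hb' : (2 : ℂ) / p.b = 2 * p.σ x * (1 + ((p.cy x : ℂ) + p.dy x) ^ 2) := by
    rw [div_eq_iff hb]; linear_combination -2 * hY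
  rw [hb'] at h1
  field_simp at h1
  linear_combination (mul_eq_zero.1 h1).resolve_left (mul_ne_zero hb hΦ)

lemma c_eq (h : p.IsMode s P) (hp : p.IsSubcriticalWormhole) (x : ℝ) :
    (p.w x : ℂ) ^ 2 * s ^ 2 * P.c x = p.σ x ^ 2 * (2 * (p.cy x + p.dy x) * p.cy x + 1 + p.Λ ^ 2
        - p.cy x ^ 2) * (P.d x - P.a x + 2 * P.c x)
      + p.σ x * p.cy x * (deriv P.d x - deriv P.a x + 2 * deriv P.c x)
      + 2 * p.σ x * (p.cy x + p.dy x) * deriv P.c x + deriv (deriv P.c) x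
      - p.σ x ^ 2 * ((1 + (p.cy x + p.dy x) ^ 2) * (P.a x + P.d x)
        - (p.dy x ^ 2 - p.Λ ^ 2) * (P.a x + P.d x - 2 * P.c x)) := by
  have h1 := h.evolutionC_eq hp x
  obtain ⟨hX, hY, e1, e2, e3⟩ := cast_facts hp x
  rw [e1, e2, e3, hp.deriv_deriv_c, hp.deriv_c, hp.deriv_d, ← σ] at h1
  have hb : (p.b : ℂ) ≠ 0 := by exact_mod_cast hp.b_pos.ne'
  have hσ : (p.σ x : ℂ) ≠ 0 := by exact_mod_cast (hp.σ_pos x).ne'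
  push_cast at h1
  have hτ : (p.b : ℂ) / p.σ x * (p.σ x ^ 2 * (1 + ((p.cy x : ℂ) + p.dy x) ^ 2)) = 1 := by
    field_simp
    linear_combination hY
  linear_combination (p.σ x ^ 2 * (1 + ((p.cy x : ℂ) + p.dy x) ^ 2)) * h1
    - (p.w x ^ 2 * s ^ 2 * P.c x - (p.σ x ^ 2 * (2 * (p.cy x + p.dy x) * p.cy x + 1 + p.Λ ^ 2
        - p.cy x ^ 2) * (P.d x - P.a x + 2 * P.c x)
      + p.σ x * p.cy x * (deriv P.d x - deriv P.a x + 2 * deriv P.c x)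
      + 2 * p.σ x * (p.cy x + p.dy x) * deriv P.c x + deriv (deriv P.c) x)) * hτ
    + p.σ x ^ 2 * (p.dy x ^ 2 - p.Λ ^ 2) * (P.a x + P.d x - 2 * P.c x) * hY

/-- The gauge invariant form of the momentum constraint. -/
lemma hasDerivAt_gaugeC (h : p.IsMode s P) (hp : p.IsSubcriticalWormhole) (hs : s ≠ 0) (x : ℝ) :
    HasDerivAt (p.gaugeC P) (p.σ x * (p.cy x * (p.gaugeA P x - p.gaugeC P x)
      + p.dy x * p.gaugeC P x)) x := by
  obtain ⟨-, sa, sc, sΦ⟩ := h.contDiff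
  have hσ := (hp.hasDerivAt_σ x).ofReal_comp
  have hγ := (hp.hasDerivAt_cy x).ofReal_comp
  rw [← σ] at hγ
  have hc := contDiff_hasDerivAt_complex sc x
  have hξ := contDiff_hasDerivAt_complex (hp.contDiff_shift sΦ) x
  obtain ⟨hX, -⟩ := cast_facts hp x
  have hM := h.deriv_c_eq hp hs x
  rw [show p.gaugeC P = _ from funext (hp.gaugeC_eq P)]
  refine (hc.fun_sub ((hσ.fun_mul hγ).fun_mul hξ)).congr_deriv ?_
  rw [hp.gaugeA_eq sΦ]
  push_cast
  rw [hX]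
  linear_combination hM

lemma contDiff_gauge (h : p.IsMode s P) (hp : p.IsSubcriticalWormhole) :
    ContDiff ℝ ∞ (p.gaugeA P) ∧ ContDiff ℝ ∞ (p.gaugeC P) := by
  obtain ⟨-, sa, sc, sΦ⟩ := h.contDiff
  have hξ := hp.contDiff_shift sΦ
  have hξ' := (contDiff_infty_iff_deriv.1 hξ).2
  have hσ : ContDiff ℝ ∞ fun x => (p.σ x : ℂ) := Complex.ofRealCLM.contDiff.comp hp.contDiff_σ
  have hγ : ContDiff ℝ ∞ fun x => (p.cy x : ℂ) := Complex.ofRealCLM.contDiff.comp hp.contDiff_cy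
  have hδ : ContDiff ℝ ∞ fun x => (p.dy x : ℂ) := Complex.ofRealCLM.contDiff.comp hp.contDiff_dy
  rw [show p.gaugeA P = _ from funext (hp.gaugeA_eq sΦ),
    show p.gaugeC P = _ from funext (hp.gaugeC_eq P)]
  exact ⟨(sa.sub hξ').add ((hσ.mul hδ).mul hξ), sc.sub ((hσ.mul hγ).mul hξ)⟩

/-- The gauge invariant form of the evolution equation for `c`. -/
lemma cy_mul_deriv_gauge (h : p.IsMode s P) (hp : p.IsSubcriticalWormhole) (hs : s ≠ 0) (x : ℝ) :
    p.cy x * deriv (fun x => p.gaugeA P x - p.gaugeC P x) x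
      = p.σ x * (s ^ 2 * p.ρ x * p.gaugeC P x
        + (1 + p.Λ ^ 2 + p.cy x ^ 2 + p.cy x * p.dy x) * (p.gaugeA P x - p.gaugeC P x)
        - p.Λ ^ 2 * p.gaugeC P x) := by
  obtain ⟨-, sa, sc, sΦ⟩ := h.contDiff
  have hσ := (hp.hasDerivAt_σ x).ofReal_comp
  have hγ := (hp.hasDerivAt_cy x).ofReal_comp
  have hδ := (hp.hasDerivAt_dy x).ofReal_comp
  rw [← σ] at hγ hδ
  have hs1 := hp.contDiff_shift sΦ
  have ha := contDiff_hasDerivAt_complex sa x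
  have hc := contDiff_hasDerivAt_complex sc x
  have hξ := contDiff_hasDerivAt_complex hs1 x
  have hξ' := contDiff_hasDerivAt_complex (contDiff_infty_iff_deriv.1 hs1).2 x
  obtain ⟨hX, -⟩ := cast_facts hp x
  have hρ : (p.σ x : ℂ) ^ 2 * p.ρ x = p.w x ^ 2 := by
    have hb := hp.b_pos.ne'
    have hS := (hp.S_pos x).ne'
    have : p.σ x ^ 2 * p.ρ x = p.w x ^ 2 := by rw [σ, ρ]; field_simp
    exact_mod_cast this
  have hσ0 : (p.σ x : ℂ) ≠ 0 := by exact_mod_cast (hp.σ_pos x).ne'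
  have e : (fun x => p.gaugeA P x - p.gaugeC P x)
      = fun x => (P.a x - deriv (p.shift P) x + p.σ x * p.dy x * p.shift P x)
        - (P.c x - p.σ x * p.cy x * p.shift P x) :=
    funext fun x => by rw [hp.gaugeA_eq sΦ, hp.gaugeC_eq]
  rw [e, (((ha.fun_sub hξ').fun_add ((hσ.fun_mul hδ).fun_mul hξ)).fun_sub
    (hc.fun_sub ((hσ.fun_mul hγ).fun_mul hξ))).deriv, hp.gaugeA_eq sΦ, hp.gaugeC_eq]
  have hM := h.deriv_c_eq hp hs x
  have hM' := h.deriv_deriv_c_eq hp hs x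
  have hΦ := h.shift_eq hp x
  have hC := h.c_eq hp x
  push_cast
  rw [hX]
  refine mul_left_cancel₀ hσ0 ?_
  rw [← hρ] at hΦ hC
  -- Subtracting σ c_y times the Φ equation from the c equation removes the derivative of δd, and
  -- the coefficient of δd itself cancels identically. The momentum constraint and its derivative
  -- then eliminate the derivatives of δc.
  linear_combination (-1) * hC + (p.σ x * p.cy x : ℂ) * hΦ - hM'
    - (p.σ x : ℂ) * (2 * (p.cy x + p.dy x) + p.dy x) * hM

end IsMode

end Params

/-! ### The master equation for modes -/

namespace Params

variable {p : Params}

lemma IsSubcriticalWormhole.contDiff_masterVariable (hp : p.IsSubcriticalWormhole) {A C : ℝ → ℂ}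
    (hA : ContDiff ℝ ∞ A) (hC : ContDiff ℝ ∞ C) : ContDiff ℝ ∞ (p.masterVariable A C) := by
  have he : ContDiff ℝ ∞ fun x => (Real.exp (-p.c x) : ℂ) :=
    Complex.ofRealCLM.contDiff.comp hp.contDiff_c.neg.exp
  have hR : ContDiff ℝ ∞ fun x => (p.R x : ℂ) := Complex.ofRealCLM.contDiff.comp hp.contDiff_R
  exact (he.mul (hA.sub hC)).sub (hR.mul (he.mul hC))

lemma masterVariable_eq (p : Params) (A C : ℝ → ℂ) (x : ℝ) : p.masterVariable A C x
    = (Real.exp (-p.c x) : ℂ) * (A x - C x) - p.R x * ((Real.exp (-p.c x) : ℂ) * C x) := rfl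

namespace IsMode

variable {s : ℂ} {P : Profile}

/-- The relation between `χ` and `u₂`. -/
lemma cy_mul_deriv_masterVariable (h : p.IsMode s P) (hp : p.IsSubcriticalWormhole) (hs : s ≠ 0)
    (x : ℝ) : p.cy x * deriv (p.masterVariable (p.gaugeA P) (p.gaugeC P)) x
      = p.σ x * (s ^ 2 * p.ρ x * ((Real.exp (-p.c x) : ℂ) * p.gaugeC P x)
        - p.B x * p.masterVariable (p.gaugeA P) (p.gaugeC P) x) := by
  obtain ⟨sA, sC⟩ := h.contDiff_gauge hp
  have he := (hp.hasDerivAt_exp_neg_c x).ofReal_comp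
  have hR := (hp.hasDerivAt_R x).ofReal_comp
  have hC := h.hasDerivAt_gaugeC hp hs x
  have hV := contDiff_hasDerivAt_complex (sA.sub sC) x
  have h1 := h.cy_mul_deriv_gauge hp hs x
  rw [← σ] at he hR
  have hT : (1 + (p.Λ : ℂ) ^ 2) * p.R x - p.Λ ^ 2 = p.cy x * p.T x := by
    exact_mod_cast hp.R_mul_sub x
  rw [show p.masterVariable (p.gaugeA P) (p.gaugeC P) = _ from funext (p.masterVariable_eq _ _)]
  rw [((he.fun_mul hV).fun_sub (hR.fun_mul (he.fun_mul hC))).deriv, B]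
  push_cast [-Complex.ofReal_exp]
  -- Once A − C is written through χ and C, the coefficient of C besides s² ρ is c_y (T + c_y R −
  -- c_y R² − R_y), by `hT`, and this vanishes by the Riccati equation of R.
  linear_combination (Real.exp (-p.c x) : ℂ) * h1
    + (Real.exp (-p.c x) : ℂ) * p.gaugeC P x * p.σ x * hT

/-- The master variable of a mode solves the time-independent master equation. -/
lemma isSol_masterVariable (h : p.IsMode s P) (hp : p.IsSubcriticalWormhole) (hs : s ≠ 0) :
    IsSol p.w (fun x => (p.W x : ℂ) + s ^ 2) (p.masterVariable (p.gaugeA P) (p.gaugeC P))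
      (fun x => (p.w x : ℂ)⁻¹ * deriv (p.masterVariable (p.gaugeA P) (p.gaugeC P)) x) := by
  obtain ⟨sA, sC⟩ := h.contDiff_gauge hp
  have hχ := hp.contDiff_masterVariable sA sC
  have hI := h.cy_mul_deriv_masterVariable hp hs
  have hMV := p.masterVariable_eq (p.gaugeA P) (p.gaugeC P)
  set χ := p.masterVariable (p.gaugeA P) (p.gaugeC P)
  have hw0 : ∀ x, (p.w x : ℂ) ≠ 0 := fun x => by exact_mod_cast (p.w_pos x).ne'
  have hσ0 : ∀ x, (p.σ x : ℂ) ≠ 0 := fun x => by exact_mod_cast (hp.σ_pos x).ne'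
  set χ₁ : ℝ → ℂ := fun x => (((p.σ x)⁻¹ : ℝ) : ℂ) * deriv χ x with hχ₁
  have hσi : ContDiff ℝ ∞ fun x => (((p.σ x)⁻¹ : ℝ) : ℂ) :=
    Complex.ofRealCLM.contDiff.comp (hp.contDiff_σ.inv fun x => (hp.σ_pos x).ne')
  have hχ₁s : ContDiff ℝ ∞ χ₁ := hσi.mul (contDiff_infty_iff_deriv.1 hχ).2
  have hd : ∀ x, deriv χ x = p.σ x * χ₁ x := fun x => by
    simp only [hχ₁]; push_cast; rw [mul_inv_cancel_left₀ (hσ0 x)]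
  have hI' : ∀ x, (p.cy x : ℂ) * χ₁ x + p.B x * χ x
      = s ^ 2 * p.ρ x * ((Real.exp (-p.c x) : ℂ) * p.gaugeC P x) := fun x => by
    have := hI x
    rw [hd] at this
    refine mul_left_cancel₀ (hσ0 x) ?_
    linear_combination this
  have hcc : ∀ f : ℝ → ℝ, ContDiff ℝ ∞ f → Continuous fun x => (f x : ℂ) := fun f hf =>
    Complex.continuous_ofReal.comp hf.continuous
  have key : ∀ x, deriv χ₁ x
      = p.σ x * ((p.U x + s ^ 2 * p.ρ x) * χ x + 2 * p.cy x * χ₁ x) := by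
    -- Differentiating `hI'` and inserting the momentum constraint eliminates C, leaving the master
    -- equation multiplied by c_y.
    have k1 : ∀ x, (p.cy x : ℂ) * (deriv χ₁ x
        - p.σ x * ((p.U x + s ^ 2 * p.ρ x) * χ x + 2 * p.cy x * χ₁ x)) = 0 := fun x => by
      have he := (hp.hasDerivAt_exp_neg_c x).ofReal_comp
      have hγ := (hp.hasDerivAt_cy x).ofReal_comp
      have hB := (hp.hasDerivAt_B x).ofReal_comp
      have hρ := (hp.hasDerivAt_ρ x).ofReal_comp
      rw [← σ] at he hγ hB hρ
      have hC := h.hasDerivAt_gaugeC hp hs x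
      have d1 := (hγ.fun_mul (contDiff_hasDerivAt_complex hχ₁s x)).fun_add
        (hB.fun_mul (contDiff_hasDerivAt_complex hχ x))
      have d2 := (hρ.const_mul (s ^ 2)).fun_mul (he.fun_mul hC)
      rw [← funext hI'] at d2
      have d3 := d1.unique d2
      rw [hd] at d3
      have hBd : (p.B x : ℂ) = p.R x * p.cy x ^ 2 - p.cy x * p.dy x - 1 - p.Λ ^ 2 := by
        rw [B]; push_cast; ring
      push_cast [-Complex.ofReal_exp] at d3
      linear_combination d3 - p.σ x * (p.cy x * p.R x + 3 * p.cy x + p.dy x) * hI' x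
        - p.σ x * χ₁ x * hBd - p.σ x * p.cy x * s ^ 2 * p.ρ x * hMV x
    obtain ⟨x₀, h0, hpos, hneg⟩ := hp.exists_cy_sign
    have hU : ContDiff ℝ ∞ p.U := by
      have h1 := hp.contDiff_R
      have h2 := hp.contDiff_cy
      have h3 := hp.contDiff_dy
      unfold U; fun_prop
    have hρ : ContDiff ℝ ∞ p.ρ := by
      have h1 := hp.contDiff_w
      unfold ρ; fun_prop
    have c1 := hcc _ hU
    have c2 := hcc _ hρ
    have c3 := hcc _ hp.contDiff_σ
    have c4 := hcc _ hp.contDiff_cy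
    have c5 := hχ.continuous
    have c6 := hχ₁s.continuous
    have c7 : Continuous (deriv χ₁) := (contDiff_infty_iff_deriv.1 hχ₁s).2.continuous
    -- c_y vanishes only at x₀, so the equation holds on a dense set, and both sides are continuous.
    refine congrFun (Continuous.ext_on (dense_compl_singleton x₀) c7 (by fun_prop) fun x hx => ?_)
    have hx' : (p.cy x : ℂ) ≠ 0 := by
      rcases lt_or_gt_of_ne (show x ≠ x₀ from hx) with hlt | hgt
      · exact_mod_cast (hneg x hlt).ne
      · exact_mod_cast (hpos x hgt).ne'
    exact sub_eq_zero.1 ((mul_eq_zero.1 (k1 x)).resolve_left hx')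
  refine ⟨fun x => ?_, fun x => ?_⟩
  · refine (contDiff_hasDerivAt_complex hχ x).congr_deriv ?_
    rw [Complex.real_smul, mul_inv_cancel_left₀ (hw0 x)]
  · have hb := hp.b_pos.ne'
    have hS := (hp.S_pos x).ne'
    set q : ℝ → ℝ := fun x => (x ^ 2 + p.b ^ 2) * p.w x / p.b with hq
    have hq0 : ∀ x, q x ≠ 0 := fun x => by
      have := hp.S_pos x
      have := p.w_pos x
      have := hp.b_pos
      simp only [hq]
      positivity
    have hq0' : (q x : ℂ) ≠ 0 := by exact_mod_cast hq0 x
    have hσq : ∀ x, p.σ x * q x = p.w x := fun x => by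
      have hS := (hp.S_pos x).ne'
      simp only [hq, σ]; field_simp
    have hg : (fun x => (p.w x : ℂ)⁻¹ * deriv χ x) = fun x => ((((q x)⁻¹ : ℝ) : ℂ)) * χ₁ x := by
      funext x
      rw [hd, ← hσq x]
      have h1 := hσ0 x
      have h2 : (q x : ℂ) ≠ 0 := by exact_mod_cast hq0 x
      push_cast
      field_simp
    rw [hg]
    have dq : HasDerivAt (fun x => (((q x)⁻¹ : ℝ) : ℂ))
        ((-(p.σ x * (2 * p.cy x * q x)) / q x ^ 2 : ℝ) : ℂ) x :=
      ((hp.hasDerivAt_S_mul_w x).fun_inv (hq0 x)).ofReal_comp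
    refine (dq.fun_mul (contDiff_hasDerivAt_complex hχ₁s x)).congr_deriv ?_
    have hUW : (p.U x : ℂ) = p.W x * q x ^ 2 := by
      have : p.U x = p.W x * q x ^ 2 := (hp.W_mul_ρ x).symm
      exact_mod_cast this
    have hρq : (p.ρ x : ℂ) = q x ^ 2 := by
      have : p.ρ x = q x ^ 2 := rfl
      exact_mod_cast this
    rw [key, hUW, hρq, Complex.real_smul, ← hσq x]
    push_cast
    field_simp
    ring

/-- As s² ρ ≠ 0, the relation between χ and u₂ determines u₂ from χ, by the same formula that
defines `ampU₂`. Thus a mode whose χ is a multiple of ψ is that multiple of the reconstructed one.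
-/
lemma gaugeC_of_masterVariable (h : p.IsMode s P) (hp : p.IsSubcriticalWormhole) {β : ℝ}
    (hβ : 0 < β) (hsβ : s = β) {ψ π : ℝ → ℝ} (hψ : IsSol p.w (fun x => p.W x + β ^ 2) ψ π) {k : ℂ}
    (hk : ∀ x, p.masterVariable (p.gaugeA P) (p.gaugeC P) x = k * ψ x) (x : ℝ) :
    (Real.exp (-p.c x) : ℂ) * p.gaugeC P x = k * p.ampU₂ β ψ π x := by
  have hs : s ≠ 0 := by rw [hsβ]; exact_mod_cast hβ.ne'
  have h1 := h.cy_mul_deriv_masterVariable hp hs x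
  have h2 : (β ^ 2 * p.ρ x * p.ampU₂ β ψ π x : ℂ)
      = p.cy x * (((x ^ 2 + p.b ^ 2) * p.w x / p.b * π x : ℝ) : ℂ) + p.B x * ψ x := by
    exact_mod_cast hp.mul_ampU₂ hβ ψ π x
  have hd := ((hψ.hasDerivAt_fst_y hp x).ofReal_comp.const_mul k)
  rw [← σ] at hd
  rw [funext hk, hd.deriv, hsβ] at h1
  have hσ0 : (p.σ x : ℂ) ≠ 0 := by exact_mod_cast (hp.σ_pos x).ne'
  have hρ0 : (p.ρ x : ℂ) ≠ 0 := by exact_mod_cast (hp.ρ_pos x).ne'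
  have hβ0 : (β : ℂ) ≠ 0 := by exact_mod_cast hβ.ne'
  refine mul_left_cancel₀ (mul_ne_zero hσ0 (mul_ne_zero (pow_ne_zero 2 hβ0) hρ0)) ?_
  rw [Complex.ofReal_mul] at h1
  linear_combination -h1 - p.σ x * k * h2

/-- A mode with vanishing master variable is pure gauge. -/
lemma gauge_eq_zero (h : p.IsMode s P) (hp : p.IsSubcriticalWormhole) (hs : s ≠ 0)
    (h0 : p.masterVariable (p.gaugeA P) (p.gaugeC P) = 0) : p.gaugeA P = 0 ∧ p.gaugeC P = 0 := by
  have he : ∀ x, (Real.exp (-p.c x) : ℂ) ≠ 0 := fun x => by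
    exact_mod_cast (Real.exp_pos _).ne'
  have hC : ∀ x, p.gaugeC P x = 0 := fun x => by
    have h1 := h.cy_mul_deriv_masterVariable hp hs x
    have hσ0 : (p.σ x : ℂ) ≠ 0 := by exact_mod_cast (hp.σ_pos x).ne'
    have hρ0 : (p.ρ x : ℂ) ≠ 0 := by exact_mod_cast (hp.ρ_pos x).ne'
    rw [h0] at h1
    simpa [hσ0, hρ0, hs] using h1
  refine ⟨funext fun x => ?_, funext hC⟩
  have h1 := congrFun h0 x
  rw [masterVariable_eq, hC] at h1
  simpa using h1

end IsMode
end Params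

end GhostWormhole

end

/-! ### Assembly -/

theorem mainTheorem1 (p : Params) (hp : p.IsSubcriticalWormhole) :
    -- regularity of master equation II
    (∀ x, 0 < p.F x) ∧ ContDiff ℝ ∞ p.W ∧
    -- the zero mode, with exactly one node
    (ContDiff ℝ ∞ p.χ₀ ∧ (∀ x, p.schrodinger p.χ₀ x = 0) ∧
      p.IsEigenfunction 0 (fun x => (p.χ₀ x : ℂ)) ∧ ∃! x, p.χ₀ x = 0) ∧
    ∃ (β : ℝ) (χβ : ℝ → ℝ), 0 < β ∧ ContDiff ℝ ∞ χβ ∧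
      -- the unique negative eigenvalue and its eigenfunction
      {E : ℝ | E < 0 ∧ p.IsEigenvalue (E : ℂ)} = {-β ^ 2} ∧
      p.IsEigenfunction (-(β : ℂ) ^ 2) (fun x => (χβ x : ℂ)) ∧
      (∀ x, p.schrodinger χβ x = -β ^ 2 * χβ x) ∧
      -- the growing mode of master equation II, and its uniqueness
      p.MasterEquationII (fun t x => Real.exp (β * t) * χβ x) ∧
      (∀ (s : ℂ) (f : ℝ → ℂ), 0 < s.re → p.IsEigenfunction (-s ^ 2) f →
        s = β ∧ ∃ k : ℂ, f =ᵐ[p.μ] fun x => k * (χβ x : ℂ)) ∧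
      -- the growing mode of the linearized field equations, and its uniqueness
      ∃ A C w : ℝ → ℝ,
        ¬ (A = 0 ∧ C = 0) ∧
        p.FirstOrderSystem (fun t x => Real.exp (β * t) * χβ x)
          (fun t x => Real.exp (β * t) * (Real.exp (-p.c x) * (A x - C x)))
          (fun t x => Real.exp (β * t) * (Real.exp (-p.c x) * C x))
          (fun t x => Real.exp (β * t) * w x) ∧
        (∀ x, p.masterVariable (fun x => (A x : ℂ)) (fun x => (C x : ℂ)) x = (χβ x : ℂ)) ∧
        p.IsLinearizedSolution
          { d := fun t x => Real.exp (β * t) * (A x - 2 * C x)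
            a := fun t x => Real.exp (β * t) * A x
            c := fun t x => Real.exp (β * t) * C x
            Φ := fun _ _ => 0 } ∧
        ∀ (s : ℂ) (P : Profile), 0 < s.re → p.IsMode s P →
          MemLp (p.masterVariable (p.gaugeA P) (p.gaugeC P)) 2 p.μ →
          ¬ (p.gaugeA P = 0 ∧ p.gaugeC P = 0) →
          s = β ∧ ∃ k : ℂ, (∀ x, p.gaugeA P x = k * (A x : ℂ)) ∧
            ∀ x, p.gaugeC P x = k * (C x : ℂ) := by
  obtain ⟨w₀, w₁, C₀, R₀, hT⟩ := hp.exists_isTame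
  obtain ⟨x₀, hc0, hcpos, hcneg⟩ := hp.exists_cy_sign
  have hχ := hp.isSol_χ₀
  have hχeq := Params.IsSubcriticalWormhole.χ₀_eq p
  have hfac : ∀ x, 0 < Real.exp (-p.c x) / p.F x := fun x => div_pos (Real.exp_pos _) (hp.F_pos x)
  have hχ0 : p.χ₀ x₀ = 0 := by rw [hχeq, hc0, mul_zero]
  have hχpos : ∀ x, x₀ < x → 0 < p.χ₀ x := fun x hx => by
    rw [hχeq]; exact mul_pos (hfac x) (hcpos x hx)
  have hχneg : ∀ x, x < x₀ → p.χ₀ x < 0 := fun x hx => by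
    rw [hχeq]; exact mul_neg_of_pos_of_neg (hfac x) (hcneg x hx)
  -- At the zero of c_y, ∂χ₀ reduces to b e^{-3c} (1 + Λ²) / F, so the node is simple and χ₀ enters
  -- the right half-line increasing.
  have hv0 : 0 < Params.IsSubcriticalWormhole.zeroModeDel p x₀ := by
    have h1 := hp.F_pos x₀
    have h2 := hp.b_pos
    rw [Params.IsSubcriticalWormhole.zeroModeDel, hc0]
    simp only [zero_mul, add_zero, ne_eq, OfNat.ofNat_ne_zero, not_false_eq_true, zero_pow, sub_zero]
    positivity
  have hχi := hp.integrable_χ₀_sq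
  obtain ⟨β, hβ, ψ, π, hψ, hψpos, hψi⟩ := hT.exists_ground_state hχ hχ0 hv0 hχpos hχi
  have hψ' : IsSol p.w (fun x => (p.W x : ℂ) - -(β : ℂ) ^ 2) (fun x => (ψ x : ℂ))
      (fun x => (π x : ℂ)) := by
    simpa using hψ.ofReal
  have hψs := (hψ.contDiff hp.contDiff_w (by have := hp.contDiff_W; fun_prop)).1
  have hψe : p.IsEigenfunction (-(β : ℂ) ^ 2) (fun x => (ψ x : ℂ)) :=
    hp.isEigenfunction hψ' (by simpa using hψi) (x₀ := 0) (by exact_mod_cast (hψpos 0).ne')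
  have hschr : ∀ x, p.schrodinger ψ x = -β ^ 2 * ψ x := fun x => by
    rw [hψ.schrodinger_eq]; ring
  have huniq : ∀ (s : ℂ) (f : ℝ → ℂ), 0 < s.re → p.IsEigenfunction (-s ^ 2) f →
      s = β ∧ ∃ k : ℂ, f =ᵐ[p.μ] fun x => k * (ψ x : ℂ) := fun s f hs hf => by
    obtain ⟨u, v, huv, hfu⟩ := hp.exists_isSol hf.2
    have huv' : IsSol p.w (fun x => (p.W x : ℂ) + s ^ 2) u v := by simpa using huv
    have hu2 : MemLp u 2 volume := (memLp_congr_ae hfu).1 (hp.memLp_μ_iff.1 hf.2.1)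
    have hfu' : f =ᵐ[p.μ] u := by rw [Filter.EventuallyEq, hp.ae_μ]; exact hfu
    have hu0 : u ≠ 0 := fun h0 => hf.1 (by rw [h0] at hfu'; exact hfu')
    obtain ⟨h1, k, hk⟩ := hT.eq_ground_state hχ hχ0 hv0.ne' hχpos hχneg hβ hψ hψpos hψi hs huv'
      ((memLp_two_iff_integrable_sq_norm huv.continuous_fst.aestronglyMeasurable).1 hu2) hu0
    exact ⟨h1, k, hfu'.trans (Filter.Eventually.of_forall hk)⟩
  -- The witness for w is forced by the second equation of the first-order system, β u₂ = b e^{-2c}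
  -- w.
  refine ⟨hp.F_pos, hp.contDiff_W, ⟨hp.contDiff_χ₀, fun x => ?_, ?_, x₀, hχ0, fun x hx => ?_⟩,
    β, ψ, hβ, hψs, ?_, hψe, hschr, fun t x => ?_, huniq,
    fun x => p.ampC β ψ π x + p.ampAC β ψ π x, p.ampC β ψ π,
    fun x => β / (p.b * Real.exp (-2 * p.c x)) * p.ampU₂ β ψ π x, ?_, fun t x => ?_, fun x => ?_,
    hψ.isLinearizedSolution hp hβ, fun s P hs hP hL2 hne => ?_⟩
  · rw [hχ.schrodinger_eq]; ring
  · have hχ' : IsSol p.w (fun x => (p.W x : ℂ) - 0) (fun x => (p.χ₀ x : ℂ))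
        (fun x => (Params.IsSubcriticalWormhole.zeroModeDel p x : ℂ)) := by
      simpa using hχ.ofReal
    refine hp.isEigenfunction hχ' (by simpa using hχi) (x₀ := x₀ + 1) ?_
    exact_mod_cast (hχpos _ (by linarith)).ne'
  · rcases lt_trichotomy x x₀ with h | h | h
    · exact absurd hx (hχneg x h).ne
    · exact h
    · exact absurd hx (hχpos x h).ne'
  · ext E
    simp only [Set.mem_ofPred_eq, Set.mem_singleton_iff]
    constructor
    · rintro ⟨hE, f, hf⟩
      -- A negative eigenvalue is −s² with s = √(−E) > 0, so uniqueness of the growing mode applies.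
      have hs : (E : ℂ) = -((Real.sqrt (-E) : ℝ) : ℂ) ^ 2 := by
        rw [← Complex.ofReal_pow, Real.sq_sqrt (by linarith)]; simp
      rw [hs] at hf
      have h1 := (huniq _ f (by simpa using hE) hf).1
      rw [h1] at hs
      exact_mod_cast hs
    · rintro rfl
      exact ⟨by have := pow_pos hβ 2; linarith, _, by push_cast; exact hψe⟩
  · have h1 : HasDerivAt (fun s : ℝ => β * s) β t := by
      simpa using (hasDerivAt_id t).const_mul β
    have h2 : ∀ k : ℝ, (deriv fun s => Real.exp (β * s) * k) = fun s => Real.exp (β * s) * (β * k) :=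
      fun k => funext fun s => congrFun (congrFun (Dt_exp_mul β fun _ => k) s) 0
    have h3 : p.del (p.del fun x => Real.exp (β * t) * ψ x)
        = fun x => Real.exp (β * t) * p.del (p.del ψ) x := by
      have : ∀ (f : ℝ → ℝ), p.del (fun x => Real.exp (β * t) * f x)
          = fun x => Real.exp (β * t) * p.del f x := fun f => by
        funext x
        simp only [Params.del, deriv_const_mul_field]
        ring
      rw [this, this]
    have h4 := hschr x
    rw [Params.schrodinger] at h4
    simp only [h2, h3]
    linear_combination Real.exp (β * t) * h4
  · rintro ⟨hA, hC⟩
    have h1 : ∀ x, p.ampU₂ β ψ π x = 0 := fun x => by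
      have := congrFun hC x
      simpa [Params.ampC, (Real.exp_pos _).ne'] using this
    have h2 := congrFun hA 0
    simp only [Params.ampC, Params.ampAC, h1, mul_zero, add_zero, zero_add, Pi.zero_apply] at h2
    exact (mul_pos (Real.exp_pos _) (hψpos 0)).ne' h2
  · have hE : Real.exp (-p.c x) * Real.exp (p.c x) = 1 := by rw [← Real.exp_add]; simp
    have hE2 := (Real.exp_pos (-2 * p.c x)).ne'
    have hb := hp.b_pos.ne'
    have hd : ∀ k : ℝ, deriv (fun s => Real.exp (β * s) * k) t = Real.exp (β * t) * (β * k) :=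
      fun k => congrFun (congrFun (Dt_exp_mul β fun _ => k) t) 0
    have hdel : p.del (fun x => Real.exp (β * t) * ψ x) x = Real.exp (β * t) * π x := by
      rw [← hψ.del_fst]
      simp only [Params.del, deriv_const_mul_field]
      ring
    have hu := hp.mul_ampU₂ hβ ψ π x
    have hq : (x ^ 2 + p.b ^ 2) * p.w x / p.b = 1 / (p.b * Real.exp (-2 * p.c x)) := by
      have hw := (p.w_pos x).ne'
      have hS := (hp.S_pos x).ne'
      rw [hp.exp_neg_two_c]; field_simp
    rw [Params.ρ, hq, Params.B, Params.R] at hu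
    simp only [hd, hdel, Params.ampC, Params.ampAC, Params.R]
    refine ⟨?_, ?_, ?_⟩
    · field_simp
      linear_combination (ψ x + p.G x / p.H x * p.ampU₂ β ψ π x) * hE
    · field_simp
      linear_combination p.ampU₂ β ψ π x * hE
    · field_simp at hu ⊢
      linear_combination hu
  · have hE : Real.exp (-p.c x) * Real.exp (p.c x) = 1 := by rw [← Real.exp_add]; simp
    have h1 : Real.exp (-p.c x) * (p.ampC β ψ π x + p.ampAC β ψ π x - p.ampC β ψ π x)
        - p.R x * (Real.exp (-p.c x) * p.ampC β ψ π x) = ψ x := by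
      rw [Params.ampC, Params.ampAC]
      linear_combination ψ x * hE
    rw [p.masterVariable_eq]
    exact_mod_cast h1
  · have hs0 : s ≠ 0 := fun h => by simp [h] at hs
    have hsol := hP.isSol_masterVariable hp hs0
    obtain ⟨h1, k, hk⟩ := hT.eq_ground_state hχ hχ0 hv0.ne' hχpos hχneg hβ hψ hψpos hψi hs hsol
      ((memLp_two_iff_integrable_sq_norm hsol.continuous_fst.aestronglyMeasurable).1
        (hp.memLp_μ_iff.1 hL2)) fun h0 => hne (hP.gauge_eq_zero hp hs0 h0)
    have hC := hP.gaugeC_of_masterVariable hp hβ h1 hψ hk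
    have hEE : ∀ x, ((Real.exp (p.c x) : ℝ) : ℂ) * ((Real.exp (-p.c x) : ℝ) : ℂ) = 1 := fun x => by
      rw [← Complex.ofReal_mul, ← Real.exp_add]; simp
    refine ⟨h1, k, fun x => ?_, fun x => ?_⟩
    · have h2 := hk x
      rw [p.masterVariable_eq, hC] at h2
      have h3 := hC x
      have h4 := hEE x
      simp only [Params.ampC, Params.ampAC]
      push_cast [-Complex.ofReal_exp]
      linear_combination (Real.exp (p.c x) : ℂ) * h2 + (Real.exp (p.c x) : ℂ) * h3
        - p.gaugeA P x * h4
    · have h3 := hC x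
      have h4 := hEE x
      simp only [Params.ampC]
      push_cast [-Complex.ofReal_exp]
      linear_combination (Real.exp (p.c x) : ℂ) * h3 - p.gaugeC P x * h4
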